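/- **Conventions.** $\mathbb N=\{1,2,\dots\}$. Finite multisets of positive integers are ordered by $A\prec B$ iff $\Sigma(A)<\Sigma(B)$, or $\Sigma(A)=\Sigma(B)$ and at the smallest integer whose multiplicities in $A$ and $B$ differ the multiplicity in $A$ is smaller; here $\Sigma(A)$ is the sum of the elements of $A$ with multiplicity. $M_j$ is the $j$-th multiset in this order ($M_1=\emptyset$), and $z^{A}=\prod_{k\in A}z_k$. For real $x$, $\langle x\rangle$ is the unique $k\in\mathbb N$ with $x-\lfloor x\rfloor\in[1-2^{-k+1},1-2^{-k})$. A *graphon* is a symmetric measurable $W:[0,1)^2\to[0,1]$, and for a graph $H$ on $\{1,\dots,n\}$, $$\tau(H,W)=\int_{[0,1)^n}\prod_{ij\in E(H)}W(x_i,x_j)\prod_{ij\notin E(H)}(1-W(x_i,x_j))\,dx ,$$ the products being over unordered pairs $i\ne j$. **Totally analytic.** $f:[0,1]^{\mathbb N}\to\mathbb R$ is totally analytic if (i) for every finite multiset $M$ of positive integers the partial derivative $\partial^{|M|}f/(\partial z)^M$ exists on $[0,1]^{\mathbb N}$ (one-sided on the boundary, independent of the order of differentiation) and is continuous in the product topology;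 (ii) for every $n$ and every fixed $(z_{n+1},z_{n+2},\dots)\in[0,1]^{\mathbb N\setminus[n]}$ the function $(z_1,\dots,z_n)\mapsto f(z)$ extends to an analytic function on an open set containing $[0,1]^n$. **Bounding sequence.** $P=(p_i,l_i,u_i)_{i\in\mathbb N}$, where $p_i$ is a real polynomial in finitely many of the $z_k$ with coefficient $\pi_{i,j}$ at $z^{M_j}$, such that on $[0,1]^{\mathbb N}$ we have $p_i\in[0,1]$ and all first partial derivatives of $p_i$ lie in $[-1,1]$; $|\pi_{i,j}|\le 2^{-2^j}/9$; and $0\le l_i\le u_i\le1$. Write $\pi^+=\max(\pi,0)$, $\pi^-=\max(-\pi,0)$. A point $z\in[0,1]^{\mathbb N}$ is *feasible* if $p_i(z)\in[l_i,u_i]$ for all $i$. **The graphon $W_F$ (depending on $P$).** On $[0,2/3)^2\setminus[1/3,2/3)^2$ it is $1$ if $x,y\in[1/6,1/3)$ and $\langle3x\rangle=\langle3y\rangle$, or if $x\in[1/3,2/3)$, $y\in[1/6,1/3)$ and $M_{\langle3x\rangle}\in\{M_{\langle3y\rangle}\setminus\{m\},\{m\}\}$ with $m=\min M_{\langle 3y\rangle}$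 (one copy of $m$ is removed), or symmetrically; otherwise $0$. For $x\in[2/3,1)$ it is $9\cdot2^{2\langle3y\rangle}\pi^+_{\langle3x\rangle,\langle3y\rangle}$ if $y\in[0,1/3)$ and $9\cdot2^{2\langle3y\rangle}\pi^-_{\langle3x\rangle,\langle3y\rangle}$ if $y\in[1/3,2/3)$, and symmetrically for $y\in[2/3,1)$. On $[1/3,2/3)^2$ it is $1-u_{\langle3x\rangle}$, and on $[2/3,1)^2$ it is $l_{\langle3x\rangle}$, if $\langle3x\rangle=\langle3y\rangle$, and $0$ otherwise. **Host graphon.** $W_0$ is any graphon that contains $W_F$ in its seventh tile: with $\iota^0_k(x)=(k+x)/13$, $k=0,\dots,6$, we have $W_0(\iota^0_6(x),\iota^0_6(y))=W_F(x,y)$ for all $x,y\in[0,1)$. (The finitely forcible graphon of the Cooper–Král'–Martins theorem that contains $W_F$ is one such $W_0$; nothing else about $W_0$ is assumed.) **The graphon $W_P(z)$, $z\in[0,1]^{\mathbb N}$.** Split $[0,1)$ from left to right into intervals ("parts") $A,B,C,D_0,\dots,D_6,E,F,Q,R$, of length $1/25$ except $|Q|=12/25$; let $\iota_X:[0,1)\to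 X$ be the increasing affine bijection. The value $W_P(z)(\iota_X(x),\iota_Y(y))$ is as follows (symmetric tiles are omitted; it is $0$ where nothing is said). - $A\times Y$, $Y\in\{A,B,C,D_0,\dots,D_6,E\}$: $1$ if $\lfloor3x\rfloor=\lfloor3y\rfloor$. - $B\times Y$, $Y\in\{B,C,D_0,\dots,D_6,E\}$: $1$ if $\lfloor3x\rfloor=\lfloor3y\rfloor$ and $\langle3x\rangle=\langle3y\rangle$. - $C\times C$, for $x,y<2/3$ with $\langle3x\rangle=\langle3y\rangle=k$: $z^{M_k}$ if $\lfloor3x\rfloor=\lfloor3y\rfloor$, and $1-z^{M_k}$ otherwise. - $C\times D_0$: $1$ if $x\in[0,\frac13)$, $y\in[\frac13,\frac23)$, $\langle3x\rangle=\langle3y\rangle$. $C\times D_1$: $1$ if $x\in[0,\frac13)$, $y\in[\frac23,1)$, $\langle3x\rangle=\langle3y\rangle$. $C\times D_2$: $1$ if $x,y\in[0,\frac16)$. $C\times D_6$: $W_F(x,y)$ on $[0,\frac13)\times[0,\frac23)\cup[0,\frac23)\times[\frac23,1)$. - $C\times E$, with $k=\langle3x\rangle$, $a=2^k(3y-1)+2$,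 $b=2^k(3y-2)+2$: $1$ if $x,y\in[0,\frac13)$, $0\le a\le p_k(z)$; or $x\in[0,\frac13)$, $y\in[\frac13,\frac23)$, $0\le b\le1-p_k(z)$; or $x\in[\frac13,\frac23)$, $y\in[0,\frac13)$, $p_k(z)\le a\le1$; or $x,y\in[\frac13,\frac23)$, $1-p_k(z)\le b\le1$. - $D_i\times D_j$: $W_0(\iota^0_i(x),\iota^0_j(y))$. - $D_6\times E$, for $y\in[0,\frac13)$ and $\langle3x\rangle=\langle3y\rangle=k$: $1$ if $x\in[\frac13,\frac23)$ and $2^k(3y-1)+2\le u_k$, or if $x\in[\frac23,1)$ and $2^k(3y-1)+2\le l_k$. - $Y\times F$, $Y\in\{A,B,D_0,\dots,D_6,F\}$: $1$ if $x+y\ge1$. - $X\times Q$, $X$ one of the twelve parts $A,\dots,F$: $\frac1{12}\bigl(12-\sum_{Z}\int_0^1W_P(z)(\iota_X(x),\iota_Z(s))\,ds\bigr)$, the sum being over these twelve parts. - $Q\times Q$ and $Q\times R$: $1$. $X\times R$, $X$ the $k$-th of the twelve parts $A,\dots,F$: $k/25$. $R\times R$: $0$. **The function $t_{P,H}$ (for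 a given $W_0$).** Consider the following pieces $c$. Each has an interval $I_c$ and a polynomial $\mu_c$. - Each part $X\notin\{C,E\}$: $I_c=X$, $\mu_c=|X|$. - $C_{k,j}$, $j\in\{0,1,2\}$: $I_c=\{\iota_C(x):\lfloor3x\rfloor=j,\langle3x\rangle=k\}$, $\mu_c=2^{-k}/75$. - $E_{k,0,r}$, $r=0,1,2,3$: $I_c$ is the set of $\iota_E(y)$ with $\lfloor3y\rfloor=0$, $\langle3y\rangle=k$ and $2^k(3y-1)+2$ in $[0,l_k)$, $[l_k,u_k)$, $[l_k,u_k)$, $[u_k,1)$, respectively; $\mu_c$ is $2^{-k}/75$ times $l_k$, $p_k-l_k$, $u_k-p_k$, $1-u_k$, respectively. - $E_{k,1,r}$, $r=0,1$: $I_c=\{\iota_E(y):\lfloor3y\rfloor=1,\langle3y\rangle=k\}$, and $\mu_c$ is $2^{-k}/75$ times $1-p_k$, $p_k$, respectively. - $E_{k,2}$: $I_c=\{\iota_E(y):\lfloor3y\rfloor=2,\langle3y\rangle=k\}$, $\mu_c=2^{-k}/75$. For two pieces of $C\cup E$ let $e_{c,c'}=e_{c',c}$ be the following polynomial: $e=z^{M_k}$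 for $C_{k,j},C_{k,j}$ with $j\in\{0,1\}$; $e=1-z^{M_k}$ for $C_{k,0},C_{k,1}$; $e=1$ for the pairs $C_{k,0},E_{k,0,r}$ with $r\le1$, $C_{k,1},E_{k,0,r}$ with $r\ge2$, $C_{k,0},E_{k,1,0}$ and $C_{k,1},E_{k,1,1}$; $e=0$ for all other pairs. For a graph $H$ on $\{1,\dots,n\}$ and an assignment $L$ of pieces to its vertices, let $s_L$ be the probability that, for independent uniform $x_v\in I_{L(v)}$ (the endpoint if $I_{L(v)}$ is empty), the $W_P(0)$-random graph on $x_1,\dots,x_n$ agrees with $H$ on all pairs of vertices that are not both assigned to pieces of $C\cup E$. Put $$q_L(z)=s_L\prod_v\mu_{L(v)}(z)\prod_{ij\in E(H)}e_{L(i),L(j)}(z)\prod_{ij\notin E(H)}\bigl(1-e_{L(i),L(j)}(z)\bigr),$$ the last two products being over pairs of vertices both assigned to pieces of $C\cup E$. Let $\alpha_{P,i}$ be the sum over all $L$ of the coefficients of $q_L$ at $z^{M_i}$, and let $$t_{P,H}(z)=\sum_{i=1}^\infty\alpha_{P,i}\,z^{M_i}.$$ **Statement.** Let $H$ be a finite graph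 on $\{1,\dots,n\}$, $P$ a bounding sequence and $W_0$ a host graphon for $P$ as above. Then $W_P(z)$ is a graphon for every $z\in[0,1]^{\mathbb N}$; the series defining $\alpha_{P,i}$, $i\in\mathbb N$, and $t_{P,H}(z)$, $z\in[0,1]^{\mathbb N}$, converge absolutely; the function $t_{P,H}:[0,1]^{\mathbb N}\to\mathbb R$ is totally analytic; and $t_{P,H}(z)=\tau(H,W_P(z))$ for every $z\in[0,1]^{\mathbb N}$ with $p_i(z)\in[l_i,u_i]$ for all $i\in\mathbb N$. -/

import Mathlib

open Set MeasureTheory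

namespace GraphonFamily

noncomputable section

open scoped Classical

/-! ### Totally analytic functions on the Hilbert cube -/

/-- The cube `[0,1]^ℕ`, coordinates indexed by the positive integers, with the product topology. -/
abbrev Cube : Type := ℕ+ → Icc (0 : ℝ) 1

/-- The real coordinates of a point of the cube. -/
def Cube.val (z : Cube) : ℕ+ → ℝ := fun k => (z k : ℝ)

/-- `d` is the partial derivative of `f` at `z` in the `j`-th coordinate
(one-sided if `z j` is `0` or `1`). -/
def HasPartialDerivAt (f : Cube → ℝ) (j : ℕ+) (d : ℝ) (z : Cube) : Prop :=
  HasDerivWithinAt (fun s : ℝ => f (Function.update z j (projIcc 0 1 zero_le_one s)))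
    d (Icc 0 1) (z j)

/-- Replace the first `n` coordinates of `z` by `x`. -/
def replaceFirst (n : ℕ) (x : Fin n → Icc (0 : ℝ) 1) (z : Cube) : Cube :=
  fun k => if h : k.natPred < n then x ⟨k.natPred, h⟩ else z k

/-- Total analyticity: all iterated partial derivatives (indexed by finite multisets) exist and are
continuous in the product topology, and for every fixed tail the function of the first `n`
coordinates extends to an analytic function on an open set containing `[0,1]^n`. -/
structure TotallyAnalytic (f : Cube → ℝ) : Prop where
  partials : ∃ D : Multiset ℕ+ → Cube → ℝ, D 0 = f ∧
    (∀ (M : Multiset ℕ+) (j : ℕ+) (z : Cube), HasPartialDerivAt (D M) j (D (j ::ₘ M) z) z) ∧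
    ∀ M : Multiset ℕ+, Continuous (D M)
  analytic : ∀ (n : ℕ) (z₀ : Cube), ∃ (U : Set (Fin n → ℝ)) (g : (Fin n → ℝ) → ℝ),
    IsOpen U ∧ Icc 0 1 ⊆ U ∧ AnalyticOnNhd ℝ g U ∧
    ∀ x : Fin n → Icc (0 : ℝ) 1, g (fun i => (x i : ℝ)) = f (replaceFirst n x z₀)

/-! ### The enumeration `M₁, M₂, …` of finite multisets of positive integers

A finite multiset `A` of positive integers is represented by its multiplicity function
`ℕ+ →₀ ℕ`, so that it is also the exponent of the monomial `z^A`. -/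

/-- The sum `Σ(A)` of the elements of a multiset. -/
def msum (A : ℕ+ →₀ ℕ) : ℕ := A.sum fun n c => (n : ℕ) * c

/-- The strict part of the linear order on finite multisets of positive integers. -/
def Prec (A B : ℕ+ →₀ ℕ) : Prop :=
  msum A < msum B ∨ (msum A = msum B ∧ ∃ n : ℕ+, (∀ k < n, A k = B k) ∧ A n < B n)

theorem prec_irrefl (A : ℕ+ →₀ ℕ) : ¬ Prec A A := by
  rintro (h | ⟨_, n, _, h⟩) <;> exact lt_irrefl _ h

theorem prec_trans {A B C : ℕ+ →₀ ℕ} (h₁ : Prec A B) (h₂ : Prec B C) : Prec A C := by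
  rcases h₁ with h₁ | ⟨e₁, n, a₁, l₁⟩ <;> rcases h₂ with h₂ | ⟨e₂, m, a₂, l₂⟩
  · exact Or.inl (h₁.trans h₂)
  · exact Or.inl (e₂ ▸ h₁)
  · exact Or.inl (e₁ ▸ h₂)
  · refine Or.inr ⟨e₁.trans e₂, min n m, fun k hk => ?_, ?_⟩
    · rw [a₁ k (hk.trans_le (min_le_left _ _)), a₂ k (hk.trans_le (min_le_right _ _))]
    · rcases lt_trichotomy n m with h | h | h
      · rw [min_eq_left h.le, ← a₂ n h]; exact l₁
      · subst h; rw [min_self]; exact l₁.trans l₂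
      · rw [min_eq_right h.le, a₁ m h]; exact l₂

theorem prec_total {A B : ℕ+ →₀ ℕ} (h : A ≠ B) : Prec A B ∨ Prec B A := by
  rcases lt_trichotomy (msum A) (msum B) with h₁ | h₁ | h₁
  · exact Or.inl (Or.inl h₁)
  · have hne : ∃ n : ℕ+, A n ≠ B n := by
      by_contra hc
      push Not at hc
      exact h (Finsupp.ext hc)
    have hmin := PNat.find_spec hne
    have hlt : ∀ k < PNat.find hne, A k = B k := fun k hk => by
      by_contra hc
      exact PNat.find_min hne hk hc
    rcases lt_or_gt_of_ne hmin with h₂ | h₂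
    · exact Or.inl (Or.inr ⟨h₁, _, hlt, h₂⟩)
    · exact Or.inr (Or.inr ⟨h₁.symm, _, fun k hk => (hlt k hk).symm, h₂⟩)
  · exact Or.inr (Or.inl h₁)

theorem mul_le_msum (A : ℕ+ →₀ ℕ) (n : ℕ+) : (n : ℕ) * A n ≤ msum A := by
  by_cases h : n ∈ A.support
  · exact Finset.single_le_sum (f := fun n : ℕ+ => (n : ℕ) * A n) (fun _ _ => Nat.zero_le _) h
  · rw [Finsupp.notMem_support_iff.mp h]; simp

theorem finite_prec (A : ℕ+ →₀ ℕ) : {B | Prec B A}.Finite := by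
  let N : ℕ := msum A
  let T : Finset ℕ+ := Finset.Icc 1 (N.succPNat)
  refine ((Finset.finite_toSet (T.finsupp fun _ => Finset.range (N + 1)))).subset ?_
  intro B hB
  have hs : msum B ≤ N := by
    rcases hB with h | ⟨h, -⟩
    · exact h.le
    · exact h.le
  have hb := mul_le_msum B
  rw [Finset.mem_coe, Finset.mem_finsupp_iff]
  refine ⟨fun n hn => ?_, fun n _ => ?_⟩
  · have h1 : 1 ≤ B n := Nat.one_le_iff_ne_zero.mpr (Finsupp.mem_support_iff.mp hn)
    have h2 : (n : ℕ) ≤ N := by nlinarith [hb n]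
    refine Finset.mem_Icc.mpr ⟨one_le, ?_⟩
    rw [← PNat.coe_le_coe, Nat.succPNat_coe]
    omega
  · have h3 : 1 ≤ (n : ℕ) := n.pos
    have h4 : B n ≤ N := by nlinarith [hb n]
    exact Finset.mem_range.mpr (by omega)

/-- The (zero-based) position of a multiset in the linear order. -/
def rank (A : ℕ+ →₀ ℕ) : ℕ := {B | Prec B A}.ncard

theorem rank_lt {A B : ℕ+ →₀ ℕ} (h : Prec A B) : rank A < rank B := by
  refine Set.ncard_lt_ncard ?_ (finite_prec B)
  refine ⟨fun C hC => prec_trans hC h, fun hsub => ?_⟩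
  exact prec_irrefl A (hsub h)

theorem rank_injective : Function.Injective rank := by
  intro A B h
  by_contra hne
  rcases prec_total hne with h' | h'
  · exact absurd h (rank_lt h').ne
  · exact absurd h (rank_lt h').ne'

theorem rank_surjective : Function.Surjective rank := by
  intro n
  obtain ⟨A, hA⟩ : ∃ A, n < rank A := by
    have hinf : (Set.range rank).Infinite := Set.infinite_range_of_injective rank_injective
    obtain ⟨_, ⟨A, rfl⟩, hA⟩ := hinf.exists_gt n
    exact ⟨A, hA⟩
  have him : rank '' {B | Prec B A} ⊆ Set.Iio (rank A) := by
    rintro _ ⟨B, hB, rfl⟩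
    exact rank_lt hB
  have heq : rank '' {B | Prec B A} = Set.Iio (rank A) := by
    refine Set.eq_of_subset_of_ncard_le him ?_ (Set.finite_Iio _)
    rw [Set.ncard_image_of_injective _ rank_injective]
    have : (Set.Iio (rank A)).ncard = rank A := by
      rw [← Nat.card_coe_set_eq]; simp
    rw [this]; exact le_rfl
  obtain ⟨B, -, hB⟩ : n ∈ rank '' {B | Prec B A} := heq ▸ hA
  exact ⟨B, hB⟩

/-- `multiset j` is `M_j`, the `j`-th multiset in the linear order (`M₁ = ∅`). -/
def multiset (j : ℕ+) : ℕ+ →₀ ℕ :=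
  (Equiv.ofBijective rank ⟨rank_injective, rank_surjective⟩).symm j.natPred

/-- The value `z^A` of the monomial with exponent `A`. -/
def monomialValue (A : ℕ+ →₀ ℕ) (z : Cube) : ℝ := A.prod fun k e => z.val k ^ e

/-! ### Bounding sequences -/

/-- A bounding sequence `(p_i, l_i, u_i)`, `i` a positive integer. -/
structure BoundingSequence where
  p : ℕ+ → MvPolynomial ℕ+ ℝ
  l : ℕ+ → ℝ
  u : ℕ+ → ℝ
  p_mem : ∀ (i : ℕ+) (z : Cube), MvPolynomial.eval z.val (p i) ∈ Icc (0 : ℝ) 1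
  coeff_le : ∀ i j : ℕ+, |(p i).coeff (multiset j)| ≤ (1 / 2 : ℝ) ^ (2 ^ (j : ℕ)) / 9
  pderiv_mem : ∀ (i k : ℕ+) (z : Cube),
    MvPolynomial.eval z.val (MvPolynomial.pderiv k (p i)) ∈ Icc (-1 : ℝ) 1
  l_mem : ∀ i, l i ∈ Icc (0 : ℝ) 1
  u_mem : ∀ i, u i ∈ Icc (0 : ℝ) 1
  l_le_u : ∀ i, l i ≤ u i

namespace BoundingSequence

variable (P : BoundingSequence)

/-- The value `p_i(z)`. -/
def pval (i : ℕ+) (z : Cube) : ℝ := MvPolynomial.eval z.val (P.p i)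

/-- The coefficient `π_{i,j}` of `p_i` at `z^{M_j}`. -/
def coeff (i j : ℕ+) : ℝ := (P.p i).coeff (multiset j)

/-- The positive part of `π_{i,j}`. -/
def coeffPos (i j : ℕ+) : ℝ := max (P.coeff i j) 0

/-- The negative part of `π_{i,j}`. -/
def coeffNeg (i j : ℕ+) : ℝ := max (-P.coeff i j) 0

/-- `z` satisfies all the constraints `p_i(z) ∈ [l_i, u_i]`. -/
def Feasible (z : Cube) : Prop := ∀ i, P.pval i z ∈ Icc (P.l i) (P.u i)

end BoundingSequence

/-! ### Graphons and labeled densities -/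

/-- A graphon: a symmetric measurable function `[0,1)² → [0,1]`. Only the values of `W` on
`[0,1)²` are relevant. -/
structure IsGraphon (W : ℝ → ℝ → ℝ) : Prop where
  measurable : Measurable fun q : Ico (0 : ℝ) 1 × Ico (0 : ℝ) 1 => W q.1 q.2
  symm : ∀ x ∈ Ico (0 : ℝ) 1, ∀ y ∈ Ico (0 : ℝ) 1, W x y = W y x
  mem : ∀ x ∈ Ico (0 : ℝ) 1, ∀ y ∈ Ico (0 : ℝ) 1, W x y ∈ Icc (0 : ℝ) 1

/-- The pairs of distinct vertices, each listed once. -/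
def vertexPairs (n : ℕ) : Finset (Fin n × Fin n) :=
  Finset.univ.filter fun q => q.1 < q.2

/-- The unit cube `[0,1)^n`. -/
def unitBox (n : ℕ) : Set (Fin n → ℝ) := Set.univ.pi fun _ => Ico (0 : ℝ) 1

/-- The labeled density `τ(H, W)`. -/
def labeledDensity {n : ℕ} (H : SimpleGraph (Fin n)) (W : ℝ → ℝ → ℝ) : ℝ :=
  ∫ x in unitBox n, ∏ q ∈ vertexPairs n,
    if H.Adj q.1 q.2 then W (x q.1) (x q.2) else 1 - W (x q.1) (x q.2)

/-! ### The auxiliary graphon `W_F` -/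

/-- The interval `J_k = [1 - 2^{-k+1}, 1 - 2^{-k})`. -/
def J (k : ℕ+) : Set ℝ := Ico (1 - 2 * (1 / 2 : ℝ) ^ (k : ℕ)) (1 - (1 / 2 : ℝ) ^ (k : ℕ))

/-- The unique `k` such that `x - ⌊x⌋ ∈ J_k`, see `coord_eq_iff`. -/
def coord (x : ℝ) : ℕ+ := (Nat.log 2 ⌊(1 - Int.fract x)⁻¹⌋₊).succPNat

theorem coord_eq_iff (x : ℝ) (k : ℕ+) : coord x = k ↔ Int.fract x ∈ J k := by
  obtain ⟨m, rfl⟩ : ∃ m : ℕ, k = m.succPNat := ⟨k.natPred, (PNat.succPNat_natPred k).symm⟩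
  have hf := Int.fract_lt_one x
  set y : ℝ := 1 - Int.fract x with hy
  have hy0 : 0 < y := by linarith
  have hy1 : y ≤ 1 := by have := Int.fract_nonneg x; linarith
  have hfl : ⌊y⁻¹⌋₊ ≠ 0 := by
    have : (1 : ℝ) ≤ y⁻¹ := (one_le_inv₀ hy0).mpr hy1
    have := Nat.floor_pos.mpr this
    omega
  have h1 : coord x = m.succPNat ↔ Nat.log 2 ⌊y⁻¹⌋₊ = m := by
    unfold coord
    exact Nat.succPNat_injective.eq_iff
  have hx : Int.fract x = 1 - y := by rw [hy]; ring
  rw [h1, Nat.log_eq_iff (Or.inr ⟨by norm_num, hfl⟩), hx, Nat.le_floor_iff (by positivity),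
    Nat.floor_lt (by positivity)]
  simp only [J, mem_Ico, Nat.succPNat_coe, Nat.succ_eq_add_one]
  push_cast
  rw [le_inv_comm₀ (by positivity) hy0, inv_lt_comm₀ hy0 (by positivity)]
  simp only [one_div, inv_pow]
  have h2 : 2 * ((2 : ℝ) ^ (m + 1))⁻¹ = ((2 : ℝ) ^ m)⁻¹ := by
    rw [pow_succ]; field_simp
  rw [h2]
  constructor <;> rintro ⟨ha, hb⟩ <;> constructor <;> linarith

/-- With `a = min B`: either `A = B \ {a}` (one copy of `a` removed) or `A = {a}`. -/
def Linked (A B : ℕ+ →₀ ℕ) : Prop :=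
  ∃ a : ℕ+, IsLeast {k : ℕ+ | B k ≠ 0} a ∧
    (A = B - Finsupp.single a 1 ∨ A = Finsupp.single a 1)

/-- The graphon `W_F` on `[0,1)²`. -/
def WF (P : BoundingSequence) (x y : ℝ) : ℝ :=
  if x < 2 / 3 ∧ y < 2 / 3 ∧ ¬ (1 / 3 ≤ x ∧ 1 / 3 ≤ y) then
    if (x ∈ Ico (1 / 6) (1 / 3) ∧ y ∈ Ico (1 / 6) (1 / 3) ∧ coord (3 * x) = coord (3 * y)) ∨
      (x ∈ Ico (1 / 3) (2 / 3) ∧ y ∈ Ico (1 / 6) (1 / 3) ∧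
        Linked (multiset (coord (3 * x))) (multiset (coord (3 * y)))) ∨
      (y ∈ Ico (1 / 3) (2 / 3) ∧ x ∈ Ico (1 / 6) (1 / 3) ∧
        Linked (multiset (coord (3 * y))) (multiset (coord (3 * x))))
    then 1 else 0
  else if 2 / 3 ≤ x ∧ y < 1 / 3 then
    9 * 2 ^ (2 * (coord (3 * y) : ℕ)) * P.coeffPos (coord (3 * x)) (coord (3 * y))
  else if 2 / 3 ≤ x ∧ y < 2 / 3 then
    9 * 2 ^ (2 * (coord (3 * y) : ℕ)) * P.coeffNeg (coord (3 * x)) (coord (3 * y))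
  else if x < 1 / 3 ∧ 2 / 3 ≤ y then
    9 * 2 ^ (2 * (coord (3 * x) : ℕ)) * P.coeffPos (coord (3 * y)) (coord (3 * x))
  else if x < 2 / 3 ∧ 2 / 3 ≤ y then
    9 * 2 ^ (2 * (coord (3 * x) : ℕ)) * P.coeffNeg (coord (3 * y)) (coord (3 * x))
  else if x < 2 / 3 ∧ y < 2 / 3 then
    if coord (3 * x) = coord (3 * y) then 1 - P.u (coord (3 * x)) else 0
  else
    if coord (3 * x) = coord (3 * y) then P.l (coord (3 * x)) else 0

/-! ### The graphons `W_P(z)` -/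

/-- The parts `A, B, C, D_A, …, D_G, E, F`; the parts `D_A, …, D_G` are `D 0, …, D 6`. -/
inductive Core : Type
  | A | B | C
  | D (k : Fin 7)
  | E | F

/-- All fourteen parts. -/
inductive Part : Type
  | core (X : Core)
  | Q | R

/-- The position of a part in the list `A, B, C, D_A, …, D_G, E, F`, starting from `0`. -/
def Core.idx : Core → ℕ
  | .A => 0
  | .B => 1
  | .C => 2
  | .D k => 3 + k
  | .E => 10
  | .F => 11

/-- The left endpoint of a part. -/
def Part.start : Part → ℝ
  | .core X => X.idx / 25
  | .Q => 12 / 25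
  | .R => 24 / 25

/-- The length of a part. -/
def Part.size : Part → ℝ
  | .core _ => 1 / 25
  | .Q => 12 / 25
  | .R => 1 / 25

/-- The linear map `ι_X` from `[0,1)` onto the part `X`. -/
def Part.embed (X : Part) (x : ℝ) : ℝ := X.start + X.size * x

/-- The part containing a point of `[0,1)`. -/
def partOf (s : ℝ) : Part :=
  if s < 1 / 25 then .core .A
  else if s < 2 / 25 then .core .B
  else if s < 3 / 25 then .core .C
  else if h : 3 ≤ ⌊25 * s⌋₊ ∧ ⌊25 * s⌋₊ < 10 then .core (.D ⟨⌊25 * s⌋₊ - 3, by omega⟩)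
  else if s < 11 / 25 then .core .E
  else if s < 12 / 25 then .core .F
  else if s < 24 / 25 then .Q
  else .R

theorem partOf_embed (X : Part) {x : ℝ} (hx : x ∈ Ico (0 : ℝ) 1) : partOf (X.embed x) = X := by
  obtain ⟨h0, h1⟩ := hx
  rcases X with (_ | _ | _ | k | _ | _) | _ | _
  case core.D =>
    have hk : (k : ℕ) < 7 := k.2
    have hk' : ((k : ℕ) : ℝ) < 7 := by exact_mod_cast hk
    have hk0 : (0 : ℝ) ≤ ((k : ℕ) : ℝ) := Nat.cast_nonneg _
    have hs : (Part.core (Core.D k)).embed x = (3 + (k : ℕ) + x) / 25 := by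
      simp only [Part.embed, Part.start, Part.size, Core.idx]; push_cast; ring
    have hfl : ⌊25 * ((3 + ((k : ℕ) : ℝ) + x) / 25)⌋₊ = 3 + (k : ℕ) := by
      rw [Nat.floor_eq_iff (by positivity)]
      push_cast
      constructor <;> linarith
    rw [hs]
    unfold partOf
    rw [if_neg (by linarith), if_neg (by linarith), if_neg (by linarith),
      dif_pos (by rw [hfl]; omega)]
    congr 2
    ext
    simp only [hfl]
    omega
  all_goals
    simp only [Part.embed, Part.start, Part.size, Core.idx]
    unfold partOf
    push_cast
  case core.A => rw [if_pos (by linarith)]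
  case core.B => rw [if_neg (by linarith), if_pos (by linarith)]
  case core.C => rw [if_neg (by linarith), if_neg (by linarith), if_pos (by linarith)]
  all_goals
    rw [if_neg (by linarith), if_neg (by linarith), if_neg (by linarith), dif_neg]
  case core.E.hnc | core.F.hnc | Q.hnc | R.hnc =>
    rintro ⟨-, h⟩
    rw [Nat.floor_lt (by positivity)] at h
    push_cast at h
    linarith
  · rw [if_pos (by linarith)]
  · rw [if_neg (by linarith), if_pos (by linarith)]
  · rw [if_neg (by linarith), if_neg (by linarith), if_pos (by linarith)]
  · rw [if_neg (by linarith), if_neg (by linarith), if_neg (by linarith)]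

/-- The linear map from `[0,1)` onto the `k`-th of the parts `A, …, G` of the host graphon `W₀`,
whose ten parts `A, …, G, P, Q, R` have size `1/13` except `Q`. -/
def hostEmbed (k : Fin 7) (x : ℝ) : ℝ := ((k : ℕ) + x) / 13

section Graphon

variable (P : BoundingSequence) (W₀ : ℝ → ℝ → ℝ) (z : Cube)

/-- The tile `C × C`. -/
def tileCC (x y : ℝ) : ℝ :=
  if x < 2 / 3 ∧ y < 2 / 3 ∧ coord (3 * x) = coord (3 * y) then
    if ⌊3 * x⌋ = ⌊3 * y⌋ then monomialValue (multiset (coord (3 * x))) z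
    else 1 - monomialValue (multiset (coord (3 * x))) z
  else 0

/-- The tiles `C × D_A, …, C × D_G`. -/
def tileCD (k : Fin 7) (x y : ℝ) : ℝ :=
  if k = 0 then
    if x < 1 / 3 ∧ y ∈ Ico (1 / 3) (2 / 3) ∧ coord (3 * x) = coord (3 * y) then 1 else 0
  else if k = 1 then
    if x < 1 / 3 ∧ 2 / 3 ≤ y ∧ coord (3 * x) = coord (3 * y) then 1 else 0
  else if k = 2 then
    if x < 1 / 6 ∧ y < 1 / 6 then 1 else 0
  else if k = 6 then
    if (x < 1 / 3 ∧ y < 2 / 3) ∨ (x < 2 / 3 ∧ 2 / 3 ≤ y) then WF P x y else 0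
  else 0

/-- The tile `C × E`. -/
def tileCE (x y : ℝ) : ℝ :=
  let k := coord (3 * x)
  let a := 2 ^ (k : ℕ) * (3 * y - 1) + 2
  let b := 2 ^ (k : ℕ) * (3 * y - 2) + 2
  if (x < 1 / 3 ∧ y < 1 / 3 ∧ 0 ≤ a ∧ a ≤ P.pval k z) ∨
    (x < 1 / 3 ∧ y ∈ Ico (1 / 3) (2 / 3) ∧ 0 ≤ b ∧ b ≤ 1 - P.pval k z) ∨
    (x ∈ Ico (1 / 3) (2 / 3) ∧ y < 1 / 3 ∧ P.pval k z ≤ a ∧ a ≤ 1) ∨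
    (x ∈ Ico (1 / 3) (2 / 3) ∧ y ∈ Ico (1 / 3) (2 / 3) ∧ 1 - P.pval k z ≤ b ∧ b ≤ 1)
  then 1 else 0

/-- The tile `D_G × E`. -/
def tileGE (x y : ℝ) : ℝ :=
  let k := coord (3 * y)
  let a := 2 ^ (k : ℕ) * (3 * y - 1) + 2
  if y < 1 / 3 ∧ coord (3 * x) = k ∧
    ((x ∈ Ico (1 / 3) (2 / 3) ∧ a ≤ P.u k) ∨ (2 / 3 ≤ x ∧ a ≤ P.l k))
  then 1 else 0

/-- The tiles `X × Y` with `X` not after `Y` in the list `A, B, C, D_A, …, D_G, E, F`. -/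
def upperTile : Core → Core → ℝ → ℝ → ℝ
  | .A, .F, x, y => if 1 ≤ x + y then 1 else 0
  | .B, .F, x, y => if 1 ≤ x + y then 1 else 0
  | .D _, .F, x, y => if 1 ≤ x + y then 1 else 0
  | .F, .F, x, y => if 1 ≤ x + y then 1 else 0
  | .A, _, x, y => if ⌊3 * x⌋ = ⌊3 * y⌋ then 1 else 0
  | .B, _, x, y => if ⌊3 * x⌋ = ⌊3 * y⌋ ∧ coord (3 * x) = coord (3 * y) then 1 else 0
  | .C, .C, x, y => tileCC z x y
  | .C, .D k, x, y => tileCD P k x y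
  | .C, .E, x, y => tileCE P z x y
  | .D j, .D k, x, y => W₀ (hostEmbed j x) (hostEmbed k y)
  | .D k, .E, x, y => if k = 6 then tileGE P x y else 0
  | _, _, _, _ => 0

/-- `W_P(ι_X(x), ι_Y(y))` for the parts `A, B, C, D_A, …, D_G, E, F`. -/
def coreTile (X Y : Core) (x y : ℝ) : ℝ :=
  if X.idx ≤ Y.idx then upperTile P W₀ z X Y x y else upperTile P W₀ z Y X y x

/-- The sum of the twelve relative degrees of `ι_X(x)` in the parts `A, …, F`. -/
def coreDegree (X : Core) (x : ℝ) : ℝ :=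
  let d : Core → ℝ := fun Y => ∫ s in Ico (0 : ℝ) 1, coreTile P W₀ z X Y x s
  d .A + d .B + d .C + ∑ k : Fin 7, d (.D k) + d .E + d .F

/-- `W_P(ι_X(x), ι_Y(y))` for all parts. -/
def tile : Part → Part → ℝ → ℝ → ℝ
  | .core X, .core Y, x, y => coreTile P W₀ z X Y x y
  | .core X, .Q, x, _ => (12 - coreDegree P W₀ z X x) / 12
  | .Q, .core Y, _, y => (12 - coreDegree P W₀ z Y y) / 12
  | .core X, .R, _, _ => ((X.idx : ℝ) + 1) / 25
  | .R, .core Y, _, _ => ((Y.idx : ℝ) + 1) / 25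
  | .Q, .Q, _, _ => 1
  | .Q, .R, _, _ => 1
  | .R, .Q, _, _ => 1
  | .R, .R, _, _ => 0

/-- The graphon `W_P(z)`, built with the host graphon `W₀` in the tiles `D_Z × D_{Z'}`. -/
def WP (s t : ℝ) : ℝ :=
  tile P W₀ z (partOf s) (partOf t) ((s - (partOf s).start) / (partOf s).size)
    ((t - (partOf t).start) / (partOf t).size)

theorem WP_embed (X Y : Part) {x y : ℝ} (hx : x ∈ Ico (0 : ℝ) 1) (hy : y ∈ Ico (0 : ℝ) 1) :
    WP P W₀ z (X.embed x) (Y.embed y) = tile P W₀ z X Y x y := by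
  have hsize : ∀ X : Part, X.size ≠ 0 := by
    rintro (_ | _ | _) <;> norm_num [Part.size]
  have h : ∀ (X : Part) (x : ℝ), (X.embed x - X.start) / X.size = x := fun X x => by
    rw [Part.embed, add_sub_cancel_left, mul_div_cancel_left₀ _ (hsize X)]
  rw [WP, partOf_embed X hx, partOf_embed Y hy, h, h]

end Graphon

/-! ### The functions `t_{P,H}` -/

/-- The pieces into which `[0,1)` is split:
* the parts `A, B, D_A, …, D_G, F, Q, R`;
* `C k j`, the points `ι_C(x)` with `⌊3x⌋ = j` and `coord (3x) = k`;
* `E₁ k i`, the points `ι_E(y)` with `⌊3y⌋ = 0` and `coord (3y) = k`, whose relative position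
  `2^k (3y - 1) + 2` lies between the consecutive terms number `i` and `i + 1` of
  `0 ≤ l_k ≤ p_k(z) ≤ u_k ≤ 1`;
* `E₂ k i`, the points `ι_E(y)` with `⌊3y⌋ = 1` and `coord (3y) = k`, whose relative position
  `2^k (3y - 2) + 2` is below (`i = 0`) or above (`i = 1`) `1 - p_k(z)`;
* `E₃ k`, the points `ι_E(y)` with `⌊3y⌋ = 2` and `coord (3y) = k`. -/
inductive Cell : Type
  | A | B
  | D (k : Fin 7)
  | F | Q | R
  | C (k : ℕ+) (j : Fin 3)
  | E₁ (k : ℕ+) (i : Fin 4)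
  | E₂ (k : ℕ+) (i : Fin 2)
  | E₃ (k : ℕ+)

/-- The part containing a piece. -/
def Cell.part : Cell → Part
  | .A => .core .A
  | .B => .core .B
  | .D k => .core (.D k)
  | .F => .core .F
  | .Q => .Q
  | .R => .R
  | .C _ _ => .core .C
  | .E₁ _ _ => .core .E
  | .E₂ _ _ => .core .E
  | .E₃ _ => .core .E

/-- The pieces of the parts `C` and `E`. -/
def Cell.InCE : Cell → Prop
  | .C _ _ => True
  | .E₁ _ _ => True
  | .E₂ _ _ => True
  | .E₃ _ => True
  | _ => False

/-- The left endpoint of `{x ∈ [0,1) | ⌊3x⌋ = j, coord (3x) = k}`, an interval of length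
`2^{-k} / 3`. -/
def blockStart (k : ℕ+) (j : ℕ) : ℝ := ((j : ℝ) + 1 - 2 * (1 / 2) ^ (k : ℕ)) / 3

section Density

variable (P : BoundingSequence) (W₀ : ℝ → ℝ → ℝ)

/-- The left endpoint, in the coordinate of its part, of the smallest interval independent of `z`
that contains the piece: the relative positions of `E₁ k 1` and `E₁ k 2` are enlarged to
`[l_k, u_k)`, those of `E₂ k i` to `[0, 1)`. -/
def Cell.lo : Cell → ℝ
  | .C k j => blockStart k j
  | .E₁ k i => blockStart k 0 + (1 / 2) ^ (k : ℕ) / 3 * ![0, P.l k, P.l k, P.u k] i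
  | .E₂ k _ => blockStart k 1
  | .E₃ k => blockStart k 2
  | _ => 0

/-- The right endpoint of the interval of `Cell.lo`. -/
def Cell.hi : Cell → ℝ
  | .C k j => blockStart k j + (1 / 2) ^ (k : ℕ) / 3
  | .E₁ k i => blockStart k 0 + (1 / 2) ^ (k : ℕ) / 3 * ![P.l k, P.u k, P.u k, 1] i
  | .E₂ k _ => blockStart k 1 + (1 / 2) ^ (k : ℕ) / 3
  | .E₃ k => blockStart k 2 + (1 / 2) ^ (k : ℕ) / 3
  | _ => 1

/-- The point of `[0,1)` at relative position `t ∈ [0,1)` in the interval of `Cell.lo`. -/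
def Cell.point (c : Cell) (t : ℝ) : ℝ := c.part.embed (c.lo P + (c.hi P - c.lo P) * t)

/-- The measure of a piece, as a polynomial in `z`. -/
def Cell.measurePoly : Cell → MvPolynomial ℕ+ ℝ
  | .E₁ k i => MvPolynomial.C ((1 / 2) ^ (k : ℕ) / 75) *
      ![MvPolynomial.C (P.l k), P.p k - MvPolynomial.C (P.l k), MvPolynomial.C (P.u k) - P.p k,
        1 - MvPolynomial.C (P.u k)] i
  | .E₂ k i => MvPolynomial.C ((1 / 2) ^ (k : ℕ) / 75) * ![1 - P.p k, P.p k] i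
  | .E₃ k => MvPolynomial.C ((1 / 2) ^ (k : ℕ) / 75)
  | .C k _ => MvPolynomial.C ((1 / 2) ^ (k : ℕ) / 75)
  | c => MvPolynomial.C c.part.size

/-- The constant value of `W_P(z)` on the product of two pieces of `C ∪ E`, as a polynomial
in `z`. -/
def edgePoly : Cell → Cell → MvPolynomial ℕ+ ℝ
  | .C k j, .C k' j' =>
      if k = k' ∧ j ≠ 2 ∧ j' ≠ 2 then
        if j = j' then MvPolynomial.monomial (multiset k) 1
        else 1 - MvPolynomial.monomial (multiset k) 1
      else 0
  | .C k j, .E₁ k' i => if k = k' ∧ ((j = 0 ∧ i < 2) ∨ (j = 1 ∧ 2 ≤ i)) then 1 else 0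
  | .E₁ k' i, .C k j => if k = k' ∧ ((j = 0 ∧ i < 2) ∨ (j = 1 ∧ 2 ≤ i)) then 1 else 0
  | .C k j, .E₂ k' i => if k = k' ∧ ((j = 0 ∧ i = 0) ∨ (j = 1 ∧ i = 1)) then 1 else 0
  | .E₂ k' i, .C k j => if k = k' ∧ ((j = 0 ∧ i = 0) ∨ (j = 1 ∧ i = 1)) then 1 else 0
  | _, _ => 0

variable {n : ℕ} (H : SimpleGraph (Fin n))

/-- The probability that, for independent uniform points, the vertex `v` being placed in the
interval of the piece `L v`, the random graph agrees with `H` on all pairs of vertices that are not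
both placed in `C ∪ E`. The values of `W_P(z)` involved do not depend on `z` (up to null sets),
so `z = 0` is used. -/
def outerProb (L : Fin n → Cell) : ℝ :=
  ∫ x in unitBox n,
    ∏ q ∈ (vertexPairs n).filter fun q => ¬ ((L q.1).InCE ∧ (L q.2).InCE),
      if H.Adj q.1 q.2 then
        WP P W₀ (fun _ => 0) ((L q.1).point P (x q.1)) ((L q.2).point P (x q.2))
      else 1 - WP P W₀ (fun _ => 0) ((L q.1).point P (x q.1)) ((L q.2).point P (x q.2))

/-- The polynomial `q_{P,H'}` of the copy `H'` of `H` whose vertex `v` is labeled by the piece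
`L v`: the contribution to `τ(H, W_P(z))` of the points in `∏ v, L v`. -/
def labeledPoly (L : Fin n → Cell) : MvPolynomial ℕ+ ℝ :=
  MvPolynomial.C (outerProb P W₀ H L) * (∏ v, (L v).measurePoly P) *
    ∏ q ∈ (vertexPairs n).filter fun q => (L q.1).InCE ∧ (L q.2).InCE,
      if H.Adj q.1 q.2 then edgePoly (L q.1) (L q.2) else 1 - edgePoly (L q.1) (L q.2)

/-- The coefficient `α_{P,i}`: the sum over all labelings of the coefficients at `z^{M_i}`. -/
def alpha (i : ℕ+) : ℝ := ∑' L : Fin n → Cell, (labeledPoly P W₀ H L).coeff (multiset i)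

/-- The function `t_{P,H}(z) = ∑ i, α_{P,i} z^{M_i}`. -/
def tFun (z : Cube) : ℝ := ∑' i : ℕ+, alpha P W₀ H i * monomialValue (multiset i) z

end Density

end

end GraphonFamily

open GraphonFamily

/-!
Cut `[0,1)` into the pieces: their measures are polynomials in `z`, and on the product of two of
them `W_P(z)` either depends only on the relative positions inside the pieces, and not on `z`, or
both pieces lie in `C ∪ E` and `W_P(z)` is a constant that is a polynomial in `z`. Splitting
`[0,1)^n` into products of pieces, one obtains `τ(H, W_P(z)) = ∑_L q_L(z)` for feasible `z`.

Rearranging this sum by monomials requires a bound on the coefficients of the `q_L`, and we use the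
weighted `ℓ¹`-norm on the polydisc of polyradius `k ↦ r ^ k`, where `z^A` has the norm `r ^ Σ(A)`.
Since `|π_{k,j}| ≤ 2^{-2^j} / 9`, each `p_k` has norm at most `1` for `r` close to `1`, so the norm
of the measure of a piece with index `k` is of the order `2^{-k}`, which beats the at most `n`
edge factors of norm at most `3 r ^ k` that the piece is responsible for. Hence the norms of the
`q_L` have a finite sum, and `t_{P,H}` is a power series that converges absolutely on a polydisc
with polyradii exceeding `1` in every variable. Such a series is totally analytic.
-/

namespace GraphonFamily

noncomputable section

/-! ### Monomials and polynomials -/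

section Monomials

variable {σ : Type*}

/-- The value `x ^ A = ∏ k, x k ^ A k` of the monomial with exponent `A` at `x`. -/
def evalMonomial (x : σ → ℝ) (A : σ →₀ ℕ) : ℝ := A.prod fun k e => x k ^ e

variable {x ρ : σ → ℝ}

@[simp]
theorem evalMonomial_zero (x : σ → ℝ) : evalMonomial x 0 = 1 := Finsupp.prod_zero_index

theorem evalMonomial_add (x : σ → ℝ) (A B : σ →₀ ℕ) :
    evalMonomial x (A + B) = evalMonomial x A * evalMonomial x B :=
  Finsupp.prod_add_index' (fun _ => pow_zero _) fun _ _ _ => pow_add _ _ _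

theorem evalMonomial_eq_mul_erase (x : σ → ℝ) (A : σ →₀ ℕ) (j : σ) :
    evalMonomial x A = x j ^ A j * evalMonomial x (A.erase j) :=
  (A.mul_prod_erase' j _ fun _ => pow_zero _).symm

theorem evalMonomial_update [DecidableEq σ] (x : σ → ℝ) (A : σ →₀ ℕ) (j : σ) (s : ℝ) :
    evalMonomial (Function.update x j s) A = s ^ A j * evalMonomial x (A.erase j) := by
  rw [evalMonomial_eq_mul_erase _ A j, Function.update_self]
  congr 1
  refine Finsupp.prod_congr fun k hk => ?_
  rw [Function.update_of_ne fun h => Finsupp.notMem_support_iff.mpr Finsupp.erase_same (h ▸ hk)]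

theorem evalMonomial_nonneg (hρ : ∀ k, 0 ≤ ρ k) (A : σ →₀ ℕ) : 0 ≤ evalMonomial ρ A :=
  Finset.prod_nonneg fun k _ => pow_nonneg (hρ k) _

theorem one_le_evalMonomial (hρ : ∀ k, 1 ≤ ρ k) (A : σ →₀ ℕ) : 1 ≤ evalMonomial ρ A :=
  Finset.one_le_prod fun k _ => one_le_pow₀ (hρ k)

theorem abs_evalMonomial_le (h : ∀ k, |x k| ≤ ρ k) (A : σ →₀ ℕ) :
    |evalMonomial x A| ≤ evalMonomial ρ A := by
  simp only [evalMonomial, Finsupp.prod, Finset.abs_prod, abs_pow]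
  gcongr with k
  exact h k

theorem continuous_evalMonomial (A : σ →₀ ℕ) : Continuous fun x : σ → ℝ => evalMonomial x A :=
  continuous_finsetProd _ fun k _ => (continuous_apply k).pow _

theorem eval_eq_sum_coeff_mul_evalMonomial (x : σ → ℝ) (q : MvPolynomial σ ℝ) :
    MvPolynomial.eval x q = ∑ A ∈ q.support, q.coeff A * evalMonomial x A :=
  MvPolynomial.eval_eq x q

end Monomials

section PolydiscNorm

open MvPolynomial

variable {σ R : Type*} [NormedCommRing R] {ρ : σ → ℝ}

/-- The `ℓ¹`-norm `∑ A, ‖q_A‖ ρ ^ A` of a polynomial on the polydisc of polyradius `ρ`. -/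
def polydiscNorm (ρ : σ → ℝ) (q : MvPolynomial σ R) : ℝ :=
  ∑ A ∈ q.support, ‖q.coeff A‖ * evalMonomial ρ A

theorem polydiscNorm_eq_sum {s : Finset (σ →₀ ℕ)} {q : MvPolynomial σ R} (h : q.support ⊆ s) :
    polydiscNorm ρ q = ∑ A ∈ s, ‖q.coeff A‖ * evalMonomial ρ A :=
  Finset.sum_subset h fun A _ hA => by rw [notMem_support_iff.mp hA, norm_zero, zero_mul]

theorem hasSum_polydiscNorm (ρ : σ → ℝ) (q : MvPolynomial σ R) :
    HasSum (fun A => ‖q.coeff A‖ * evalMonomial ρ A) (polydiscNorm ρ q) :=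
  hasSum_sum_of_ne_finset_zero fun A hA => by rw [notMem_support_iff.mp hA, norm_zero, zero_mul]

theorem polydiscNorm_nonneg (hρ : ∀ k, 0 ≤ ρ k) (q : MvPolynomial σ R) : 0 ≤ polydiscNorm ρ q :=
  Finset.sum_nonneg fun A _ => mul_nonneg (norm_nonneg _) (evalMonomial_nonneg hρ A)

theorem norm_coeff_mul_evalMonomial_le_polydiscNorm (hρ : ∀ k, 0 ≤ ρ k) (q : MvPolynomial σ R)
    (A : σ →₀ ℕ) : ‖q.coeff A‖ * evalMonomial ρ A ≤ polydiscNorm ρ q :=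
  le_hasSum (hasSum_polydiscNorm ρ q) A fun B _ =>
    mul_nonneg (norm_nonneg _) (evalMonomial_nonneg hρ B)

@[simp]
theorem polydiscNorm_zero (ρ : σ → ℝ) : polydiscNorm ρ (0 : MvPolynomial σ R) = 0 := by
  simp [polydiscNorm]

@[simp]
theorem polydiscNorm_monomial (ρ : σ → ℝ) (A : σ →₀ ℕ) (c : R) :
    polydiscNorm ρ (monomial A c) = ‖c‖ * evalMonomial ρ A := by
  classical
  rw [polydiscNorm_eq_sum support_monomial_subset, Finset.sum_singleton, coeff_monomial, if_pos rfl]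

@[simp]
theorem polydiscNorm_C (ρ : σ → ℝ) (c : R) :
    polydiscNorm ρ (C c : MvPolynomial σ R) = ‖c‖ := by
  rw [C_apply, polydiscNorm_monomial, evalMonomial_zero, mul_one]

@[simp]
theorem polydiscNorm_one [NormOneClass R] (ρ : σ → ℝ) :
    polydiscNorm ρ (1 : MvPolynomial σ R) = 1 := by
  rw [← C_1, polydiscNorm_C, norm_one]

@[simp]
theorem polydiscNorm_neg (ρ : σ → ℝ) (q : MvPolynomial σ R) :
    polydiscNorm ρ (-q) = polydiscNorm ρ q := by
  simp only [polydiscNorm, support_neg, coeff_neg, norm_neg]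

theorem polydiscNorm_add_le (hρ : ∀ k, 0 ≤ ρ k) (q r : MvPolynomial σ R) :
    polydiscNorm ρ (q + r) ≤ polydiscNorm ρ q + polydiscNorm ρ r := by
  classical
  rw [polydiscNorm_eq_sum support_add, polydiscNorm_eq_sum (q := q) Finset.subset_union_left,
    polydiscNorm_eq_sum (q := r) Finset.subset_union_right, ← Finset.sum_add_distrib]
  refine Finset.sum_le_sum fun A _ => ?_
  rw [coeff_add, ← add_mul]
  exact mul_le_mul_of_nonneg_right (norm_add_le _ _) (evalMonomial_nonneg hρ A)

theorem polydiscNorm_sub_le (hρ : ∀ k, 0 ≤ ρ k) (q r : MvPolynomial σ R) :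
    polydiscNorm ρ (q - r) ≤ polydiscNorm ρ q + polydiscNorm ρ r := by
  simpa only [sub_eq_add_neg, polydiscNorm_neg] using polydiscNorm_add_le hρ q (-r)

theorem polydiscNorm_sum_le (hρ : ∀ k, 0 ≤ ρ k) {ι : Type*} (s : Finset ι)
    (q : ι → MvPolynomial σ R) :
    polydiscNorm ρ (∑ i ∈ s, q i) ≤ ∑ i ∈ s, polydiscNorm ρ (q i) :=
  Finset.le_sum_of_subadditive _ (polydiscNorm_zero ρ).le (polydiscNorm_add_le hρ) s q

theorem polydiscNorm_mul_le (hρ : ∀ k, 0 ≤ ρ k) (q r : MvPolynomial σ R) :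
    polydiscNorm ρ (q * r) ≤ polydiscNorm ρ q * polydiscNorm ρ r := by
  have hexp : q * r =
      ∑ A ∈ q.support, ∑ B ∈ r.support, monomial (A + B) (q.coeff A * r.coeff B) := by
    conv_lhs => rw [q.as_sum, r.as_sum]
    simp only [Finset.sum_mul_sum, monomial_mul]
  rw [hexp, polydiscNorm.eq_def ρ q, polydiscNorm.eq_def ρ r, Finset.sum_mul_sum]
  refine (polydiscNorm_sum_le hρ _ _).trans (Finset.sum_le_sum fun A _ => ?_)
  refine (polydiscNorm_sum_le hρ _ _).trans (Finset.sum_le_sum fun B _ => ?_)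
  rw [polydiscNorm_monomial, evalMonomial_add, mul_mul_mul_comm]
  exact mul_le_mul_of_nonneg_right (norm_mul_le _ _)
    (mul_nonneg (evalMonomial_nonneg hρ A) (evalMonomial_nonneg hρ B))

theorem polydiscNorm_prod_le [NormOneClass R] (hρ : ∀ k, 0 ≤ ρ k) {ι : Type*} (s : Finset ι)
    (q : ι → MvPolynomial σ R) :
    polydiscNorm ρ (∏ i ∈ s, q i) ≤ ∏ i ∈ s, polydiscNorm ρ (q i) := by
  induction s using Finset.cons_induction with
  | empty => simp only [Finset.prod_empty, polydiscNorm_one, le_refl]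
  | cons i s hi ih =>
    rw [Finset.prod_cons, Finset.prod_cons]
    exact (polydiscNorm_mul_le hρ _ _).trans
      (mul_le_mul_of_nonneg_left ih (polydiscNorm_nonneg hρ _))

end PolydiscNorm

/-! ### Power series in infinitely many variables -/

section PowerSeries

variable {σ : Type*} {a : (σ →₀ ℕ) → ℝ} {x ρ : σ → ℝ}

/-- The sum `∑ A, a A * x ^ A` of the power series with coefficients `a`. -/
def seriesSum (a : (σ →₀ ℕ) → ℝ) (x : σ → ℝ) : ℝ := ∑' A, a A * evalMonomial x A

/-- The coefficients of the partial derivative with respect to the variable `j`. -/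
def derivCoeff (j : σ) (a : (σ →₀ ℕ) → ℝ) (A : σ →₀ ℕ) : ℝ :=
  (A j + 1) * a (A + Finsupp.single j 1)

instance : LeftCommutative (derivCoeff (σ := σ)) where
  left_comm i j a := by
    funext A
    simp only [derivCoeff, Finsupp.add_apply]
    obtain rfl | h := eq_or_ne i j
    · rfl
    · rw [Finsupp.single_eq_of_ne h, Finsupp.single_eq_of_ne h.symm, add_right_comm A]
      push_cast
      ring

theorem norm_mul_evalMonomial_le (hx : ∀ k, |x k| ≤ ρ k) (A : σ →₀ ℕ) :
    ‖a A * evalMonomial x A‖ ≤ |a A| * evalMonomial ρ A := by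
  rw [Real.norm_eq_abs, abs_mul]
  exact mul_le_mul_of_nonneg_left (abs_evalMonomial_le hx A) (abs_nonneg _)

theorem summable_mul_evalMonomial (ha : Summable fun A => |a A| * evalMonomial ρ A)
    (hx : ∀ k, |x k| ≤ ρ k) : Summable fun A => a A * evalMonomial x A :=
  ha.of_norm_bounded (norm_mul_evalMonomial_le hx)

theorem continuousOn_seriesSum (ha : Summable fun A => |a A| * evalMonomial ρ A) :
    ContinuousOn (seriesSum a) {x | ∀ k, |x k| ≤ ρ k} :=
  continuousOn_tsum
    (fun A => (continuous_const.mul (continuous_evalMonomial A)).continuousOn) ha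
    fun A _ hx => norm_mul_evalMonomial_le hx A

theorem natCast_mul_pow_pred_mul_sub_le_pow {t r : ℝ} (ht : 0 ≤ t) (htr : t ≤ r) (n : ℕ) :
    n * t ^ (n - 1) * (r - t) ≤ r ^ n := by
  have hgeom : n * t ^ (n - 1) ≤ ∑ i ∈ Finset.range n, r ^ i * t ^ (n - 1 - i) := by
    calc (n : ℝ) * t ^ (n - 1) = ∑ i ∈ Finset.range n, t ^ i * t ^ (n - 1 - i) := by
          rw [Finset.sum_congr rfl fun i hi => by
            rw [← pow_add, Nat.add_sub_cancel' (Nat.le_sub_one_of_lt (Finset.mem_range.mp hi))],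
            Finset.sum_const, Finset.card_range, nsmul_eq_mul]
      _ ≤ _ := by gcongr
  calc n * t ^ (n - 1) * (r - t)
      ≤ (∑ i ∈ Finset.range n, r ^ i * t ^ (n - 1 - i)) * (r - t) :=
        mul_le_mul_of_nonneg_right hgeom (sub_nonneg.mpr htr)
    _ = r ^ n - t ^ n := (Commute.all r t).geom_sum₂_mul n
    _ ≤ r ^ n := sub_le_self _ (pow_nonneg ht n)

theorem natCast_mul_pow_pred_mul_evalMonomial_erase_le (hρ : ∀ k, 0 ≤ ρ k) {j : σ} {t : ℝ}
    (ht : 0 ≤ t) (htρ : t < ρ j) (A : σ →₀ ℕ) :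
    A j * t ^ (A j - 1) * evalMonomial ρ (A.erase j) ≤ evalMonomial ρ A / (ρ j - t) := by
  rw [le_div_iff₀ (sub_pos.mpr htρ), mul_right_comm, evalMonomial_eq_mul_erase ρ A j]
  exact mul_le_mul_of_nonneg_right (natCast_mul_pow_pred_mul_sub_le_pow ht htρ.le _)
    (evalMonomial_nonneg hρ _)

variable [DecidableEq σ]

theorem seriesSum_derivCoeff (a : (σ →₀ ℕ) → ℝ) (x : σ → ℝ) (j : σ) (s : ℝ) :
    seriesSum (derivCoeff j a) (Function.update x j s) =
      ∑' A, a A * (A j * s ^ (A j - 1) * evalMonomial x (A.erase j)) := by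
  rw [← (add_left_injective (Finsupp.single j 1)).tsum_eq]
  · refine tsum_congr fun A => ?_
    rw [derivCoeff, evalMonomial_update, Finsupp.add_apply, Finsupp.single_eq_same,
      Nat.add_sub_cancel, Finsupp.erase_add, Finsupp.erase_single, add_zero]
    push_cast
    ring
  · intro A hA
    have hAj : A j ≠ 0 := fun h => hA (by simp only [h, Nat.cast_zero, zero_mul, mul_zero])
    exact ⟨A - Finsupp.single j 1,
      tsub_add_cancel_of_le (Finsupp.single_le_iff.mpr (Nat.one_le_iff_ne_zero.mpr hAj))⟩

theorem hasDerivAt_seriesSum_update (ha : Summable fun A => |a A| * evalMonomial ρ A)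
    (hx : ∀ k, |x k| ≤ ρ k) {j : σ} {s : ℝ} (hs : |s| < ρ j) :
    HasDerivAt (fun s => seriesSum a (Function.update x j s))
      (seriesSum (derivCoeff j a) (Function.update x j s)) s := by
  have hρ : ∀ k, 0 ≤ ρ k := fun k => (abs_nonneg _).trans (hx k)
  obtain ⟨t, hst, htρ⟩ := exists_between hs
  have ht : 0 ≤ t := (abs_nonneg s).trans hst.le
  rw [seriesSum_derivCoeff]
  simp only [seriesSum, evalMonomial_update]
  refine hasDerivAt_tsum_of_isPreconnected
    (g' := fun A s => a A * (A j * s ^ (A j - 1) * evalMonomial x (A.erase j)))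
    (ha.div_const (ρ j - t)) isOpen_Ioo
    isPreconnected_Ioo (fun A y _ => ((hasDerivAt_pow (A j) y).mul_const _).const_mul (a A))
    (fun A y hy => ?_) (abs_lt.mp hst) ?_ (abs_lt.mp hst)
  · rw [Real.norm_eq_abs, abs_mul, abs_mul, abs_mul, Nat.abs_cast, abs_pow, mul_div_assoc]
    refine mul_le_mul_of_nonneg_left (le_trans ?_
      (natCast_mul_pow_pred_mul_evalMonomial_erase_le hρ ht htρ A)) (abs_nonneg _)
    gcongr
    · exact (abs_lt.mpr hy).le
    · exact abs_evalMonomial_le hx _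
  · simp only [← evalMonomial_update]
    refine summable_mul_evalMonomial ha fun k => ?_
    obtain rfl | hk := eq_or_ne k j
    · rw [Function.update_self]; exact hs.le
    · rw [Function.update_of_ne hk]; exact hx k

theorem summable_derivCoeff (ha : Summable fun A => |a A| * evalMonomial ρ A)
    (hρ : ∀ k, 0 ≤ ρ k) {j : σ} {t : ℝ} (ht : 0 ≤ t) (htρ : t < ρ j) :
    Summable fun A => |derivCoeff j a A| * evalMonomial (Function.update ρ j t) A := by
  refine ((ha.div_const (ρ j - t)).comp_injective
    (add_left_injective (Finsupp.single j 1))).of_nonneg_of_le (fun A => ?_) fun A => ?_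
  · refine mul_nonneg (abs_nonneg _) (evalMonomial_nonneg (fun k => ?_) A)
    obtain rfl | hk := eq_or_ne k j
    · rwa [Function.update_self]
    · rw [Function.update_of_ne hk]; exact hρ k
  · have h := natCast_mul_pow_pred_mul_evalMonomial_erase_le hρ ht htρ (A + Finsupp.single j 1)
    rw [Finsupp.add_apply, Finsupp.single_eq_same, Nat.add_sub_cancel, Finsupp.erase_add,
      Finsupp.erase_single, add_zero, mul_assoc] at h
    rw [derivCoeff, abs_mul, evalMonomial_update, mul_comm |_|, mul_assoc, Function.comp_apply,
      mul_div_assoc, ← Nat.cast_add_one, Nat.abs_cast]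
    exact mul_le_mul_of_nonneg_left h (abs_nonneg _)

end PowerSeries

/-! ### Analyticity in finitely many variables -/

section Monomials

variable {σ : Type*}

theorem evalMonomial_const (r : ℝ) (A : σ →₀ ℕ) : evalMonomial (fun _ => r) A = r ^ A.degree :=
  Finset.prod_pow_eq_pow_sum _ _ _

theorem prod_map_toMultiset (y : σ → ℝ) (A : σ →₀ ℕ) :
    (A.toMultiset.map y).prod = evalMonomial y A := by
  rw [Finsupp.toMultiset_map, Finsupp.prod_toMultiset]
  exact Finsupp.prod_mapDomain_index (fun _ => pow_zero _) fun _ _ _ => pow_add _ _ _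

theorem evalMonomial_extend {κ : Type*} {e : κ → σ} (he : Function.Injective e)
    (y : κ → ℝ) (x : σ → ℝ) (A : σ →₀ ℕ) [DecidablePred (· ∈ Set.range e)] :
    evalMonomial (Function.extend e y x) A =
      evalMonomial y (A.comapDomain e he.injOn) *
        evalMonomial x (A.filter (· ∉ Set.range e)) := by
  have hA : A = (A.comapDomain e he.injOn).mapDomain e + A.filter (· ∉ Set.range e) := by
    ext k
    by_cases hk : k ∈ Set.range e
    · obtain ⟨i, rfl⟩ := hk
      rw [Finsupp.add_apply, Finsupp.mapDomain_apply he, Finsupp.comapDomain_apply,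
        Finsupp.filter_apply_neg (· ∉ Set.range e) _ (not_not_intro (mem_range_self i)), add_zero]
    · rw [Finsupp.add_apply, Finsupp.mapDomain_of_notMem_range _ _ hk,
        Finsupp.filter_apply_pos (· ∉ Set.range e) _ hk, zero_add]
  conv_lhs => rw [hA]
  rw [evalMonomial_add, evalMonomial, Finsupp.prod_mapDomain_index_inj he]
  congr 1
  · exact Finsupp.prod_congr fun i _ => by rw [he.extend_apply]
  · refine Finsupp.prod_congr fun k hk => ?_
    rw [Finsupp.support_filter, Finset.mem_filter] at hk
    rw [Function.extend_apply' _ _ _ hk.2]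

end Monomials

section Analyticity

theorem hasFPowerSeriesOnBall_tsum {ι 𝕜 E F : Type*} [NontriviallyNormedField 𝕜]
    [NormedAddCommGroup E] [NormedSpace 𝕜 E] [NormedAddCommGroup F] [NormedSpace 𝕜 F]
    [CompleteSpace F] {f : ι → E → F} {p : ι → FormalMultilinearSeries 𝕜 E F} {x : E} {r : NNReal}
    (hr : 0 < r) (hf : ∀ i, HasFPowerSeriesOnBall (f i) (p i) x r)
    (hp : Summable fun q : ι × ℕ => ‖p q.1 q.2‖ * r ^ q.2) :
    HasFPowerSeriesOnBall (fun y => ∑' i, f i y) (fun m => ∑' i, p i m) x r := by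
  have hpm : ∀ m, Summable fun i => ‖p i m‖ := fun m =>
    (summable_mul_right_iff (pow_ne_zero m (NNReal.coe_ne_zero.mpr hr.ne'))).mp
      (hp.prod_symm.prod_factor m)
  refine ⟨?_, by exact_mod_cast hr, fun {y} hy => ?_⟩
  · refine FormalMultilinearSeries.le_radius_of_summable_norm _
      (hp.prod_symm.prod.of_nonneg_of_le (fun m => by positivity) fun m => ?_)
    exact (mul_le_mul_of_nonneg_right (norm_tsum_le_tsum_norm (hpm m)) (by positivity)).trans
      tsum_mul_right.symm.le
  · have hyr : ‖y‖ ≤ r := (mem_eball_zero_iff.mp hy).le |> fun h => by exact_mod_cast h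
    have hterm : Summable fun q : ι × ℕ => p q.1 q.2 fun _ => y :=
      hp.of_norm_bounded fun q => (ContinuousMultilinearMap.le_opNorm _ _).trans (by
        rw [Finset.prod_const, Finset.card_univ, Fintype.card_fin]
        gcongr)
    have hsum : HasSum (fun q : ℕ × ι => p q.2 q.1 fun _ => y) (∑' i, f i (x + y)) := by
      have h := hterm.hasSum.prod_fiberwise fun i => (hf i).hasSum hy
      rw [h.tsum_eq]
      exact (Equiv.prodComm ℕ ι).hasSum_iff.mpr hterm.hasSum
    exact hsum.prod_fiberwise fun m => (hpm m).of_norm.hasSum.mapL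
      (ContinuousMultilinearMap.apply 𝕜 (fun _ : Fin m => E) F fun _ => y)

variable {κ : Type*}

/-- The monomial `y ↦ (l.map y).prod` as a power series: its only nonzero term is the one of degree
`l.length`. -/
def listMonomial (l : List κ) : FormalMultilinearSeries ℝ (κ → ℝ) ℝ := fun m =>
  if h : l.length = m then
    (ContinuousMultilinearMap.mkPiAlgebra ℝ (Fin m) ℝ).compContinuousLinearMap fun i =>
      ContinuousLinearMap.proj (l.get (i.cast h.symm))
  else 0

theorem listMonomial_of_ne {l : List κ} {m : ℕ} (h : m ≠ l.length) : listMonomial l m = 0 :=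
  dif_neg h.symm

variable [Fintype κ]

theorem norm_listMonomial_length_le (l : List κ) : ‖listMonomial l l.length‖ ≤ 1 := by
  rw [listMonomial, dif_pos rfl]
  refine ContinuousMultilinearMap.opNorm_le_bound zero_le_one fun v => ?_
  simp only [ContinuousMultilinearMap.compContinuousLinearMap_apply,
    ContinuousMultilinearMap.mkPiAlgebra_apply, one_mul, norm_prod]
  exact Finset.prod_le_prod (fun _ _ => norm_nonneg _) fun i _ => norm_le_pi_norm (v i) _

theorem hasFPowerSeriesOnBall_listMonomial (l : List κ) :
    HasFPowerSeriesOnBall (fun y : κ → ℝ => (l.map y).prod) (listMonomial l) 0 ⊤ := by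
  refine ⟨?_, ENNReal.zero_lt_top, fun {y} _ => ?_⟩
  · refine (FormalMultilinearSeries.radius_eq_top_of_eventually_eq_zero _ ?_).ge
    filter_upwards [Filter.eventually_gt_atTop l.length] with m hm using listMonomial_of_ne hm.ne'
  · rw [zero_add]
    convert hasSum_single l.length fun m hm => ?_
    · simp only [listMonomial, dif_pos, ContinuousMultilinearMap.compContinuousLinearMap_apply,
        ContinuousMultilinearMap.mkPiAlgebra_apply, ContinuousLinearMap.proj_apply, Fin.cast_refl]
      exact (Fin.prod_univ_fun_getElem l y).symm
    · rw [listMonomial_of_ne hm, zero_apply]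

theorem hasFPowerSeriesOnBall_tsum_evalMonomial {ι : Type*} {b : ι → ℝ} {B : ι → κ →₀ ℕ}
    {r : NNReal} (hr : 0 < r) (hb : Summable fun i => |b i| * (r : ℝ) ^ (B i).degree) :
    ∃ p : FormalMultilinearSeries ℝ (κ → ℝ) ℝ,
      HasFPowerSeriesOnBall (fun y => ∑' i, b i * evalMonomial y (B i)) p 0 r := by
  let l : ι → List κ := fun i => (B i).toMultiset.toList
  have hlen : ∀ i, (l i).length = (B i).degree := fun i => by
    rw [Multiset.length_toList, Finsupp.card_toMultiset]
    rfl
  have hval : ∀ i (y : κ → ℝ), ((l i).map y).prod = evalMonomial y (B i) := fun i y => by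
    rw [← prod_map_toMultiset, ← Multiset.prod_coe, ← Multiset.map_coe, Multiset.coe_toList]
  simp only [← hval]
  have hterm : ∀ i, HasFPowerSeriesOnBall (fun y : κ → ℝ => b i * ((l i).map y).prod)
      (b i • listMonomial (l i)) 0 r := fun i =>
    ((hasFPowerSeriesOnBall_listMonomial (l i)).const_smul (c := b i)).mono
      (ENNReal.coe_pos.mpr hr) le_top
  refine ⟨_, hasFPowerSeriesOnBall_tsum hr hterm ?_⟩
  have hinj : Function.Injective fun i => (i, (l i).length) := fun i j h => (Prod.ext_iff.mp h).1
  refine (hinj.summable_iff ?_).mp (hb.of_nonneg_of_le (fun i => ?_) fun i => ?_)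
  · rintro ⟨i, m⟩ hm
    rw [FormalMultilinearSeries.smul_apply, listMonomial_of_ne, smul_zero, norm_zero, zero_mul]
    exact fun h => hm ⟨i, Prod.ext rfl h.symm⟩
  · simp only [Function.comp_apply]
    positivity
  · rw [Function.comp_apply, hlen, FormalMultilinearSeries.smul_apply, norm_smul, Real.norm_eq_abs]
    gcongr
    refine mul_le_of_le_one_right (abs_nonneg _) ?_
    rw [← hlen]
    exact norm_listMonomial_length_le _

theorem hasFPowerSeriesOnBall_seriesSum_extend {σ : Type*} {a : (σ →₀ ℕ) → ℝ} {x ρ : σ → ℝ}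
    {e : κ → σ} (he : Function.Injective e) (ha : Summable fun A => |a A| * evalMonomial ρ A)
    (hx : ∀ k, |x k| ≤ ρ k) {r : NNReal} (hr : 0 < r) (hrρ : ∀ i, r ≤ ρ (e i)) :
    ∃ p : FormalMultilinearSeries ℝ (κ → ℝ) ℝ,
      HasFPowerSeriesOnBall (fun y => seriesSum a (Function.extend e y x)) p 0 r := by
  classical
  have hle : ∀ k, |Function.extend e (fun _ => (r : ℝ)) x k| ≤ ρ k := fun k => by
    by_cases hk : ∃ i, e i = k
    · obtain ⟨i, rfl⟩ := hk
      rw [he.extend_apply, abs_of_pos (NNReal.coe_pos.mpr hr)]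
      exact hrρ i
    · rw [Function.extend_apply' _ _ _ hk]
      exact hx k
  simp only [seriesSum, evalMonomial_extend he, mul_left_comm (a _)]
  simp only [mul_comm (evalMonomial _ (Finsupp.comapDomain _ _ _))]
  refine hasFPowerSeriesOnBall_tsum_evalMonomial hr
    (ha.of_nonneg_of_le (fun A => by positivity) fun A => ?_)
  refine le_trans (le_of_eq ?_) (norm_mul_evalMonomial_le hle A)
  rw [evalMonomial_extend he, evalMonomial_const, Real.norm_eq_abs, abs_mul, abs_mul, abs_mul,
    abs_of_nonneg (pow_nonneg r.coe_nonneg _)]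
  ring

end Analyticity

/-! ### Power series converging beyond the unit polydisc -/

section OverConvergence

variable {σ : Type*} {a : (σ →₀ ℕ) → ℝ}

/-- Absolute convergence of a power series on a polydisc whose polyradius exceeds `1` in every
variable. -/
def OverConvergent (a : (σ →₀ ℕ) → ℝ) : Prop :=
  ∃ ρ : σ → ℝ, (∀ k, 1 < ρ k) ∧ Summable fun A => |a A| * evalMonomial ρ A

namespace OverConvergent

theorem derivCoeff (ha : OverConvergent a) (j : σ) :
    OverConvergent (GraphonFamily.derivCoeff j a) := by
  classical
  obtain ⟨ρ, hρ, hs⟩ := ha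
  obtain ⟨t, ht, htρ⟩ := exists_between (hρ j)
  refine ⟨Function.update ρ j t, fun k => ?_,
    summable_derivCoeff hs (fun k => zero_le_one.trans (hρ k).le) (zero_le_one.trans ht.le) htρ⟩
  obtain rfl | hk := eq_or_ne k j
  · rwa [Function.update_self]
  · rw [Function.update_of_ne hk]
    exact hρ k

theorem foldr_derivCoeff (ha : OverConvergent a) (M : Multiset σ) :
    OverConvergent (M.foldr GraphonFamily.derivCoeff a) := by
  induction M using Multiset.induction_on with
  | empty => rwa [Multiset.foldr_zero]
  | cons j M ih => rw [Multiset.foldr_cons]; exact ih.derivCoeff j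

theorem summable_mul_evalMonomial (ha : OverConvergent a) {x : σ → ℝ} (hx : ∀ k, |x k| ≤ 1) :
    Summable fun A => a A * evalMonomial x A :=
  have ⟨_, hρ, hs⟩ := ha
  GraphonFamily.summable_mul_evalMonomial hs fun k => (hx k).trans (hρ k).le

end OverConvergent

end OverConvergence

section PolynomialSeries

variable {ι σ : Type*} {q : ι → MvPolynomial σ ℝ} {ρ : σ → ℝ}

theorem summable_coeff_of_summable_polydiscNorm (hρ : ∀ k, 1 ≤ ρ k)
    (hq : Summable fun i => polydiscNorm ρ (q i)) (A : σ →₀ ℕ) :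
    Summable fun i => (q i).coeff A :=
  hq.of_norm_bounded fun i =>
    (le_mul_of_one_le_right (norm_nonneg _) (one_le_evalMonomial hρ A)).trans
      (norm_coeff_mul_evalMonomial_le_polydiscNorm (fun k => zero_le_one.trans (hρ k)) (q i) A)

theorem summable_abs_coeff_mul_evalMonomial (hρ : ∀ k, 0 ≤ ρ k)
    (hq : Summable fun i => polydiscNorm ρ (q i)) :
    Summable fun s : ι × (σ →₀ ℕ) => |(q s.1).coeff s.2| * evalMonomial ρ s.2 := by
  refine (summable_prod_of_nonneg fun s =>
    mul_nonneg (abs_nonneg _) (evalMonomial_nonneg hρ _)).mpr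
    ⟨fun i => (hasSum_polydiscNorm ρ (q i)).summable, ?_⟩
  exact hq.congr fun i => (hasSum_polydiscNorm ρ (q i)).tsum_eq.symm

theorem overConvergent_tsum_coeff (hρ : ∀ k, 1 < ρ k)
    (hq : Summable fun i => polydiscNorm ρ (q i)) :
    OverConvergent fun A => ∑' i, (q i).coeff A := by
  have hρ₀ : ∀ k, 0 ≤ ρ k := fun k => zero_le_one.trans (hρ k).le
  refine ⟨ρ, hρ, (summable_abs_coeff_mul_evalMonomial hρ₀ hq).prod_symm.prod.of_nonneg_of_le
    (fun A => mul_nonneg (abs_nonneg _) (evalMonomial_nonneg hρ₀ A)) fun A => ?_⟩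
  have hA := summable_coeff_of_summable_polydiscNorm (fun k => (hρ k).le) hq A
  simp only [Prod.fst_swap, Prod.snd_swap, tsum_mul_right]
  exact mul_le_mul_of_nonneg_right (norm_tsum_le_tsum_norm hA.norm) (evalMonomial_nonneg hρ₀ A)

theorem seriesSum_tsum_coeff {x : σ → ℝ} (hx : ∀ k, |x k| ≤ ρ k)
    (hq : Summable fun i => polydiscNorm ρ (q i)) :
    seriesSum (fun A => ∑' i, (q i).coeff A) x = ∑' i, MvPolynomial.eval x (q i) := by
  have hρ : ∀ k, 0 ≤ ρ k := fun k => (abs_nonneg _).trans (hx k)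
  have hsum : Summable fun s : ι × (σ →₀ ℕ) => (q s.1).coeff s.2 * evalMonomial x s.2 :=
    (summable_abs_coeff_mul_evalMonomial hρ hq).of_norm_bounded fun s =>
      norm_mul_evalMonomial_le (a := fun A => (q s.1).coeff A) hx s.2
  have heval : ∀ i, ∑' A, (q i).coeff A * evalMonomial x A = MvPolynomial.eval x (q i) := fun i =>
    (eval_eq_sum_coeff_mul_evalMonomial x (q i) ▸ hasSum_sum_of_ne_finset_zero fun A hA => by
      rw [MvPolynomial.notMem_support_iff.mp hA, zero_mul]).tsum_eq
  simp only [seriesSum, ← tsum_mul_right, ← heval]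
  exact Summable.tsum_comm hsum

end PolynomialSeries

section Cube

variable {a : (ℕ+ →₀ ℕ) → ℝ}

theorem Cube.abs_val_le_one (z : Cube) (k : ℕ+) : |z.val k| ≤ 1 :=
  abs_le.mpr ⟨(neg_nonpos.mpr zero_le_one).trans (z k).2.1, (z k).2.2⟩

theorem Cube.continuous_val : Continuous Cube.val :=
  continuous_pi fun k => continuous_subtype_val.comp (continuous_apply k)

theorem Cube.val_update (z : Cube) (j : ℕ+) (s : Icc (0 : ℝ) 1) :
    Cube.val (Function.update z j s) = Function.update z.val j (s : ℝ) := by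
  funext k
  exact Function.apply_update (fun _ => Subtype.val) z j s k

theorem injective_succPNat_val (n : ℕ) : Function.Injective fun i : Fin n => (i : ℕ).succPNat :=
  Nat.succPNat_injective.comp Fin.val_injective

theorem val_replaceFirst (n : ℕ) (x : Fin n → Icc (0 : ℝ) 1) (z : Cube) :
    (replaceFirst n x z).val =
      Function.extend (fun i : Fin n => (i : ℕ).succPNat) (fun i => (x i : ℝ)) z.val := by
  funext k
  by_cases hk : k.natPred < n
  · have hk' : k = ((⟨k.natPred, hk⟩ : Fin n) : ℕ).succPNat := (PNat.succPNat_natPred k).symm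
    rw [Cube.val, replaceFirst, dif_pos hk]
    conv_rhs => rw [hk']
    exact ((injective_succPNat_val n).extend_apply (fun i => (x i : ℝ)) z.val ⟨k.natPred, hk⟩).symm
  · rw [Cube.val, replaceFirst, dif_neg hk, Function.extend_apply']
    · rfl
    · rintro ⟨i, rfl⟩
      exact hk (by rw [Nat.natPred_succPNat]; exact i.2)

namespace OverConvergent

theorem continuous_seriesSum_val (ha : OverConvergent a) :
    Continuous fun z : Cube => seriesSum a z.val := by
  obtain ⟨ρ, hρ, hs⟩ := ha
  exact (continuousOn_seriesSum hs).comp_continuous Cube.continuous_val fun z k =>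
    (z.abs_val_le_one k).trans (hρ k).le

theorem hasPartialDerivAt (ha : OverConvergent a) (j : ℕ+) (z : Cube) :
    HasPartialDerivAt (fun z => seriesSum a z.val) j
      (seriesSum (GraphonFamily.derivCoeff j a) z.val) z := by
  obtain ⟨ρ, hρ, hs⟩ := ha
  have hz : ∀ k, |z.val k| ≤ ρ k := fun k => (z.abs_val_le_one k).trans (hρ k).le
  have hderiv := hasDerivAt_seriesSum_update hs hz (j := j) (s := z.val j)
    ((z.abs_val_le_one j).trans_lt (hρ j))
  rw [Function.update_eq_self] at hderiv
  refine hderiv.hasDerivWithinAt.congr_of_mem (fun s hs => ?_) (z j).2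
  beta_reduce
  rw [Cube.val_update, projIcc_of_mem zero_le_one hs]

theorem exists_analyticOnNhd (ha : OverConvergent a) (n : ℕ) (z : Cube) :
    ∃ (U : Set (Fin n → ℝ)) (g : (Fin n → ℝ) → ℝ), IsOpen U ∧ Icc 0 1 ⊆ U ∧ AnalyticOnNhd ℝ g U ∧
      ∀ x : Fin n → Icc (0 : ℝ) 1,
        g (fun i => (x i : ℝ)) = seriesSum a (replaceFirst n x z).val := by
  obtain ⟨ρ, hρ, hs⟩ := ha
  obtain ⟨r, hr, hrρ⟩ := (Set.finite_singleton (1 : ℝ)).exists_between'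
    (Set.finite_range fun i : Fin n => ρ (i : ℕ).succPNat)
    (by rintro _ rfl; exact forall_mem_range.mpr fun i => hρ _)
  replace hr := hr 1 rfl
  rw [forall_mem_range] at hrρ
  lift r to NNReal using zero_le_one.trans hr.le
  obtain ⟨p, hp⟩ := hasFPowerSeriesOnBall_seriesSum_extend (injective_succPNat_val n) hs
    (fun k => (z.abs_val_le_one k).trans (hρ k).le) (NNReal.coe_pos.mp (zero_lt_one.trans hr))
    fun i => (hrρ i).le
  refine ⟨_, _, Metric.isOpen_eball, fun x hx => ?_, fun x => hp.analyticAt_of_mem, fun x => ?_⟩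
  · rw [mem_eball_zero_iff]
    have hx1 : ‖x‖ ≤ 1 := (pi_norm_le_iff_of_nonneg zero_le_one).mpr fun i =>
      abs_le.mpr ⟨(neg_nonpos.mpr zero_le_one).trans (hx.1 i), hx.2 i⟩
    exact_mod_cast hx1.trans_lt hr
  · rw [val_replaceFirst]

theorem totallyAnalytic (ha : OverConvergent a) :
    TotallyAnalytic fun z => seriesSum a z.val where
  partials := by
    refine ⟨fun M z => seriesSum (M.foldr GraphonFamily.derivCoeff a) z.val, ?_, fun M j z => ?_,
      fun M => (ha.foldr_derivCoeff M).continuous_seriesSum_val⟩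
    · simp only [Multiset.foldr_zero]
    · simp only [Multiset.foldr_cons]
      exact (ha.foldr_derivCoeff M).hasPartialDerivAt j z
  analytic := ha.exists_analyticOnNhd

end OverConvergent

end Cube

/-! ### Norms of the polynomials `q_L` -/

section Enumeration

/-- The enumeration `j ↦ M_j` of the finite multisets as an equivalence. -/
def multisetEquiv : ℕ+ ≃ (ℕ+ →₀ ℕ) :=
  Equiv.pnatEquivNat.trans (Equiv.ofBijective rank ⟨rank_injective, rank_surjective⟩).symm

theorem rank_multiset (j : ℕ+) : rank (multiset j) = j.natPred :=
  (Equiv.ofBijective rank ⟨rank_injective, rank_surjective⟩).apply_symm_apply j.natPred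

theorem msum_single (j : ℕ+) (c : ℕ) : msum (Finsupp.single j c) = j * c :=
  Finsupp.sum_single_index (mul_zero _)

theorem msum_le_rank (A : ℕ+ →₀ ℕ) : msum A ≤ rank A := by
  have hsub : Finsupp.single (1 : ℕ+) '' Iio (msum A) ⊆ {B | Prec B A} := by
    rintro _ ⟨m, hm, rfl⟩
    exact Or.inl (by rwa [msum_single, PNat.one_coe, one_mul])
  have hcard := ncard_le_ncard hsub (finite_prec A)
  rwa [ncard_image_of_injective _ (Finsupp.single_injective _), ncard_Iio_nat] at hcard

theorem msum_multiset_le (j : ℕ+) : msum (multiset j) ≤ j :=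
  (msum_le_rank _).trans ((rank_multiset j).trans_le (Nat.sub_le _ _))

/-- The polyradius `k ↦ r ^ k`, at which the monomial `z ^ A` has the value `r ^ Σ(A)`. -/
def geometricRadius (r : ℝ) (k : ℕ+) : ℝ := r ^ (k : ℕ)

theorem evalMonomial_geometricRadius (r : ℝ) (A : ℕ+ →₀ ℕ) :
    evalMonomial (geometricRadius r) A = r ^ msum A := by
  simp only [evalMonomial, geometricRadius, ← pow_mul]
  exact Finset.prod_pow_eq_pow_sum _ _ _

variable {r : ℝ}

theorem geometricRadius_nonneg (hr : 0 ≤ r) (k : ℕ+) : 0 ≤ geometricRadius r k := pow_nonneg hr _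

theorem one_lt_geometricRadius (hr : 1 < r) (k : ℕ+) : 1 < geometricRadius r k :=
  one_lt_pow₀ hr k.ne_zero

theorem evalMonomial_geometricRadius_multiset_le (hr : 1 ≤ r) (j : ℕ+) :
    evalMonomial (geometricRadius r) (multiset j) ≤ r ^ (j : ℕ) :=
  (evalMonomial_geometricRadius r _).trans_le (pow_le_pow_right₀ hr (msum_multiset_le j))

theorem hasSum_half_pow_pnat : HasSum (fun j : ℕ+ => (1 / 2 : ℝ) ^ (j : ℕ)) 1 := by
  have h := hasSum_geometric_two.mul_left (1 / 2 : ℝ)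
  rw [one_div_mul_cancel two_ne_zero] at h
  exact Equiv.pnatEquivNat.symm.hasSum_iff.mp (h.congr_fun fun m => pow_succ' (1 / 2) m)

theorem two_mul_le_two_pow {m : ℕ} (hm : m ≠ 0) : 2 * m ≤ 2 ^ m := by
  obtain ⟨m, rfl⟩ := Nat.exists_eq_succ_of_ne_zero hm
  rw [Nat.pow_succ']
  exact Nat.mul_le_mul_left 2 (Nat.lt_two_pow_self)

namespace BoundingSequence

variable (P : BoundingSequence)

theorem abs_coeff_le_quarter_pow (k j : ℕ+) : |P.coeff k j| ≤ (1 / 4 : ℝ) ^ (j : ℕ) / 9 := by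
  refine (P.coeff_le k j).trans (div_le_div_of_nonneg_right ?_ (by norm_num))
  calc (1 / 2 : ℝ) ^ 2 ^ (j : ℕ) ≤ (1 / 2) ^ (2 * (j : ℕ)) :=
        pow_le_pow_of_le_one (by norm_num) (by norm_num) (two_mul_le_two_pow j.ne_zero)
    _ = (1 / 4) ^ (j : ℕ) := by rw [pow_mul]; norm_num

theorem polydiscNorm_p_le_one (hr : 1 ≤ r) (hr₂ : r ≤ 2) (k : ℕ+) :
    polydiscNorm (geometricRadius r) (P.p k) ≤ 1 := by
  refine hasSum_le (fun j => ?_)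
    (multisetEquiv.hasSum_iff.mpr (hasSum_polydiscNorm (geometricRadius r) (P.p k)))
    hasSum_half_pow_pnat
  calc |P.coeff k j| * evalMonomial (geometricRadius r) (multiset j)
      ≤ (1 / 4) ^ (j : ℕ) * 2 ^ (j : ℕ) := by
        gcongr
        · exact evalMonomial_nonneg (geometricRadius_nonneg (zero_le_one.trans hr)) _
        · exact (P.abs_coeff_le_quarter_pow k j).trans (div_le_self (by positivity) (by norm_num))
        · exact (evalMonomial_geometricRadius_multiset_le hr j).trans (by gcongr)
    _ = (1 / 2) ^ (j : ℕ) := by rw [← mul_pow]; norm_num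

end BoundingSequence

end Enumeration

section Labelings

theorem summable_pi_prod {ι : Type*} {w : ι → ℝ} (hw : Summable w) (h0 : ∀ i, 0 ≤ w i) (n : ℕ) :
    Summable fun L : Fin n → ι => ∏ v, w (L v) := by
  induction n with
  | zero => exact Summable.of_finite
  | succ n ih =>
    refine ((Fin.consEquiv fun _ => ι).symm.summable_iff.mpr
      (hw.mul_of_nonneg ih h0 fun L => Finset.prod_nonneg fun v _ => h0 (L v))).congr fun L => ?_
    exact (Fin.prod_univ_succ fun v => w (L v)).symm

namespace Cell

/-- The index `k` of the pieces `C k j`, `E₁ k i`, `E₂ k i` and `E₃ k`, and `0` for the pieces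
outside `C ∪ E`; the measure of a piece is at most `2 ^ (-key)`. -/
def key : Cell → ℕ
  | .C k _ => k
  | .E₁ k _ => k
  | .E₂ k _ => k
  | .E₃ k => k
  | _ => 0

/-- A numbering of the pieces with a given `Cell.key`. -/
def kind : Cell → Fin 22
  | .A => 0
  | .B => 1
  | .D k => ⟨2 + k, by omega⟩
  | .F => 9
  | .Q => 10
  | .R => 11
  | .C _ j => ⟨12 + j, by omega⟩
  | .E₁ _ i => ⟨15 + i, by omega⟩
  | .E₂ _ i => ⟨19 + i, by omega⟩
  | .E₃ _ => 21

theorem key_kind_injective : Function.Injective fun c : Cell => (c.key, c.kind) := by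
  intro c d h
  simp only [Prod.mk.injEq, Fin.ext_iff] at h
  obtain ⟨h1, h2⟩ := h
  cases c <;> cases d <;> simp [key, kind] at h1 h2 ⊢ <;> grind

instance : Countable Cell := key_kind_injective.countable

theorem summable_pow_key {q : ℝ} (h0 : 0 ≤ q) (h1 : q < 1) :
    Summable fun c : Cell => q ^ c.key := by
  have h : Summable fun a : ℕ × Fin 22 => q ^ a.1 * 1 :=
    (summable_geometric_of_lt_one h0 h1).mul_of_nonneg (Summable.of_finite (f := fun _ => 1))
      (fun _ => pow_nonneg h0 _) (fun _ => zero_le_one)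
  simpa only [mul_one, Function.comp_def] using h.comp_injective key_kind_injective

end Cell

section PolydiscNorm

variable (P : BoundingSequence) {r : ℝ}

theorem polydiscNorm_C_le_one {ρ : ℕ+ → ℝ} {x : ℝ} (hx : x ∈ Icc (0 : ℝ) 1) :
    polydiscNorm ρ (MvPolynomial.C x) ≤ 1 := by
  rw [polydiscNorm_C, Real.norm_of_nonneg hx.1]
  exact hx.2

theorem polydiscNorm_sub_le_two {ρ : ℕ+ → ℝ} (hρ : ∀ k, 0 ≤ ρ k) {p q : MvPolynomial ℕ+ ℝ}
    (hp : polydiscNorm ρ p ≤ 1) (hq : polydiscNorm ρ q ≤ 1) : polydiscNorm ρ (p - q) ≤ 2 :=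
  (polydiscNorm_sub_le hρ p q).trans (by linarith)

theorem polydiscNorm_C_mul_le {ρ : ℕ+ → ℝ} (hρ : ∀ k, 0 ≤ ρ k) {q : MvPolynomial ℕ+ ℝ}
    (hq : polydiscNorm ρ q ≤ 2) (k : ℕ) :
    polydiscNorm ρ (MvPolynomial.C ((1 / 2) ^ k / 75) * q) ≤ (1 / 2) ^ k := by
  have h0 : (0 : ℝ) ≤ (1 / 2) ^ k := by positivity
  refine (polydiscNorm_mul_le hρ _ _).trans ?_
  rw [polydiscNorm_C, Real.norm_of_nonneg (by positivity)]
  linarith [mul_le_mul_of_nonneg_left hq h0]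

theorem polydiscNorm_measurePoly_le (hr : 1 ≤ r) (hr₂ : r ≤ 2) (c : Cell) :
    polydiscNorm (geometricRadius r) (c.measurePoly P) ≤ (1 / 2) ^ c.key := by
  have hρ : ∀ k, 0 ≤ geometricRadius r k := geometricRadius_nonneg (zero_le_one.trans hr)
  have hp : ∀ k, polydiscNorm (geometricRadius r) (P.p k) ≤ 1 := P.polydiscNorm_p_le_one hr hr₂
  have hl : ∀ k, polydiscNorm (geometricRadius r) (MvPolynomial.C (P.l k)) ≤ 1 :=
    fun k => polydiscNorm_C_le_one (P.l_mem k)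
  have hu : ∀ k, polydiscNorm (geometricRadius r) (MvPolynomial.C (P.u k)) ≤ 1 :=
    fun k => polydiscNorm_C_le_one (P.u_mem k)
  have hone : polydiscNorm (geometricRadius r) (1 : MvPolynomial ℕ+ ℝ) ≤ 1 :=
    (polydiscNorm_one _).le
  have hblock : ∀ k : ℕ+, polydiscNorm (geometricRadius r)
      (MvPolynomial.C ((1 / 2 : ℝ) ^ (k : ℕ) / 75)) ≤ (1 / 2) ^ (k : ℕ) := fun k => by
    simpa only [mul_one] using polydiscNorm_C_mul_le hρ (hone.trans one_le_two) k
  cases c with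
  | E₁ k i =>
    refine polydiscNorm_C_mul_le hρ ?_ k
    fin_cases i
    · exact (hl k).trans one_le_two
    · exact polydiscNorm_sub_le_two hρ (hp k) (hl k)
    · exact polydiscNorm_sub_le_two hρ (hu k) (hp k)
    · exact polydiscNorm_sub_le_two hρ hone (hu k)
  | E₂ k i =>
    refine polydiscNorm_C_mul_le hρ ?_ k
    fin_cases i
    · exact polydiscNorm_sub_le_two hρ hone (hp k)
    · exact (hp k).trans one_le_two
  | E₃ k => exact hblock k
  | C k j => exact hblock k
  | _ =>
    simp only [Cell.measurePoly, Cell.key, pow_zero]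
    apply polydiscNorm_C_le_one
    constructor <;> norm_num [Cell.part, Part.size]

theorem polydiscNorm_edgePoly_le (hr : 1 ≤ r) (c d : Cell) :
    polydiscNorm (geometricRadius r) (edgePoly c d) ≤ 1 + r ^ c.key := by
  have hρ : ∀ k, 0 ≤ geometricRadius r k := geometricRadius_nonneg (zero_le_one.trans hr)
  have hpos : ∀ m : ℕ, 0 ≤ r ^ m := fun m => pow_nonneg (zero_le_one.trans hr) m
  have hzero : ∀ m : ℕ, polydiscNorm (geometricRadius r) (0 : MvPolynomial ℕ+ ℝ) ≤ 1 + r ^ m :=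
    fun m => by rw [polydiscNorm_zero]; linarith [hpos m]
  have hone : ∀ m : ℕ, polydiscNorm (geometricRadius r) (1 : MvPolynomial ℕ+ ℝ) ≤ 1 + r ^ m :=
    fun m => by rw [polydiscNorm_one]; linarith [hpos m]
  have hmonomial : ∀ k : ℕ+, polydiscNorm (geometricRadius r)
      (MvPolynomial.monomial (multiset k) (1 : ℝ)) ≤ r ^ (k : ℕ) := fun k => by
    rw [polydiscNorm_monomial, norm_one, one_mul]
    exact evalMonomial_geometricRadius_multiset_le hr k
  have hmonomial' : ∀ k : ℕ+, polydiscNorm (geometricRadius r)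
      (MvPolynomial.monomial (multiset k) (1 : ℝ)) ≤ 1 + r ^ (k : ℕ) :=
    fun k => by linarith [hmonomial k]
  have hcompl : ∀ k : ℕ+, polydiscNorm (geometricRadius r)
      (1 - MvPolynomial.monomial (multiset k) (1 : ℝ)) ≤ 1 + r ^ (k : ℕ) := fun k =>
    (polydiscNorm_sub_le hρ _ _).trans (by rw [polydiscNorm_one]; linarith [hmonomial k])
  cases c <;> cases d <;> simp only [edgePoly, Cell.key] <;> (try split_ifs) <;>
    first | exact hzero _ | exact hone _ | exact hmonomial' _ | exact hcompl _

variable (W₀ : ℝ → ℝ → ℝ) {n : ℕ} (H : SimpleGraph (Fin n))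

theorem polydiscNorm_edgeFactor_le [DecidableRel H.Adj] (hr : 1 ≤ r) (L : Fin n → Cell)
    (q : Fin n × Fin n) :
    polydiscNorm (geometricRadius r)
      (if H.Adj q.1 q.2 then edgePoly (L q.1) (L q.2) else 1 - edgePoly (L q.1) (L q.2)) ≤
      3 * r ^ (L q.1).key := by
  have h := polydiscNorm_edgePoly_le hr (L q.1) (L q.2)
  have hone := one_le_pow₀ hr (n := (L q.1).key)
  split_ifs
  · linarith
  · refine (polydiscNorm_sub_le (geometricRadius_nonneg (zero_le_one.trans hr)) _ _).trans ?_
    rw [polydiscNorm_one]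
    linarith

theorem polydiscNorm_prod_edgeFactor_le [DecidableRel H.Adj] (hr : 1 ≤ r) (L : Fin n → Cell)
    (s : Finset (Fin n × Fin n)) :
    polydiscNorm (geometricRadius r) (∏ q ∈ s,
      if H.Adj q.1 q.2 then edgePoly (L q.1) (L q.2) else 1 - edgePoly (L q.1) (L q.2)) ≤
      ∏ v, (3 * r ^ (L v).key) ^ n := by
  have hρ : ∀ k, 0 ≤ geometricRadius r k := geometricRadius_nonneg (zero_le_one.trans hr)
  have hbase : ∀ v, 1 ≤ 3 * r ^ (L v).key := fun v => by
    linarith [one_le_pow₀ hr (n := (L v).key)]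
  calc _ ≤ ∏ q ∈ s, 3 * r ^ (L q.1).key :=
        (polydiscNorm_prod_le hρ _ _).trans (Finset.prod_le_prod
          (fun _ _ => polydiscNorm_nonneg hρ _) fun q _ => polydiscNorm_edgeFactor_le H hr L q)
    _ ≤ ∏ q : Fin n × Fin n, 3 * r ^ (L q.1).key :=
        Finset.prod_le_prod_of_subset_of_one_le (Finset.subset_univ _)
          (fun q _ => zero_le_one.trans (hbase q.1)) fun q _ _ => hbase q.1
    _ = ∏ v, (3 * r ^ (L v).key) ^ n := by
        simp only [Fintype.prod_prod_type, Finset.prod_const, Finset.card_univ, Fintype.card_fin]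

theorem polydiscNorm_labeledPoly_le (hr : 1 ≤ r) (hr₂ : r ≤ 2) {L : Fin n → Cell}
    (hL : |outerProb P W₀ H L| ≤ 1) :
    polydiscNorm (geometricRadius r) (labeledPoly P W₀ H L) ≤
      ∏ v, (3 ^ n * (r ^ n / 2) ^ (L v).key) := by
  classical
  have hρ : ∀ k, 0 ≤ geometricRadius r k := geometricRadius_nonneg (zero_le_one.trans hr)
  have houter : polydiscNorm (geometricRadius r) (MvPolynomial.C (outerProb P W₀ H L)) ≤ 1 := by
    rwa [polydiscNorm_C]
  have hmeasure : polydiscNorm (geometricRadius r) (∏ v, (L v).measurePoly P) ≤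
      ∏ v, (1 / 2 : ℝ) ^ (L v).key :=
    (polydiscNorm_prod_le hρ _ _).trans (Finset.prod_le_prod
      (fun _ _ => polydiscNorm_nonneg hρ _) fun v _ => polydiscNorm_measurePoly_le P hr hr₂ (L v))
  calc _ ≤ 1 * (∏ v, (1 / 2 : ℝ) ^ (L v).key) * ∏ v, (3 * r ^ (L v).key) ^ n := by
        refine (polydiscNorm_mul_le hρ _ _).trans (mul_le_mul ?_
          (polydiscNorm_prod_edgeFactor_le H hr L _) (polydiscNorm_nonneg hρ _) (by positivity))
        exact (polydiscNorm_mul_le hρ _ _).trans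
          (mul_le_mul houter hmeasure (polydiscNorm_nonneg hρ _) zero_le_one)
    _ = _ := by
        rw [one_mul, ← Finset.prod_mul_distrib]
        refine Finset.prod_congr rfl fun v _ => ?_
        rw [mul_pow, div_pow, div_pow, one_pow, ← pow_mul, ← pow_mul, mul_comm n]
        ring

theorem exists_summable_polydiscNorm_labeledPoly
    (hL : ∀ L : Fin n → Cell, |outerProb P W₀ H L| ≤ 1) :
    ∃ r : ℝ, 1 < r ∧ Summable fun L : Fin n → Cell =>
      polydiscNorm (geometricRadius r) (labeledPoly P W₀ H L) := by
  obtain ⟨r, hrn, hr, hr₂⟩ : ∃ r : ℝ, r ^ n < 3 / 2 ∧ 1 < r ∧ r < 2 := by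
    have hlim : Filter.Tendsto (fun r : ℝ => r ^ n) (nhdsWithin 1 (Ioi 1)) (nhds (1 ^ n)) :=
      ((continuous_pow n).tendsto 1).mono_left nhdsWithin_le_nhds
    have hlt : ∀ᶠ r : ℝ in nhdsWithin 1 (Ioi 1), r ^ n < 3 / 2 :=
      hlim.eventually_lt_const (by norm_num)
    exact (hlt.and (Ioo_mem_nhdsGT one_lt_two)).exists
  have hr0 : 0 ≤ r := zero_le_one.trans hr.le
  have hw : Summable fun c : Cell => 3 ^ n * (r ^ n / 2) ^ c.key :=
    (Cell.summable_pow_key (by positivity) (by linarith)).mul_left _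
  exact ⟨r, hr, Summable.of_nonneg_of_le
    (fun L => polydiscNorm_nonneg (geometricRadius_nonneg hr0) _)
    (fun L => polydiscNorm_labeledPoly_le P W₀ H hr.le hr₂.le (hL L))
    (summable_pi_prod hw (fun c => by positivity) n)⟩

end PolydiscNorm

end Labelings

/-! ### Measurability of the tiles -/

section BoxIntegral

variable {ι : Type*} [Fintype ι]

theorem integral_image_pi_affine {a c : ι → ℝ} (hc : ∀ i, 0 < c i) {s : Set (ι → ℝ)}
    (hs : MeasurableSet s) (F : (ι → ℝ) → ℝ) :
    ∫ x in (fun t i => c i * t i + a i) '' s, F x =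
      (∏ i, c i) * ∫ t in s, F fun i => c i * t i + a i := by
  let f' : (ι → ℝ) →L[ℝ] ι → ℝ :=
    ContinuousLinearMap.pi fun i => c i • ContinuousLinearMap.proj i
  have hderiv : ∀ t ∈ s, HasFDerivWithinAt (fun t i => c i * t i + a i) f' s t := fun t _ =>
    (f'.hasFDerivAt.add_const a).hasFDerivWithinAt
  have hinj : InjOn (fun (t : ι → ℝ) i => c i * t i + a i) s := fun t _ t' _ h =>
    funext fun i => mul_left_cancel₀ (hc i).ne' (add_right_cancel (congrFun h i))
  have hdet : |f'.det| = ∏ i, c i := by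
    have h : f'.det = ∏ i, c i := by
      refine (LinearMap.det_pi fun i => c i • (LinearMap.id : ℝ →ₗ[ℝ] ℝ)).trans ?_
      simp only [LinearMap.det_smul, Module.finrank_self, pow_one, LinearMap.det_id, mul_one]
    rw [h, abs_of_pos (Finset.prod_pos fun i _ => hc i)]
  simp only [integral_image_eq_integral_abs_det_fderiv_smul volume hs hderiv hinj, hdet,
    smul_eq_mul, integral_const_mul]

theorem integral_pi_Ico {a b : ι → ℝ} (hab : ∀ i, a i ≤ b i) (F : (ι → ℝ) → ℝ) :
    ∫ x in univ.pi fun i => Ico (a i) (b i), F x =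
      (∏ i, (b i - a i)) *
        ∫ t in univ.pi fun _ => Ico (0 : ℝ) 1, F fun i => a i + (b i - a i) * t i := by
  by_cases h : ∃ i, a i = b i
  · obtain ⟨i, hi⟩ := h
    rw [univ_pi_eq_empty (i := i) (by rw [hi, Ico_self]), setIntegral_empty,
      Finset.prod_eq_zero (Finset.mem_univ i) (by rw [hi, sub_self]), zero_mul]
  · have hpos : ∀ i, 0 < b i - a i := fun i =>
      sub_pos.mpr ((hab i).lt_of_ne fun hi => h ⟨i, hi⟩)
    have himage : (fun (t : ι → ℝ) i => (b i - a i) * t i + a i) '' univ.pi (fun _ => Ico 0 1) =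
        univ.pi fun i => Ico (a i) (b i) := by
      refine (piMap_image_univ_pi (fun i x => (b i - a i) * x + a i) _).trans ?_
      simp only [image_affine_Ico (hpos _), mul_zero, zero_add, mul_one, sub_add_cancel]
    rw [← himage, integral_image_pi_affine hpos (MeasurableSet.univ_pi fun _ => measurableSet_Ico)]
    simp only [add_comm]

end BoxIntegral

section Measurability

instance : MeasurableSpace ℕ+ := ⊤

instance : DiscreteMeasurableSpace ℕ+ := ⟨fun _ => trivial⟩

@[fun_prop]
theorem measurable_coord : Measurable coord := by
  have h : Measurable fun x : ℝ => ⌊(1 - Int.fract x)⁻¹⌋₊ :=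
    Nat.measurable_floor.comp (measurable_const.sub measurable_fract).inv
  exact (Measurable.of_discrete (f := fun m : ℕ => (Nat.log 2 m).succPNat)).comp h

theorem measurable_coord_pair {β : Type*} [MeasurableSpace β] (f : ℕ+ → ℕ+ → β) :
    Measurable fun q : ℝ × ℝ => f (coord (3 * q.1)) (coord (3 * q.2)) := by
  have h : Measurable fun q : ℝ × ℝ => (coord (3 * q.1), coord (3 * q.2)) := by fun_prop
  exact (Measurable.of_discrete (f := fun k : ℕ+ × ℕ+ => f k.1 k.2)).comp h

theorem measurable_coord_left {β : Type*} [MeasurableSpace β] (f : ℕ+ → β) :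
    Measurable fun q : ℝ × ℝ => f (coord (3 * q.1)) :=
  measurable_coord_pair fun k _ => f k

theorem measurable_coord_right {β : Type*} [MeasurableSpace β] (f : ℕ+ → β) :
    Measurable fun q : ℝ × ℝ => f (coord (3 * q.2)) :=
  measurable_coord_pair fun _ k => f k

variable (P : BoundingSequence) (W₀ : ℝ → ℝ → ℝ) (z : Cube)

theorem measurable_WF : Measurable fun q : ℝ × ℝ => WF P q.1 q.2 := by
  have heq := measurable_coord_pair fun k m => k = m
  have := measurable_coord_pair fun k m => Linked (multiset k) (multiset m)
  have := measurable_coord_pair fun k m => Linked (multiset m) (multiset k)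
  have hpos := measurable_coord_pair fun k m => 9 * 2 ^ (2 * (m : ℕ)) * P.coeffPos k m
  have hneg := measurable_coord_pair fun k m => 9 * 2 ^ (2 * (m : ℕ)) * P.coeffNeg k m
  have hpos' := measurable_coord_pair fun m k => 9 * 2 ^ (2 * (m : ℕ)) * P.coeffPos k m
  have hneg' := measurable_coord_pair fun m k => 9 * 2 ^ (2 * (m : ℕ)) * P.coeffNeg k m
  have hu := measurable_coord_left fun k => 1 - P.u k
  have hl := measurable_coord_left fun k => P.l k
  refine Measurable.ite (Measurable.setOf (by fun_prop))
    (Measurable.ite (Measurable.setOf (by simp only [mem_Ico]; fun_prop))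
      measurable_const measurable_const) ?_
  refine Measurable.ite (Measurable.setOf (by fun_prop)) hpos ?_
  refine Measurable.ite (Measurable.setOf (by fun_prop)) hneg ?_
  refine Measurable.ite (Measurable.setOf (by fun_prop)) hpos' ?_
  refine Measurable.ite (Measurable.setOf (by fun_prop)) hneg' ?_
  exact Measurable.ite (Measurable.setOf (by fun_prop))
    (Measurable.ite heq.setOf hu measurable_const) (Measurable.ite heq.setOf hl measurable_const)

theorem measurable_tileCC : Measurable fun q : ℝ × ℝ => tileCC z q.1 q.2 := by
  have := measurable_coord_pair fun k m => k = m
  have hpow := measurable_coord_left fun k => monomialValue (multiset k) z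
  exact Measurable.ite (Measurable.setOf (by fun_prop))
    (Measurable.ite (Measurable.setOf (by fun_prop)) hpow (hpow.const_sub 1)) measurable_const

theorem measurable_tileCD (k : Fin 7) : Measurable fun q : ℝ × ℝ => tileCD P k q.1 q.2 := by
  have := measurable_coord_pair fun k m => k = m
  unfold tileCD
  simp only [mem_Ico]
  split_ifs
  · exact Measurable.ite (Measurable.setOf (by fun_prop)) measurable_const measurable_const
  · exact Measurable.ite (Measurable.setOf (by fun_prop)) measurable_const measurable_const
  · exact Measurable.ite (Measurable.setOf (by fun_prop)) measurable_const measurable_const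
  · exact Measurable.ite (Measurable.setOf (by fun_prop)) (measurable_WF P) measurable_const
  · exact measurable_const

theorem measurable_tileCE : Measurable fun q : ℝ × ℝ => tileCE P z q.1 q.2 := by
  have := measurable_coord_left fun k => P.pval k z
  have := measurable_coord_left fun k => (2 : ℝ) ^ (k : ℕ)
  unfold tileCE
  simp only [mem_Ico]
  exact Measurable.ite (Measurable.setOf (by fun_prop)) measurable_const measurable_const

theorem measurable_tileGE : Measurable fun q : ℝ × ℝ => tileGE P q.1 q.2 := by
  have := measurable_coord_pair fun k m => k = m
  have := measurable_coord_right fun k => P.l k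
  have := measurable_coord_right fun k => P.u k
  have := measurable_coord_right fun k => (2 : ℝ) ^ (k : ℕ)
  unfold tileGE
  simp only [mem_Ico]
  exact Measurable.ite (Measurable.setOf (by fun_prop)) measurable_const measurable_const

variable {W₀}

theorem measurable_upperTile (hW : Measurable fun q : ℝ × ℝ => W₀ q.1 q.2) (X Y : Core) :
    Measurable fun q : ℝ × ℝ => upperTile P W₀ z X Y q.1 q.2 := by
  have := measurable_coord_pair fun k m => k = m
  have hA : Measurable fun q : ℝ × ℝ => if ⌊3 * q.1⌋ = ⌊3 * q.2⌋ then (1 : ℝ) else 0 :=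
    Measurable.ite (Measurable.setOf (by fun_prop)) measurable_const measurable_const
  have hB : Measurable fun q : ℝ × ℝ =>
      if ⌊3 * q.1⌋ = ⌊3 * q.2⌋ ∧ coord (3 * q.1) = coord (3 * q.2) then (1 : ℝ) else 0 :=
    Measurable.ite (Measurable.setOf (by fun_prop)) measurable_const measurable_const
  have hF : Measurable fun q : ℝ × ℝ => if 1 ≤ q.1 + q.2 then (1 : ℝ) else 0 :=
    Measurable.ite (Measurable.setOf (by fun_prop)) measurable_const measurable_const
  have hGE : ∀ k : Fin 7, Measurable fun q : ℝ × ℝ => if k = 6 then tileGE P q.1 q.2 else 0 :=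
    fun k => (measurable_tileGE P).ite (.const _) measurable_const
  have hDD : ∀ j k : Fin 7, Measurable fun q : ℝ × ℝ =>
      W₀ (hostEmbed j q.1) (hostEmbed k q.2) := fun j k => by
    have h : Measurable fun q : ℝ × ℝ => (hostEmbed j q.1, hostEmbed k q.2) := by
      unfold hostEmbed
      fun_prop
    exact hW.comp h
  cases X <;> cases Y <;> simp only [upperTile] <;>
    first
    | exact measurable_const | exact hA | exact hB | exact hF | exact hGE _ | exact hDD _ _
    | exact measurable_tileCC z | exact measurable_tileCD P _ | exact measurable_tileCE P z

theorem measurable_coreTile (hW : Measurable fun q : ℝ × ℝ => W₀ q.1 q.2) (X Y : Core) :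
    Measurable fun q : ℝ × ℝ => coreTile P W₀ z X Y q.1 q.2 := by
  unfold coreTile
  split_ifs
  · exact measurable_upperTile P z hW X Y
  · exact (measurable_upperTile P z hW Y X).comp measurable_swap

theorem measurable_coreDegree (hW : Measurable fun q : ℝ × ℝ => W₀ q.1 q.2) (X : Core) :
    Measurable (coreDegree P W₀ z X) := by
  have h : ∀ Y, Measurable fun x => ∫ s in Ico (0 : ℝ) 1, coreTile P W₀ z X Y x s := fun Y =>
    (StronglyMeasurable.integral_prod_right (f := fun x s => coreTile P W₀ z X Y x s)
      (measurable_coreTile P z hW X Y).stronglyMeasurable).measurable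
  unfold coreDegree
  fun_prop

theorem measurable_tile (hW : Measurable fun q : ℝ × ℝ => W₀ q.1 q.2) (X Y : Part) :
    Measurable fun q : ℝ × ℝ => tile P W₀ z X Y q.1 q.2 := by
  have h := measurable_coreDegree P z hW
  cases X <;> cases Y <;> simp only [tile]
  case core.core X Y => exact measurable_coreTile P z hW X Y
  all_goals fun_prop

end Measurability

/-! ### `W_P(z)` is a graphon -/

section Parts

theorem lt_natCast_div_iff (s : ℝ) (k : ℕ) [NeZero k] : s < k / 25 ↔ ⌊25 * s⌋₊ < k := by
  rw [Nat.floor_lt' (NeZero.ne k), lt_div_iff₀ (by norm_num), mul_comm]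

theorem partOf_floor (s : ℝ) : partOf (⌊25 * s⌋₊ / 25) = partOf s := by
  have hfloor : ⌊25 * ((⌊25 * s⌋₊ : ℝ) / 25)⌋₊ = ⌊25 * s⌋₊ := by
    rw [mul_div_cancel₀ _ (by norm_num), Nat.floor_natCast]
  have hlt : ∀ (k : ℕ) [NeZero k], ((⌊25 * s⌋₊ : ℝ) / 25 < k / 25) = (s < k / 25) := fun k _ => by
    rw [lt_natCast_div_iff, hfloor, lt_natCast_div_iff]
  have h1 := hlt 1
  have h2 := hlt 2
  have h3 := hlt 3
  have h11 := hlt 11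
  have h12 := hlt 12
  have h24 := hlt 24
  push_cast at h1 h2 h3 h11 h12 h24
  simp only [partOf, h1, h2, h3, h11, h12, h24, hfloor]

namespace Part

theorem size_pos : ∀ X : Part, 0 < X.size := by
  rintro (_ | _ | _) <;> norm_num [size]

/-- The inverse of `Part.embed`: the coordinate in `[0,1)` of a point of the part. -/
def unembed (X : Part) (s : ℝ) : ℝ := (s - X.start) / X.size

theorem embed_unembed (X : Part) (s : ℝ) : X.embed (X.unembed s) = s := by
  rw [embed, unembed, mul_div_cancel₀ _ X.size_pos.ne', add_sub_cancel]

theorem embed_mem (X : Part) {x : ℝ} (hx : x ∈ Ico (0 : ℝ) 1) : X.embed x ∈ Ico (0 : ℝ) 1 := by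
  obtain ⟨h0, h1⟩ := hx
  rcases X with (_ | _ | _ | k | _ | _) | _ | _
  case core.D =>
    have hk : ((k : ℕ) : ℝ) ≤ 6 := by exact_mod_cast Nat.lt_succ_iff.mp k.2
    simp only [embed, start, size, Core.idx]
    push_cast
    constructor <;> linarith [Nat.cast_nonneg (α := ℝ) (k : ℕ)]
  all_goals
    simp only [embed, start, size, Core.idx]
    push_cast
    constructor <;> linarith

end Part

theorem mem_Ico_start_partOf {s : ℝ} (hs : s ∈ Ico (0 : ℝ) 1) :
    s ∈ Ico (partOf s).start ((partOf s).start + (partOf s).size) := by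
  obtain ⟨h0, h1⟩ := hs
  have hle := Nat.floor_le (show 0 ≤ 25 * s by linarith)
  have hlt := Nat.lt_floor_add_one (25 * s)
  unfold partOf
  split_ifs with hA hB hC hD hE hF hQ <;> simp only [Part.start, Part.size, Core.idx]
  · constructor <;> norm_num <;> linarith
  · constructor <;> norm_num <;> linarith
  · constructor <;> norm_num <;> linarith
  · push_cast [Nat.cast_sub hD.1]
    constructor <;> linarith
  · have h3 : 3 ≤ ⌊25 * s⌋₊ := Nat.le_floor (by push_cast; linarith)
    have h10 : (10 : ℝ) ≤ ⌊25 * s⌋₊ := by exact_mod_cast not_lt.mp fun h => hD ⟨h3, h⟩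
    constructor <;> norm_num <;> linarith
  · constructor <;> norm_num <;> linarith
  · constructor <;> norm_num <;> linarith
  · constructor <;> norm_num <;> linarith

theorem unembed_partOf_mem {s : ℝ} (hs : s ∈ Ico (0 : ℝ) 1) :
    (partOf s).unembed s ∈ Ico (0 : ℝ) 1 := by
  obtain ⟨hle, hlt⟩ := mem_Ico_start_partOf hs
  exact ⟨div_nonneg (sub_nonneg.mpr hle) (partOf s).size_pos.le,
    (div_lt_one (partOf s).size_pos).mpr (sub_lt_iff_lt_add'.mpr hlt)⟩

theorem hostEmbed_mem (k : Fin 7) {x : ℝ} (hx : x ∈ Ico (0 : ℝ) 1) :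
    hostEmbed k x ∈ Ico (0 : ℝ) 1 := by
  have hk : ((k : ℕ) : ℝ) ≤ 6 := by exact_mod_cast Nat.lt_succ_iff.mp k.2
  unfold hostEmbed
  constructor <;> linarith [hx.1, hx.2, Nat.cast_nonneg (α := ℝ) (k : ℕ)]

namespace Core

theorem idx_le (X : Core) : X.idx ≤ 11 := by
  cases X <;> simp only [idx] <;> lia

theorem idx_injective : Function.Injective idx := by
  intro X Y h
  cases X <;> cases Y <;> dsimp only [idx] at h <;>
    first | rfl | lia | exact congrArg D (Fin.ext (by lia))

end Core

end Parts

section Bounds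

variable {P : BoundingSequence} {W₀ W₁ : ℝ → ℝ → ℝ} {x y : ℝ}

theorem one_sub_mem_Icc {a : ℝ} (ha : a ∈ Icc (0 : ℝ) 1) : 1 - a ∈ Icc (0 : ℝ) 1 :=
  ⟨sub_nonneg.mpr ha.2, sub_le_self 1 ha.1⟩

theorem monomialValue_mem (A : ℕ+ →₀ ℕ) (z : Cube) : monomialValue A z ∈ Icc (0 : ℝ) 1 :=
  ⟨Finset.prod_nonneg fun k _ => pow_nonneg (z k).2.1 _,
    Finset.prod_le_one (fun k _ => pow_nonneg (z k).2.1 _) fun k _ =>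
      pow_le_one₀ (z k).2.1 (z k).2.2⟩

theorem scaled_abs_coeff_le_one (P : BoundingSequence) (k m : ℕ+) :
    9 * 2 ^ (2 * (m : ℕ)) * |P.coeff k m| ≤ 1 := by
  calc 9 * 2 ^ (2 * (m : ℕ)) * |P.coeff k m|
      ≤ 9 * 2 ^ (2 * (m : ℕ)) * ((1 / 4) ^ (m : ℕ) / 9) := by
        gcongr
        exact P.abs_coeff_le_quarter_pow k m
    _ = (4 * (1 / 4)) ^ (m : ℕ) := by rw [pow_mul, mul_pow]; ring
    _ = 1 := by norm_num

theorem scaled_max_mem (P : BoundingSequence) (k m : ℕ+) {a : ℝ} (ha : a ≤ |P.coeff k m|) :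
    9 * 2 ^ (2 * (m : ℕ)) * max a 0 ∈ Icc (0 : ℝ) 1 := by
  refine ⟨by positivity, le_trans ?_ (scaled_abs_coeff_le_one P k m)⟩
  gcongr
  exact max_le ha (abs_nonneg _)

theorem WF_mem (P : BoundingSequence) (x y : ℝ) : WF P x y ∈ Icc (0 : ℝ) 1 := by
  have hpos : ∀ k m : ℕ+, 9 * 2 ^ (2 * (m : ℕ)) * P.coeffPos k m ∈ Icc (0 : ℝ) 1 := fun k m =>
    scaled_max_mem P k m (le_abs_self _)
  have hneg : ∀ k m : ℕ+, 9 * 2 ^ (2 * (m : ℕ)) * P.coeffNeg k m ∈ Icc (0 : ℝ) 1 := fun k m =>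
    scaled_max_mem P k m (neg_le_abs _)
  unfold WF
  split_ifs
  all_goals
    first
    | exact left_mem_Icc.mpr zero_le_one | exact right_mem_Icc.mpr zero_le_one
    | exact hpos _ _ | exact hneg _ _ | exact one_sub_mem_Icc (P.u_mem _) | exact P.l_mem _

theorem upperTile_mem (hW₀ : IsGraphon W₀) (z : Cube) (X Y : Core) (hx : x ∈ Ico (0 : ℝ) 1)
    (hy : y ∈ Ico (0 : ℝ) 1) : upperTile P W₀ z X Y x y ∈ Icc (0 : ℝ) 1 := by
  cases X <;> cases Y <;>
    simp only [upperTile, tileCC, tileCD, tileCE, tileGE] <;> (try split_ifs) <;>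
    first
    | exact left_mem_Icc.mpr zero_le_one | exact right_mem_Icc.mpr zero_le_one
    | exact monomialValue_mem _ z | exact one_sub_mem_Icc (monomialValue_mem _ z)
    | exact WF_mem P x y | exact hW₀.mem _ (hostEmbed_mem _ hx) _ (hostEmbed_mem _ hy)

theorem coreTile_mem (hW₀ : IsGraphon W₀) (z : Cube) (X Y : Core) (hx : x ∈ Ico (0 : ℝ) 1)
    (hy : y ∈ Ico (0 : ℝ) 1) : coreTile P W₀ z X Y x y ∈ Icc (0 : ℝ) 1 := by
  unfold coreTile
  split_ifs
  · exact upperTile_mem hW₀ z X Y hx hy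
  · exact upperTile_mem hW₀ z Y X hy hx

theorem setIntegral_mem_Icc {α : Type*} [MeasurableSpace α] {μ : Measure α} {s : Set α}
    (hs : MeasurableSet s) (hμ : μ s ≤ 1) {f : α → ℝ} (hf : ∀ x ∈ s, f x ∈ Icc (0 : ℝ) 1) :
    ∫ x in s, f x ∂μ ∈ Icc (0 : ℝ) 1 := by
  refine ⟨setIntegral_nonneg hs fun x hx => (hf x hx).1, ?_⟩
  have hnorm := norm_setIntegral_le_of_norm_le_const (hμ.trans_lt ENNReal.one_lt_top)
    fun x hx => by
      rw [Real.norm_of_nonneg (hf x hx).1]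
      exact (hf x hx).2
  rw [one_mul] at hnorm
  exact (le_abs_self _).trans (hnorm.trans (ENNReal.toReal_mono ENNReal.one_ne_top hμ))

theorem coreDegree_mem (hW₀ : IsGraphon W₀) (z : Cube) (X : Core) (hx : x ∈ Ico (0 : ℝ) 1) :
    coreDegree P W₀ z X x ∈ Icc (0 : ℝ) 12 := by
  have h : ∀ Y, ∫ s in Ico (0 : ℝ) 1, coreTile P W₀ z X Y x s ∈ Icc (0 : ℝ) 1 := fun Y =>
    setIntegral_mem_Icc measurableSet_Ico (by simp) fun s hs => coreTile_mem hW₀ z X Y hx hs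
  have hD0 : 0 ≤ ∑ k : Fin 7, ∫ s in Ico (0 : ℝ) 1, coreTile P W₀ z X (.D k) x s :=
    Finset.sum_nonneg fun k _ => (h _).1
  have hD1 : ∑ k : Fin 7, ∫ s in Ico (0 : ℝ) 1, coreTile P W₀ z X (.D k) x s ≤ 7 := by
    simpa using Finset.sum_le_card_nsmul Finset.univ _ 1 fun k _ => (h (.D k)).2
  obtain ⟨⟨hA0, hA1⟩, hB0, hB1⟩ := And.intro (h .A) (h .B)
  obtain ⟨⟨hC0, hC1⟩, ⟨hE0, hE1⟩, hF0, hF1⟩ := And.intro (h .C) (And.intro (h .E) (h .F))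
  unfold coreDegree
  constructor <;> linarith

theorem tile_mem (hW₀ : IsGraphon W₀) (z : Cube) (X Y : Part) (hx : x ∈ Ico (0 : ℝ) 1)
    (hy : y ∈ Ico (0 : ℝ) 1) : tile P W₀ z X Y x y ∈ Icc (0 : ℝ) 1 := by
  have hidx : ∀ X : Core, ((X.idx : ℝ) + 1) / 25 ∈ Icc (0 : ℝ) 1 := fun X => by
    have h11 : (X.idx : ℝ) ≤ 11 := by exact_mod_cast X.idx_le
    constructor <;> linarith [Nat.cast_nonneg (α := ℝ) X.idx]
  have hdeg : ∀ (X : Core) {x : ℝ}, x ∈ Ico (0 : ℝ) 1 →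
      (12 - coreDegree P W₀ z X x) / 12 ∈ Icc (0 : ℝ) 1 := fun X x hx => by
    obtain ⟨h0, h12⟩ := coreDegree_mem (P := P) hW₀ z X hx
    constructor <;> linarith
  cases X <;> cases Y <;> simp only [tile] <;>
    first
    | exact coreTile_mem hW₀ z _ _ hx hy | exact hidx _ | exact hdeg _ hx | exact hdeg _ hy
    | exact right_mem_Icc.mpr zero_le_one | exact left_mem_Icc.mpr zero_le_one

theorem tileCC_comm (z : Cube) (x y : ℝ) : tileCC z x y = tileCC z y x := by
  unfold tileCC
  by_cases hc : coord (3 * x) = coord (3 * y)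
  · simp only [hc, eq_comm (a := ⌊3 * x⌋), ← and_assoc, and_comm (a := x < 2 / 3)]
  · simp only [hc, Ne.symm hc, and_false, if_false]

theorem coreTile_comm (hW₀ : IsGraphon W₀) (z : Cube) (X Y : Core) (hx : x ∈ Ico (0 : ℝ) 1)
    (hy : y ∈ Ico (0 : ℝ) 1) : coreTile P W₀ z X Y x y = coreTile P W₀ z Y X y x := by
  rcases lt_trichotomy X.idx Y.idx with h | h | h
  · rw [coreTile, coreTile, if_pos h.le, if_neg h.not_ge]
  · obtain rfl := Core.idx_injective h
    simp only [coreTile, le_refl, if_true]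
    cases X <;> simp only [upperTile]
    case A => simp only [eq_comm]
    case B => simp only [eq_comm]
    case C => exact tileCC_comm z x y
    case D k => exact hW₀.symm _ (hostEmbed_mem k hx) _ (hostEmbed_mem k hy)
    case F => simp only [add_comm]
  · rw [coreTile, coreTile, if_neg h.not_ge, if_pos h.le]

theorem tile_comm (hW₀ : IsGraphon W₀) (z : Cube) (X Y : Part) (hx : x ∈ Ico (0 : ℝ) 1)
    (hy : y ∈ Ico (0 : ℝ) 1) : tile P W₀ z X Y x y = tile P W₀ z Y X y x := by
  cases X <;> cases Y <;> simp only [tile]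
  exact coreTile_comm hW₀ z _ _ hx hy

theorem coreTile_congr (h : ∀ x ∈ Ico (0 : ℝ) 1, ∀ y ∈ Ico (0 : ℝ) 1, W₀ x y = W₁ x y) (z : Cube)
    (X Y : Core) (hx : x ∈ Ico (0 : ℝ) 1) (hy : y ∈ Ico (0 : ℝ) 1) :
    coreTile P W₀ z X Y x y = coreTile P W₁ z X Y x y := by
  unfold coreTile
  cases X <;> cases Y <;> simp only [upperTile]
  rw [h _ (hostEmbed_mem _ hx) _ (hostEmbed_mem _ hy),
    h _ (hostEmbed_mem _ hy) _ (hostEmbed_mem _ hx)]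

theorem coreDegree_congr (h : ∀ x ∈ Ico (0 : ℝ) 1, ∀ y ∈ Ico (0 : ℝ) 1, W₀ x y = W₁ x y)
    (z : Cube) (X : Core) (hx : x ∈ Ico (0 : ℝ) 1) :
    coreDegree P W₀ z X x = coreDegree P W₁ z X x := by
  have hint : ∀ Y, ∫ s in Ico (0 : ℝ) 1, coreTile P W₀ z X Y x s =
      ∫ s in Ico (0 : ℝ) 1, coreTile P W₁ z X Y x s := fun Y =>
    setIntegral_congr_fun measurableSet_Ico fun s hs => coreTile_congr h z X Y hx hs
  simp only [coreDegree, hint]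

theorem tile_congr (h : ∀ x ∈ Ico (0 : ℝ) 1, ∀ y ∈ Ico (0 : ℝ) 1, W₀ x y = W₁ x y) (z : Cube)
    (X Y : Part) (hx : x ∈ Ico (0 : ℝ) 1) (hy : y ∈ Ico (0 : ℝ) 1) :
    tile P W₀ z X Y x y = tile P W₁ z X Y x y := by
  cases X <;> cases Y <;> simp only [tile]
  · exact coreTile_congr h z _ _ hx hy
  · rw [coreDegree_congr h z _ hx]
  · rw [coreDegree_congr h z _ hy]

theorem IsGraphon.exists_measurable {W : ℝ → ℝ → ℝ} (hW : IsGraphon W) :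
    ∃ W₁ : ℝ → ℝ → ℝ, (Measurable fun q : ℝ × ℝ => W₁ q.1 q.2) ∧
      ∀ x ∈ Ico (0 : ℝ) 1, ∀ y ∈ Ico (0 : ℝ) 1, W x y = W₁ x y := by
  have he : MeasurableEmbedding
      (Prod.map Subtype.val Subtype.val : Ico (0 : ℝ) 1 × Ico (0 : ℝ) 1 → ℝ × ℝ) :=
    (MeasurableEmbedding.subtype_coe measurableSet_Ico).prodMap
      (MeasurableEmbedding.subtype_coe measurableSet_Ico)
  obtain ⟨g, hg, hgW⟩ := he.exists_measurable_extend hW.measurable fun _ => ⟨0⟩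
  exact ⟨fun x y => g (x, y), hg, fun x hx y hy => (congrFun hgW (⟨x, hx⟩, ⟨y, hy⟩)).symm⟩

theorem WP_eq_tile_unembed (z : Cube) (s t : ℝ) : WP P W₀ z s t =
    tile P W₀ z (partOf s) (partOf t) ((partOf s).unembed s) ((partOf t).unembed t) := rfl

theorem measurable_WP (hW : Measurable fun q : ℝ × ℝ => W₀ q.1 q.2) (z : Cube) :
    Measurable fun q : ℝ × ℝ => WP P W₀ z q.1 q.2 := by
  -- `partOf` factors through `⌊25 * s⌋₊`, so only countably many pairs of parts need be treated.
  let part (m : ℕ) : Part := partOf (m / 25)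
  have htile : Measurable fun p : (ℕ × ℕ) × (ℝ × ℝ) => tile P W₀ z (part p.1.1) (part p.1.2)
      ((part p.1.1).unembed p.2.1) ((part p.1.2).unembed p.2.2) := by
    refine measurable_from_prod_countable_right fun m => ?_
    have h : ∀ X Y : Part, Measurable fun q : ℝ × ℝ => (X.unembed q.1, Y.unembed q.2) :=
      fun X Y => by
        unfold Part.unembed
        fun_prop
    exact (measurable_tile P z hW (part m.1) (part m.2)).comp (h (part m.1) (part m.2))
  have hfloor : Measurable fun q : ℝ × ℝ => ((⌊25 * q.1⌋₊, ⌊25 * q.2⌋₊), q) := by fun_prop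
  simpa only [Function.comp_def, part, partOf_floor, WP_eq_tile_unembed] using htile.comp hfloor

theorem isGraphon_WP (hW₀ : IsGraphon W₀) (P : BoundingSequence) (z : Cube) :
    IsGraphon (WP P W₀ z) := by
  refine ⟨?_, fun x hx y hy => ?_, fun x hx y hy => ?_⟩
  · obtain ⟨W₁, hW₁, hW₀₁⟩ := hW₀.exists_measurable
    have h : Measurable fun q : Ico (0 : ℝ) 1 × Ico (0 : ℝ) 1 => WP P W₁ z q.1 q.2 :=
      (measurable_WP (P := P) hW₁ z).comp
        ((measurable_subtype_coe.comp measurable_fst).prodMk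
          (measurable_subtype_coe.comp measurable_snd))
    convert h using 2 with q
    exact tile_congr hW₀₁ z _ _ (unembed_partOf_mem q.1.2) (unembed_partOf_mem q.2.2)
  · exact tile_comm hW₀ z _ _ (unembed_partOf_mem hx) (unembed_partOf_mem hy)
  · exact tile_mem hW₀ z _ _ (unembed_partOf_mem hx) (unembed_partOf_mem hy)

end Bounds

/-! ### Blocks -/

section Blocks

/-- The point at relative position `t` in the block `{x | ⌊3x⌋ = j, coord (3x) = k}`, an interval
that corresponds to `0 ≤ t < 1`. -/
def blockPoint (k : ℕ+) (j : ℕ) (t : ℝ) : ℝ := blockStart k j + (1 / 2) ^ (k : ℕ) / 3 * t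

/-- The relative position of `x` with respect to the block `{x | ⌊3x⌋ = j, coord (3x) = k}`: for
`j = 0, 1` these are the expressions `a` and `b` in the definition of the tile `C × E`. -/
def relPos (k : ℕ+) (j : ℕ) (x : ℝ) : ℝ := 2 ^ (k : ℕ) * (3 * x - (j + 1)) + 2

variable {k : ℕ+} {j : ℕ} {x y t a b : ℝ}

theorem two_pow_mul_half_pow (n : ℕ) : (2 : ℝ) ^ n * (1 / 2) ^ n = 1 := by
  rw [← mul_pow]
  norm_num

theorem blockPoint_relPos (k : ℕ+) (j : ℕ) (x : ℝ) : blockPoint k j (relPos k j x) = x := by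
  unfold blockPoint relPos blockStart
  linear_combination (x - (j + 1) / 3) * two_pow_mul_half_pow k

theorem relPos_injective (k : ℕ+) (j : ℕ) : Function.Injective (relPos k j) :=
  Function.LeftInverse.injective (blockPoint_relPos k j)

theorem blockPoint_strictMono (k : ℕ+) (j : ℕ) : StrictMono (blockPoint k j) := by
  intro s t hst
  unfold blockPoint
  gcongr

theorem mem_Ico_blockPoint_iff :
    x ∈ Ico (blockPoint k j a) (blockPoint k j b) ↔ relPos k j x ∈ Ico a b := by
  rw [← blockPoint_relPos k j x, mem_Ico, (blockPoint_strictMono k j).le_iff_le,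
    (blockPoint_strictMono k j).lt_iff_lt, blockPoint_relPos, mem_Ico]

theorem half_pow_le_half (k : ℕ+) : (1 / 2 : ℝ) ^ (k : ℕ) ≤ 1 / 2 :=
  pow_le_of_le_one (by norm_num) (by norm_num) k.ne_zero

theorem floor_eq_and_coord_eq_iff :
    (⌊3 * x⌋ = j ∧ coord (3 * x) = k) ↔ relPos k j x ∈ Ico 0 1 := by
  have hpos : (0 : ℝ) < (1 / 2) ^ (k : ℕ) := by positivity
  have hle := half_pow_le_half k
  rw [← mem_Ico_blockPoint_iff, coord_eq_iff, Int.fract, J, mem_Ico, mem_Ico]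
  unfold blockPoint blockStart
  constructor
  · rintro ⟨hj, h⟩
    rw [hj, Int.cast_natCast] at h
    constructor <;> linarith
  · intro h
    have hj : ⌊3 * x⌋ = j := by
      rw [Int.floor_eq_iff, Int.cast_natCast]
      constructor <;> linarith
    rw [hj, Int.cast_natCast]
    refine ⟨rfl, ?_, ?_⟩ <;> linarith

theorem floor_three_mul_eq_zero_iff (hx : 0 ≤ x) : ⌊3 * x⌋ = 0 ↔ x < 1 / 3 := by
  rw [Int.floor_eq_iff, Int.cast_zero]
  exact ⟨fun h => by linarith [h.2], fun h => ⟨by linarith, by linarith⟩⟩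

theorem floor_three_mul_eq_one_iff : ⌊3 * x⌋ = 1 ↔ x ∈ Ico (1 / 3) (2 / 3) := by
  rw [Int.floor_eq_iff, mem_Ico, Int.cast_one]
  constructor <;> rintro ⟨h₁, h₂⟩ <;> constructor <;> linarith

theorem exists_floor_three_mul_eq (hx : x ∈ Ico 0 1) : ∃ j : Fin 3, ⌊3 * x⌋ = (j : ℕ) := by
  have h₀ : 0 ≤ ⌊3 * x⌋ := Int.floor_nonneg.mpr (by linarith [hx.1])
  have h₃ : ⌊3 * x⌋ < 3 := Int.floor_lt.mpr (by push_cast; linarith [hx.2])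
  exact ⟨⟨⌊3 * x⌋.toNat, by omega⟩, (Int.toNat_of_nonneg h₀).symm⟩

theorem blockPoint_mem (k : ℕ+) (j : Fin 3) (ht : t ∈ Icc 0 1) : blockPoint k j t ∈ Ico 0 1 := by
  have hle := half_pow_le_half k
  have hpos : 0 < (1 / 2 : ℝ) ^ (k : ℕ) := by positivity
  have hj : ((j : ℕ) : ℝ) ≤ 2 := by exact_mod_cast Nat.lt_succ_iff.mp j.2
  unfold blockPoint blockStart
  constructor <;> nlinarith [ht.1, ht.2, Nat.cast_nonneg (α := ℝ) (j : ℕ)]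

theorem measurable_relPos (k : ℕ+) (j : ℕ) : Measurable (relPos k j) := by
  unfold relPos
  fun_prop

theorem ite_relPos_mem_eq_indicator (k : ℕ+) (j : ℕ) (S : Set ℝ) [DecidablePred (· ∈ S)] :
    (fun x => if relPos k j x ∈ S then (1 : ℝ) else 0) = (relPos k j ⁻¹' S).indicator 1 := by
  ext x
  by_cases h : relPos k j x ∈ S
  · rw [if_pos h, indicator_of_mem (by exact h), Pi.one_apply]
  · rw [if_neg h, indicator_of_notMem (by exact h)]

theorem integral_ite_relPos_mem (k : ℕ+) (j : Fin 3) {S : Set ℝ} [DecidablePred (· ∈ S)]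
    (hS : MeasurableSet S) (hS₁ : S ⊆ Icc 0 1) :
    ∫ x in Ico (0 : ℝ) 1, (if relPos k j x ∈ S then (1 : ℝ) else 0) =
      (1 / 2) ^ (k : ℕ) / 3 * volume.real S := by
  have hsub : relPos k j ⁻¹' S ⊆ Ico 0 1 := fun x hx =>
    blockPoint_relPos k j x ▸ blockPoint_mem k j (hS₁ hx)
  have hpre : relPos k j ⁻¹' S =
      ((2 ^ (k : ℕ) * 3 : ℝ) * ·) ⁻¹' ((· + (2 - 2 ^ (k : ℕ) * ((j : ℕ) + 1))) ⁻¹' S) := by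
    ext x
    simp only [mem_preimage, relPos]
    ring_nf
  calc ∫ x in Ico (0 : ℝ) 1, (if relPos k j x ∈ S then (1 : ℝ) else 0)
      = ∫ x in Ico (0 : ℝ) 1, (relPos k j ⁻¹' S).indicator 1 x := by
        rw [ite_relPos_mem_eq_indicator]
    _ = volume.real (relPos k j ⁻¹' S) := by
        rw [integral_indicator_one (measurable_relPos k j hS), measureReal_restrict_apply
          (measurable_relPos k j hS), inter_eq_left.mpr hsub]
    _ = (1 / 2) ^ (k : ℕ) / 3 * volume.real S := by
        rw [measureReal_def, hpre, Real.volume_preimage_mul_left (by positivity),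
          measure_preimage_add_right, ENNReal.toReal_mul, ENNReal.toReal_ofReal (abs_nonneg _),
          abs_of_nonneg (by positivity), mul_inv, one_div, inv_pow, measureReal_def]
        rfl

theorem integrableOn_ite_relPos_mem (k : ℕ+) (j : ℕ) {S : Set ℝ} [DecidablePred (· ∈ S)]
    (hS : MeasurableSet S) :
    IntegrableOn (fun x => if relPos k j x ∈ S then (1 : ℝ) else 0) (Ico 0 1) := by
  rw [ite_relPos_mem_eq_indicator]
  exact (integrableOn_const (C := (1 : ℝ)) (by simp)).indicator (measurable_relPos k j hS)

theorem integrableOn_ite_floor_coord (k : ℕ+) (j : ℕ) :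
    IntegrableOn (fun x : ℝ => if ⌊3 * x⌋ = j ∧ coord (3 * x) = k then (1 : ℝ) else 0)
      (Ico 0 1) := by
  classical
  simp only [floor_eq_and_coord_eq_iff]
  exact integrableOn_ite_relPos_mem k j measurableSet_Ico

theorem integral_ite_floor_coord (k : ℕ+) (j : Fin 3) :
    ∫ x in Ico (0 : ℝ) 1, (if ⌊3 * x⌋ = (j : ℕ) ∧ coord (3 * x) = k then (1 : ℝ) else 0) =
      (1 / 2) ^ (k : ℕ) / 3 := by
  classical
  simp only [floor_eq_and_coord_eq_iff]
  rw [integral_ite_relPos_mem k j measurableSet_Ico Ico_subset_Icc_self, Real.volume_real_Ico,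
    sub_zero, max_eq_left zero_le_one, mul_one]

end Blocks

/-! ### The tiles meeting `C` and `E` -/

section Tiles

variable {P : BoundingSequence} {z : Cube} {k k' : ℕ+} {x y : ℝ}

theorem lt_two_thirds_iff (hx : 0 ≤ x) : x < 2 / 3 ↔ ⌊3 * x⌋ = 0 ∨ ⌊3 * x⌋ = 1 := by
  rw [floor_three_mul_eq_zero_iff hx, floor_three_mul_eq_one_iff, mem_Ico]
  constructor
  · intro h
    exact (lt_or_ge x (1 / 3)).imp_right fun h' => ⟨h', h⟩
  · rintro (h | h)
    · linarith
    · exact h.2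

theorem pval_mem (P : BoundingSequence) (k : ℕ+) (z : Cube) : P.pval k z ∈ Icc 0 1 :=
  P.p_mem k z

theorem relPos_one_eq (k : ℕ+) (x : ℝ) : relPos k 1 x = relPos k 0 x - 2 ^ (k : ℕ) := by
  unfold relPos
  push_cast
  ring

theorem two_le_two_pow (k : ℕ+) : (2 : ℝ) ≤ 2 ^ (k : ℕ) :=
  le_self_pow₀ one_le_two k.ne_zero

theorem not_relPos_zero_one_mem (k : ℕ+) (x : ℝ) :
    ¬ (relPos k 0 x ∈ Icc 0 1 ∧ relPos k 1 x ∈ Icc 0 1) := by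
  rintro ⟨h₀, h₁⟩
  rw [relPos_one_eq] at h₁
  linarith [h₀.2, h₁.1, two_le_two_pow k]

theorem integral_ite_relPos_mem_or (k : ℕ+) {S T : Set ℝ} [DecidablePred (· ∈ S)]
    [DecidablePred (· ∈ T)] (hS : MeasurableSet S) (hT : MeasurableSet T) (hS₁ : S ⊆ Icc 0 1)
    (hT₁ : T ⊆ Icc 0 1) :
    ∫ x in Ico (0 : ℝ) 1, (if relPos k 0 x ∈ S ∨ relPos k 1 x ∈ T then (1 : ℝ) else 0) =
      (1 / 2) ^ (k : ℕ) / 3 * (volume.real S + volume.real T) := by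
  have hsum : ∀ x, (if relPos k 0 x ∈ S ∨ relPos k 1 x ∈ T then (1 : ℝ) else 0) =
      (if relPos k 0 x ∈ S then 1 else 0) + if relPos k 1 x ∈ T then 1 else 0 := by
    intro x
    have hST : ¬ (relPos k 0 x ∈ S ∧ relPos k 1 x ∈ T) :=
      fun h => not_relPos_zero_one_mem k x ⟨hS₁ h.1, hT₁ h.2⟩
    by_cases h₀ : relPos k 0 x ∈ S <;> by_cases h₁ : relPos k 1 x ∈ T <;>
      simp_all only [and_self, not_true_eq_false, or_false, or_true, if_true, if_false, or_self,
        add_zero, zero_add]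
  simp only [hsum]
  rw [integral_add (integrableOn_ite_relPos_mem k 0 hS) (integrableOn_ite_relPos_mem k 1 hT),
    mul_add]
  exact congrArg₂ (· + ·) (integral_ite_relPos_mem k 0 hS hS₁) (integral_ite_relPos_mem k 1 hT hT₁)

theorem lt_third_of_relPos_le_one (h : relPos k 0 y ≤ 1) : y < 1 / 3 := by
  unfold relPos at h
  push_cast at h
  by_contra! hy
  nlinarith [two_le_two_pow k]

theorem mem_Ico_of_relPos_mem (h : relPos k 1 y ∈ Icc 0 1) : y ∈ Ico (1 / 3) (2 / 3) := by
  unfold relPos at h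
  push_cast at h
  constructor
  · by_contra! hy
    nlinarith [h.1, two_le_two_pow k]
  · by_contra! hy
    nlinarith [h.2, two_le_two_pow k]

theorem two_pow_mul_add_eq_relPos_zero (k : ℕ+) (y : ℝ) :
    2 ^ (k : ℕ) * (3 * y - 1) + 2 = relPos k 0 y := by
  simp only [relPos, Nat.cast_zero, zero_add]

theorem two_pow_mul_add_eq_relPos_one (k : ℕ+) (y : ℝ) :
    2 ^ (k : ℕ) * (3 * y - 2) + 2 = relPos k 1 y := by
  norm_num only [relPos, Nat.cast_one]

open Classical in
theorem tileCE_of_lt_third (P : BoundingSequence) (z : Cube) (hx : x < 1 / 3) (y : ℝ) :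
    tileCE P z x y =
      if relPos (coord (3 * x)) 0 y ∈ Icc 0 (P.pval (coord (3 * x)) z) ∨
        relPos (coord (3 * x)) 1 y ∈ Icc 0 (1 - P.pval (coord (3 * x)) z) then 1 else 0 := by
  have hx' : x ∉ Ico (1 / 3) (2 / 3) := fun h => h.1.not_gt hx
  have hp := pval_mem P (coord (3 * x)) z
  simp only [tileCE, two_pow_mul_add_eq_relPos_zero, two_pow_mul_add_eq_relPos_one, hx, hx',
    true_and, false_and, or_false, ← mem_Icc]
  refine if_congr (or_congr (and_iff_right_of_imp fun h => ?_)
    (and_iff_right_of_imp fun h => ?_)) rfl rfl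
  · exact lt_third_of_relPos_le_one (h.2.trans hp.2)
  · exact mem_Ico_of_relPos_mem ⟨h.1, by linarith [h.2, hp.1]⟩

open Classical in
theorem tileCE_of_mem_Ico (P : BoundingSequence) (z : Cube) (hx : x ∈ Ico (1 / 3) (2 / 3))
    (y : ℝ) :
    tileCE P z x y =
      if relPos (coord (3 * x)) 0 y ∈ Icc (P.pval (coord (3 * x)) z) 1 ∨
        relPos (coord (3 * x)) 1 y ∈ Icc (1 - P.pval (coord (3 * x)) z) 1 then 1 else 0 := by
  have hx' : ¬ x < 1 / 3 := hx.1.not_gt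
  have hp := pval_mem P (coord (3 * x)) z
  simp only [tileCE, two_pow_mul_add_eq_relPos_zero, two_pow_mul_add_eq_relPos_one, hx, hx',
    true_and, false_and, false_or, ← mem_Icc]
  refine if_congr (or_congr (and_iff_right_of_imp fun h => ?_)
    (and_iff_right_of_imp fun h => ?_)) rfl rfl
  · exact lt_third_of_relPos_le_one h.2
  · exact mem_Ico_of_relPos_mem ⟨by linarith [h.1, hp.2], h.2⟩

theorem tileCE_of_two_thirds_le (P : BoundingSequence) (z : Cube) (hx : 2 / 3 ≤ x) (y : ℝ) :
    tileCE P z x y = 0 := by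
  have hx₀ : ¬ x < 1 / 3 := by linarith
  have hx₁ : x ∉ Ico (1 / 3) (2 / 3) := fun h => h.2.not_ge hx
  simp only [tileCE, hx₀, hx₁, false_and, or_false, if_false]

theorem integral_tileCE_right (P : BoundingSequence) (z : Cube) (x : ℝ) :
    ∫ y in Ico (0 : ℝ) 1, tileCE P z x y =
      if x < 2 / 3 then (1 / 2) ^ (coord (3 * x) : ℕ) / 3 else 0 := by
  classical
  obtain ⟨hp₀, hp₁⟩ := pval_mem P (coord (3 * x)) z
  have hp₀' : 0 ≤ 1 - P.pval (coord (3 * x)) z := sub_nonneg.mpr hp₁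
  have hp₁' : 1 - P.pval (coord (3 * x)) z ≤ 1 := sub_le_self 1 hp₀
  rcases lt_or_ge x (2 / 3) with hx | hx
  · rw [if_pos hx]
    rcases lt_or_ge x (1 / 3) with hx' | hx'
    · simp only [tileCE_of_lt_third P z hx']
      rw [integral_ite_relPos_mem_or _ measurableSet_Icc measurableSet_Icc
        (Icc_subset_Icc_right hp₁) (Icc_subset_Icc_right hp₁'), Real.volume_real_Icc_of_le hp₀,
        Real.volume_real_Icc_of_le hp₀']
      ring
    · simp only [tileCE_of_mem_Ico P z ⟨hx', hx⟩]
      rw [integral_ite_relPos_mem_or _ measurableSet_Icc measurableSet_Icc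
        (Icc_subset_Icc_left hp₀) (Icc_subset_Icc_left hp₀'), Real.volume_real_Icc_of_le hp₁,
        Real.volume_real_Icc_of_le hp₁']
      ring
  · simp only [tileCE_of_two_thirds_le P z hx, if_neg hx.not_gt, integral_zero]

/-- The points of the part `E` that are joined by the tile `C × E` to the block number `k` of the
first third of the part `C`, up to endpoints. -/
def firstSide (P : BoundingSequence) (z : Cube) (k : ℕ+) : Set ℝ :=
  {y | relPos k 0 y ∈ Ico 0 (P.pval k z) ∨ relPos k 1 y ∈ Ico 0 (1 - P.pval k z)}

/-- The points of the part `E` that are joined by the tile `C × E` to the block number `k` of the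
second third of the part `C`, up to endpoints. -/
def secondSide (P : BoundingSequence) (z : Cube) (k : ℕ+) : Set ℝ :=
  {y | relPos k 0 y ∈ Ico (P.pval k z) 1 ∨ relPos k 1 y ∈ Ico (1 - P.pval k z) 1}

/-- The points of the part `E` where some tile may jump. -/
def jumpSet (P : BoundingSequence) (z : Cube) : Set ℝ :=
  ⋃ k, relPos k 0 ⁻¹' {P.l k, P.pval k z, P.u k, 1} ∪ relPos k 1 ⁻¹' {1 - P.pval k z, 1}

theorem countable_jumpSet (P : BoundingSequence) (z : Cube) : (jumpSet P z).Countable :=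
  countable_iUnion fun k =>
    ((toFinite _).countable.preimage (relPos_injective k 0)).union
      ((toFinite _).countable.preimage (relPos_injective k 1))

theorem relPos_zero_notMem (hy : y ∉ jumpSet P z) (k : ℕ+) :
    relPos k 0 y ∉ ({P.l k, P.pval k z, P.u k, 1} : Set ℝ) :=
  fun h => hy (mem_iUnion.mpr ⟨k, Or.inl h⟩)

theorem relPos_one_notMem (hy : y ∉ jumpSet P z) (k : ℕ+) :
    relPos k 1 y ∉ ({1 - P.pval k z, 1} : Set ℝ) :=
  fun h => hy (mem_iUnion.mpr ⟨k, Or.inr h⟩)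

theorem mem_Icc_iff_mem_Ico_of_ne {a b t : ℝ} (h : t ≠ b) : t ∈ Icc a b ↔ t ∈ Ico a b :=
  and_congr_right fun _ => h.le_iff_lt

open Classical in
theorem tileCE_eq_of_notMem_jumpSet (hx : 0 ≤ x) (hy : y ∉ jumpSet P z) :
    tileCE P z x y =
      if (⌊3 * x⌋ = 0 ∧ y ∈ firstSide P z (coord (3 * x))) ∨
        (⌊3 * x⌋ = 1 ∧ y ∈ secondSide P z (coord (3 * x))) then 1 else 0 := by
  have h₀ := relPos_zero_notMem hy (coord (3 * x))
  have h₁ := relPos_one_notMem hy (coord (3 * x))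
  simp only [mem_insert_iff, mem_singleton_iff, not_or] at h₀ h₁
  obtain ⟨-, h₀p, -, h₀1⟩ := h₀
  obtain ⟨h₁p, h₁1⟩ := h₁
  simp only [floor_three_mul_eq_zero_iff hx, floor_three_mul_eq_one_iff]
  rcases lt_or_ge x (1 / 3) with hx' | hx'
  · have hx₁ : x ∉ Ico (1 / 3) (2 / 3) := fun h => h.1.not_gt hx'
    simp only [tileCE_of_lt_third P z hx', hx', hx₁, mem_Icc_iff_mem_Ico_of_ne h₀p,
      mem_Icc_iff_mem_Ico_of_ne h₁p, firstSide, mem_ofPred_eq, true_and, false_and, or_false]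
  · rcases lt_or_ge x (2 / 3) with hx₂ | hx₂
    · have hx₁ : x ∈ Ico (1 / 3) (2 / 3) := ⟨hx', hx₂⟩
      simp only [tileCE_of_mem_Ico P z hx₁, hx'.not_gt, hx₁, mem_Icc_iff_mem_Ico_of_ne h₀1,
        mem_Icc_iff_mem_Ico_of_ne h₁1, secondSide, mem_ofPred_eq, true_and, false_and, false_or]
    · have hx₁ : x ∉ Ico (1 / 3) (2 / 3) := fun h => h.2.not_ge hx₂
      simp only [tileCE_of_two_thirds_le P z hx₂, hx'.not_gt, hx₁, false_and, or_false, if_false]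

theorem mem_union_sides_iff :
    y ∈ firstSide P z k ∪ secondSide P z k ↔
      (⌊3 * y⌋ = 0 ∨ ⌊3 * y⌋ = 1) ∧ coord (3 * y) = k := by
  obtain ⟨hp₀, hp₁⟩ := pval_mem P k z
  have h₀ := floor_eq_and_coord_eq_iff (k := k) (j := 0) (x := y)
  have h₁ := floor_eq_and_coord_eq_iff (k := k) (j := 1) (x := y)
  rw [Nat.cast_zero, ← Ico_union_Ico_eq_Ico hp₀ hp₁] at h₀
  rw [Nat.cast_one, ← Ico_union_Ico_eq_Ico (sub_nonneg.mpr hp₁) (sub_le_self 1 hp₀)] at h₁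
  rw [or_and_right, h₀, h₁]
  simp only [firstSide, secondSide, mem_union, mem_ofPred_eq]
  tauto

theorem disjoint_sides (P : BoundingSequence) (z : Cube) (k k' : ℕ+) :
    Disjoint (firstSide P z k) (secondSide P z k') := by
  rw [disjoint_left]
  intro y h₁ h₂
  obtain rfl : k = k' := (mem_union_sides_iff.mp (Or.inl h₁)).2.symm.trans
    (mem_union_sides_iff.mp (Or.inr h₂)).2
  obtain ⟨hp₀, hp₁⟩ := pval_mem P k z
  have h := not_relPos_zero_one_mem k y
  rcases h₁ with h₁ | h₁ <;> rcases h₂ with h₂ | h₂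
  · exact h₁.2.not_ge h₂.1
  · exact h ⟨⟨h₁.1, h₁.2.le.trans hp₁⟩, by linarith [h₂.1], h₂.2.le⟩
  · exact h ⟨⟨hp₀.trans h₂.1, h₂.2.le⟩, h₁.1, by linarith [h₁.2]⟩
  · exact h₁.2.not_ge h₂.1

theorem mem_firstSide_iff_of_mem (h : y ∈ firstSide P z k) : y ∈ firstSide P z k' ↔ k' = k :=
  ⟨fun h' => (mem_union_sides_iff.mp (Or.inl h')).2.symm.trans
    (mem_union_sides_iff.mp (Or.inl h)).2, fun hk => hk ▸ h⟩

theorem mem_secondSide_iff_of_mem (h : y ∈ secondSide P z k) :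
    y ∈ secondSide P z k' ↔ k' = k :=
  ⟨fun h' => (mem_union_sides_iff.mp (Or.inr h')).2.symm.trans
    (mem_union_sides_iff.mp (Or.inr h)).2, fun hk => hk ▸ h⟩

theorem notMem_secondSide (h : y ∈ firstSide P z k) (k' : ℕ+) : y ∉ secondSide P z k' :=
  disjoint_left.mp (disjoint_sides P z k k') h

theorem notMem_firstSide (h : y ∈ secondSide P z k) (k' : ℕ+) : y ∉ firstSide P z k' :=
  disjoint_right.mp (disjoint_sides P z k' k) h

theorem notMem_sides (h : ¬ (⌊3 * y⌋ = 0 ∨ ⌊3 * y⌋ = 1)) (k : ℕ+) :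
    y ∉ firstSide P z k ∧ y ∉ secondSide P z k :=
  not_or.mp fun hk => h (mem_union_sides_iff.mp hk).1

theorem integral_tileCE_left (hy : y ∉ jumpSet P z) :
    ∫ x in Ico (0 : ℝ) 1, tileCE P z x y =
      if ⌊3 * y⌋ = 0 ∨ ⌊3 * y⌋ = 1 then (1 / 2) ^ (coord (3 * y) : ℕ) / 3 else 0 := by
  classical
  rw [setIntegral_congr_fun measurableSet_Ico fun x hx => tileCE_eq_of_notMem_jumpSet hx.1 hy]
  split_ifs with h
  · rcases (mem_union_sides_iff (P := P) (z := z)).mpr ⟨h, rfl⟩ with hside | hside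
    · simp only [mem_firstSide_iff_of_mem hside, notMem_secondSide hside, and_false, or_false]
      exact integral_ite_floor_coord (coord (3 * y)) 0
    · simp only [mem_secondSide_iff_of_mem hside, notMem_firstSide hside, and_false, false_or]
      exact integral_ite_floor_coord (coord (3 * y)) 1
  · simp only [(notMem_sides h _).1, (notMem_sides h _).2, and_false, or_false, if_false,
      integral_zero]

theorem tileCC_eq_sum (z : Cube) {i : Fin 2} (hx : 0 ≤ x) (hi : ⌊3 * x⌋ = (i : ℕ)) (hy : 0 ≤ y) :
    tileCC z x y = ∑ j : Fin 2,
      (if j = i then monomialValue (multiset (coord (3 * x))) z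
        else 1 - monomialValue (multiset (coord (3 * x))) z) *
      if ⌊3 * y⌋ = (j : ℕ) ∧ coord (3 * y) = coord (3 * x) then 1 else 0 := by
  have hx' : x < 2 / 3 := (lt_two_thirds_iff hx).mpr (by rw [hi]; fin_cases i <;> simp)
  rw [Fin.sum_univ_two]
  simp only [tileCC, hx', lt_two_thirds_iff hy, true_and, hi, eq_comm (a := coord (3 * x))]
  by_cases hk : coord (3 * y) = coord (3 * x)
  · rcases eq_or_ne ⌊3 * y⌋ 0 with h₀ | h₀
    · fin_cases i <;> simp [hk, h₀]
    · rcases eq_or_ne ⌊3 * y⌋ 1 with h₁ | h₁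
      · fin_cases i <;> simp [hk, h₁]
      · simp [h₀, h₁]
  · simp only [hk, and_false, if_false, mul_zero, add_zero]

theorem integral_tileCC (z : Cube) (hx : 0 ≤ x) :
    ∫ y in Ico (0 : ℝ) 1, tileCC z x y =
      if x < 2 / 3 then (1 / 2) ^ (coord (3 * x) : ℕ) / 3 else 0 := by
  split_ifs with hx'
  · obtain ⟨i, hi⟩ : ∃ i : Fin 2, ⌊3 * x⌋ = (i : ℕ) :=
      ((lt_two_thirds_iff hx).mp hx').elim (fun h => ⟨0, h⟩) fun h => ⟨1, h⟩
    rw [setIntegral_congr_fun measurableSet_Ico fun y hy => tileCC_eq_sum z hx hi hy.1,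
      integral_finsetSum]
    · have hj : ∀ j : Fin 2, ∫ y in Ico (0 : ℝ) 1, (if ⌊3 * y⌋ = (j : ℕ) ∧
          coord (3 * y) = coord (3 * x) then (1 : ℝ) else 0) = (1 / 2) ^ (coord (3 * x) : ℕ) / 3 :=
        fun j => integral_ite_floor_coord (coord (3 * x)) j.castSucc
      simp only [integral_const_mul, hj, Fin.sum_univ_two]
      fin_cases i <;> simp only [Fin.zero_eta, Fin.mk_one, zero_ne_one, one_ne_zero, if_true,
        if_false] <;> ring
    · exact fun j _ => (integrableOn_ite_floor_coord (coord (3 * x)) j).const_mul _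
  · simp only [tileCC, hx', false_and, if_false, integral_zero]

end Tiles

/-! ### Dependence of the tiles on `z` -/

/-- The parts other than `C` and `E`: the tiles between two of them do not depend on `z`. -/
def Part.Outer (X : Part) : Prop := X ≠ .core .C ∧ X ≠ .core .E

section Independence

variable {P : BoundingSequence} (W₀ : ℝ → ℝ → ℝ)

theorem coreTile_eq_of_outer {X : Core} (hX : (Part.core X).Outer) (z z' : Cube) (Y : Core)
    (x y : ℝ) : coreTile P W₀ z X Y x y = coreTile P W₀ z' X Y x y := by
  obtain ⟨hC, hE⟩ := hX
  unfold coreTile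
  cases X <;> cases Y <;> first | contradiction | rfl

theorem coreDegree_eq_of_outer {X : Core} (hX : (Part.core X).Outer) (z z' : Cube) (x : ℝ) :
    coreDegree P W₀ z X x = coreDegree P W₀ z' X x := by
  simp only [coreDegree, coreTile_eq_of_outer W₀ hX z z']

theorem tile_eq_of_outer {X Y : Part} (hX : X.Outer) (hY : Y.Outer) (z z' : Cube) (x y : ℝ) :
    tile P W₀ z X Y x y = tile P W₀ z' X Y x y := by
  cases X <;> cases Y <;> simp only [tile]
  · exact coreTile_eq_of_outer W₀ hX z z' _ x y
  · rw [coreDegree_eq_of_outer W₀ hX z z']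
  · rw [coreDegree_eq_of_outer W₀ hY z z']

theorem coreDegree_C_eq (z z' : Cube) {x : ℝ} (hx : 0 ≤ x) :
    coreDegree P W₀ z .C x = coreDegree P W₀ z' .C x := by
  have hC : ∀ z, ∫ s in Ico (0 : ℝ) 1, coreTile P W₀ z .C .C x s = _ := fun z =>
    integral_tileCC z hx
  have hE : ∀ z, ∫ s in Ico (0 : ℝ) 1, coreTile P W₀ z .C .E x s = _ := fun z =>
    integral_tileCE_right P z x
  simp only [coreDegree, hC, hE]
  rfl

theorem tile_C_eq_of_outer {Y : Part} (hY : Y.Outer) (z z' : Cube) {x : ℝ} (hx : 0 ≤ x) (y : ℝ) :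
    tile P W₀ z (.core .C) Y x y = tile P W₀ z' (.core .C) Y x y := by
  obtain ⟨hC, hE⟩ := hY
  rcases Y with (_ | _ | _ | k | _ | _) | _ | _
  case Q => simp only [tile, coreDegree_C_eq W₀ z z' hx]
  all_goals first | contradiction | rfl

/-- Two points of the part `E` that lie in the same block and, if it is a block of the first third,
on the same side of the relative positions `l` and `u`. Outside `C`, the tiles of `E` do not
distinguish them. -/
structure SameZone (P : BoundingSequence) (y y' : ℝ) : Prop where
  floor_eq : ⌊3 * y⌋ = ⌊3 * y'⌋
  coord_eq : coord (3 * y) = coord (3 * y')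
  lower : ⌊3 * y⌋ = 0 → (relPos (coord (3 * y)) 0 y < P.l (coord (3 * y)) ↔
    relPos (coord (3 * y)) 0 y' < P.l (coord (3 * y)))
  upper : ⌊3 * y⌋ = 0 → (relPos (coord (3 * y)) 0 y < P.u (coord (3 * y)) ↔
    relPos (coord (3 * y)) 0 y' < P.u (coord (3 * y)))

namespace SameZone

variable {z z' : Cube} {y y' : ℝ}

theorem tileGE_eq (h : SameZone P y y') (hy : 0 ≤ y) (hy' : 0 ≤ y') (hyz : y ∉ jumpSet P z)
    (hyz' : y' ∉ jumpSet P z') (x : ℝ) : tileGE P x y = tileGE P x y' := by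
  unfold tileGE
  simp only [← floor_three_mul_eq_zero_iff hy, ← floor_three_mul_eq_zero_iff hy', ← h.floor_eq,
    ← h.coord_eq, two_pow_mul_add_eq_relPos_zero]
  refine if_congr (and_congr_right fun hfloor => and_congr_right fun _ => ?_) rfl rfl
  have hne := relPos_zero_notMem hyz (coord (3 * y))
  have hne' := relPos_zero_notMem hyz' (coord (3 * y))
  simp only [mem_insert_iff, mem_singleton_iff, not_or, ← ne_eq] at hne hne'
  obtain ⟨hl, -, hu, -⟩ := hne
  obtain ⟨hl', -, hu', -⟩ := hne'
  rw [hl.le_iff_lt, hu.le_iff_lt, hl'.le_iff_lt, hu'.le_iff_lt, h.lower hfloor, h.upper hfloor]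

theorem coreTile_eq (h : SameZone P y y') (hy : 0 ≤ y) (hy' : 0 ≤ y') (hyz : y ∉ jumpSet P z)
    (hyz' : y' ∉ jumpSet P z') {Y : Core} (hY : Y ≠ .C) (s : ℝ) :
    coreTile P W₀ z .E Y y s = coreTile P W₀ z' .E Y y' s := by
  cases Y
  case C => contradiction
  case A =>
    change (if _ then _ else _) = (if _ then _ else _)
    simp only [upperTile, h.floor_eq]
  case B =>
    change (if _ then _ else _) = (if _ then _ else _)
    simp only [upperTile, h.floor_eq, h.coord_eq]
  case D k =>
    have hidx : ¬ Core.E.idx ≤ (Core.D k).idx := by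
      simp only [Core.idx]
      omega
    simp only [coreTile, if_neg hidx, upperTile, h.tileGE_eq hy hy' hyz hyz' s]
  all_goals rfl

theorem coreDegree_eq (h : SameZone P y y') (hy : 0 ≤ y) (hy' : 0 ≤ y') (hyz : y ∉ jumpSet P z)
    (hyz' : y' ∉ jumpSet P z') : coreDegree P W₀ z .E y = coreDegree P W₀ z' .E y' := by
  have hC : ∫ s in Ico (0 : ℝ) 1, coreTile P W₀ z .E .C y s =
      ∫ s in Ico (0 : ℝ) 1, coreTile P W₀ z' .E .C y' s := by
    have hright := integral_tileCE_left hyz'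
    rw [← h.floor_eq, ← h.coord_eq] at hright
    exact (integral_tileCE_left hyz).trans hright.symm
  have hne : ∀ {Y : Core}, Y ≠ .C → ∀ s, coreTile P W₀ z .E Y y s = coreTile P W₀ z' .E Y y' s :=
    h.coreTile_eq W₀ hy hy' hyz hyz'
  simp only [coreDegree, hC, hne (Y := .A) nofun, hne (Y := .B) nofun,
    fun m => hne (Y := .D m) nofun, hne (Y := .E) nofun, hne (Y := .F) nofun]

theorem tile_eq (h : SameZone P y y') (hy : 0 ≤ y) (hy' : 0 ≤ y') (hyz : y ∉ jumpSet P z)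
    (hyz' : y' ∉ jumpSet P z') {Y : Part} (hY : Y.Outer) (s : ℝ) :
    tile P W₀ z (.core .E) Y y s = tile P W₀ z' (.core .E) Y y' s := by
  cases Y with
  | core Y => exact h.coreTile_eq W₀ hy hy' hyz hyz' (fun hYC => hY.1 (hYC ▸ rfl)) s
  | Q => simp only [tile, h.coreDegree_eq W₀ hy hy' hyz hyz']
  | R => rfl

end SameZone

end Independence

/-! ### The pieces partition the unit interval -/

section Cuts

theorem existsUnique_mem_Ico_castSucc_succ {α : Type*} [LinearOrder α] {n : ℕ}
    {b : Fin (n + 1) → α} (hb : Monotone b) {t : α} (ht : t ∈ Ico (b 0) (b (Fin.last n))) :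
    ∃! i : Fin n, t ∈ Ico (b i.castSucc) (b i.succ) := by
  obtain ⟨i, hi⟩ : ∃ i : Fin n, t ∈ Ico (b i.castSucc) (b i.succ) := by
    by_contra! h
    have hle : ∀ i, b i ≤ t := Fin.induction ht.1 fun i hi => not_lt.mp fun hlt => h i ⟨hi, hlt⟩
    exact ht.2.not_ge (hle _)
  refine ⟨i, hi, fun i' hi' => ?_⟩
  rcases lt_trichotomy i' i with h | h | h
  · exact absurd (hi'.2.trans_le (hb (Fin.succ_le_castSucc_iff.mpr h))) hi.1.not_gt
  · exact h
  · exact absurd (hi.2.trans_le (hb (Fin.succ_le_castSucc_iff.mpr h))) hi'.1.not_gt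

/-- The relative positions at which the blocks of the first third of the part `E` are cut. -/
def firstCuts (P : BoundingSequence) (z : Cube) (k : ℕ+) : Fin 5 → ℝ :=
  ![0, P.l k, P.pval k z, P.u k, 1]

/-- The relative positions at which the blocks of the second third of the part `E` are cut. -/
def secondCuts (P : BoundingSequence) (z : Cube) (k : ℕ+) : Fin 3 → ℝ :=
  ![0, 1 - P.pval k z, 1]

variable {P : BoundingSequence} {z : Cube}

theorem monotone_firstCuts (hz : P.Feasible z) (k : ℕ+) : Monotone (firstCuts P z k) := by
  rw [Fin.monotone_iff_le_succ]
  intro i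
  fin_cases i
  exacts [(P.l_mem k).1, (hz k).1, (hz k).2, (P.u_mem k).2]

theorem monotone_secondCuts (P : BoundingSequence) (z : Cube) (k : ℕ+) :
    Monotone (secondCuts P z k) := by
  rw [Fin.monotone_iff_le_succ]
  intro i
  fin_cases i
  exacts [sub_nonneg.mpr (pval_mem P k z).2, sub_le_self 1 (pval_mem P k z).1]

end Cuts

variable {k : ℕ+} {j : ℕ} {x : ℝ}

theorem blockPoint_zero (k : ℕ+) (j : ℕ) : blockPoint k j 0 = blockStart k j := by
  rw [blockPoint, mul_zero, add_zero]

theorem blockPoint_one (k : ℕ+) (j : ℕ) :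
    blockPoint k j 1 = blockStart k j + (1 / 2) ^ (k : ℕ) / 3 := by
  rw [blockPoint, mul_one]

theorem mem_Ico_blockStart_iff :
    x ∈ Ico (blockStart k j) (blockStart k j + (1 / 2) ^ (k : ℕ) / 3) ↔
      ⌊3 * x⌋ = j ∧ coord (3 * x) = k := by
  rw [← blockPoint_one, ← blockPoint_zero, mem_Ico_blockPoint_iff, floor_eq_and_coord_eq_iff]

namespace Cell

/-- The left endpoint of the piece itself, in the coordinate of its part. -/
def left (P : BoundingSequence) (z : Cube) : Cell → ℝ
  | .E₁ k i => blockPoint k 0 (firstCuts P z k i.castSucc)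
  | .E₂ k i => blockPoint k 1 (secondCuts P z k i.castSucc)
  | c => c.lo P

/-- The right endpoint of the piece itself, in the coordinate of its part. -/
def right (P : BoundingSequence) (z : Cube) : Cell → ℝ
  | .E₁ k i => blockPoint k 0 (firstCuts P z k i.succ)
  | .E₂ k i => blockPoint k 1 (secondCuts P z k i.succ)
  | c => c.hi P

variable {P : BoundingSequence} {z : Cube} {c d : Cell}

theorem size_mul_right_sub_left (c : Cell) :
    c.part.size * (c.right P z - c.left P z) = MvPolynomial.eval z.val (c.measurePoly P) := by
  have hblock : ∀ {k j} {a b v : ℝ}, v = b - a →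
      1 / 25 * (blockPoint k j b - blockPoint k j a) = (1 / 2) ^ (k : ℕ) / 75 * v := by
    rintro k j a b v rfl
    unfold blockPoint
    ring
  have hwhole (k : ℕ+) (j : ℕ) :
      1 / 25 * (blockStart k j + (1 / 2) ^ (k : ℕ) / 3 - blockStart k j) =
        (1 / 2 : ℝ) ^ (k : ℕ) / 75 := by ring
  cases c with
  | E₁ k i =>
    rw [measurePoly, map_mul, MvPolynomial.eval_C]
    refine hblock ?_
    fin_cases i <;> simp [firstCuts, BoundingSequence.pval]
  | E₂ k i =>
    rw [measurePoly, map_mul, MvPolynomial.eval_C]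
    refine hblock ?_
    fin_cases i <;> simp [secondCuts, BoundingSequence.pval]
  | E₃ k => exact (hwhole k 2).trans (MvPolynomial.eval_C _).symm
  | C k j => exact (hwhole k j).trans (MvPolynomial.eval_C _).symm
  | _ => simp only [left, right, lo, hi, measurePoly, MvPolynomial.eval_C, sub_zero, mul_one]

theorem left_le_right (hz : P.Feasible z) (c : Cell) : c.left P z ≤ c.right P z := by
  cases c with
  | E₁ k i =>
    exact (blockPoint_strictMono k 0).monotone (monotone_firstCuts hz k i.castSucc_le_succ)
  | E₂ k i =>
    exact (blockPoint_strictMono k 1).monotone (monotone_secondCuts P z k i.castSucc_le_succ)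
  | E₃ k => exact le_add_of_nonneg_right (by positivity)
  | C k j => exact le_add_of_nonneg_right (by positivity)
  | _ => exact zero_le_one

theorem lo_mem (c : Cell) : c.lo P ∈ Ico 0 1 := by
  have hstart (k : ℕ+) (j : Fin 3) : blockStart k j ∈ Ico (0 : ℝ) 1 :=
    blockPoint_zero k j ▸ blockPoint_mem k j (left_mem_Icc.mpr zero_le_one)
  cases c with
  | E₁ k i =>
    refine blockPoint_mem k 0 (t := ![0, P.l k, P.l k, P.u k] i) ?_
    fin_cases i
    exacts [left_mem_Icc.mpr zero_le_one, P.l_mem k, P.l_mem k, P.u_mem k]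
  | E₂ k i => exact hstart k 1
  | E₃ k => exact hstart k 2
  | C k j => exact hstart k j
  | _ => exact left_mem_Ico.mpr one_pos

theorem hi_mem (c : Cell) : c.hi P ∈ Icc 0 1 := by
  have hend (k : ℕ+) (j : Fin 3) : blockStart k j + (1 / 2) ^ (k : ℕ) / 3 ∈ Icc (0 : ℝ) 1 :=
    blockPoint_one k j ▸
      Ico_subset_Icc_self (blockPoint_mem k j (right_mem_Icc.mpr zero_le_one))
  cases c with
  | E₁ k i =>
    refine Ico_subset_Icc_self (blockPoint_mem k 0 (t := ![P.l k, P.u k, P.u k, 1] i) ?_)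
    fin_cases i
    exacts [P.l_mem k, P.u_mem k, P.u_mem k, right_mem_Icc.mpr zero_le_one]
  | E₂ k i => exact hend k 1
  | E₃ k => exact hend k 2
  | C k j => exact hend k j
  | _ => exact right_mem_Icc.mpr zero_le_one

theorem Ico_left_right_subset_Ico_lo_hi (hz : P.Feasible z) (c : Cell) :
    Ico (c.left P z) (c.right P z) ⊆ Ico (c.lo P) (c.hi P) := by
  cases c with
  | E₁ k i =>
    refine Ico_subset_Ico ((blockPoint_strictMono k 0).monotone ?_)
      ((blockPoint_strictMono k 0).monotone ?_)
    · fin_cases i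
      exacts [le_rfl, le_rfl, (hz k).1, le_rfl]
    · fin_cases i
      exacts [le_rfl, (hz k).2, le_rfl, le_rfl]
  | E₂ k i =>
    rw [lo, hi, ← blockPoint_one, ← blockPoint_zero]
    exact Ico_subset_Ico
      ((blockPoint_strictMono k 1).monotone (monotone_secondCuts P z k (Fin.zero_le _)))
      ((blockPoint_strictMono k 1).monotone (monotone_secondCuts P z k (Fin.le_last _)))
  | _ => exact subset_rfl

theorem mem_unit_of_mem_Ico (hz : P.Feasible z) (hx : x ∈ Ico (c.left P z) (c.right P z)) :
    x ∈ Ico 0 1 :=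
  Ico_subset_Ico c.lo_mem.1 c.hi_mem.2 (Ico_left_right_subset_Ico_lo_hi hz c hx)

theorem floor_coord_of_mem_E₁ {i : Fin 4} (hx : x ∈ Ico ((E₁ k i).lo P) ((E₁ k i).hi P)) :
    ⌊3 * x⌋ = 0 ∧ coord (3 * x) = k := by
  refine floor_eq_and_coord_eq_iff.mpr (mem_Ico_blockPoint_iff.mp
    (Ico_subset_Ico ((blockPoint_strictMono k 0).monotone ?_)
      ((blockPoint_strictMono k 0).monotone ?_) hx))
  · fin_cases i
    exacts [le_rfl, (P.l_mem k).1, (P.l_mem k).1, (P.u_mem k).1]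
  · fin_cases i
    exacts [(P.l_mem k).2, (P.u_mem k).2, (P.u_mem k).2, le_rfl]

theorem eq_of_mem_Ico_of_part_eq (hz : P.Feasible z) (hcd : c.part = d.part)
    (hc : x ∈ Ico (c.left P z) (c.right P z)) (hd : x ∈ Ico (d.left P z) (d.right P z)) :
    c = d := by
  have hc' := Ico_left_right_subset_Ico_lo_hi hz c hc
  have hd' := Ico_left_right_subset_Ico_lo_hi hz d hd
  have hE₁ : ∀ {k i}, x ∈ Ico ((E₁ k i).lo P) ((E₁ k i).hi P) → _ := floor_coord_of_mem_E₁
  have hblock : ∀ {k j}, x ∈ Ico (blockStart k j) (blockStart k j + (1 / 2) ^ (k : ℕ) / 3) → _ :=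
    mem_Ico_blockStart_iff.mp
  have hfloor : ∀ {m m' : ℤ}, ⌊3 * x⌋ = m → ⌊3 * x⌋ = m' → m = m' := fun h h' => h.symm.trans h'
  cases c <;> cases d <;> simp only [part, Part.core.injEq, reduceCtorEq, Core.D.injEq] at hcd
  case C.C k j k' j' =>
    obtain rfl := (hblock hc').2.symm.trans (hblock hd').2
    rw [Fin.ext (Nat.cast_injective (hfloor (hblock hc').1 (hblock hd').1))]
  case E₁.E₁ k i k' i' =>
    obtain rfl := (hE₁ hc').2.symm.trans (hE₁ hd').2
    have ht : relPos k 0 x ∈ Ico 0 1 := floor_eq_and_coord_eq_iff.mp (hE₁ hc')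
    rw [(existsUnique_mem_Ico_castSucc_succ (monotone_firstCuts hz k) ht).unique
      (mem_Ico_blockPoint_iff.mp hc) (mem_Ico_blockPoint_iff.mp hd)]
  case E₂.E₂ k i k' i' =>
    obtain rfl := (hblock hc').2.symm.trans (hblock hd').2
    have ht : relPos k 1 x ∈ Ico 0 1 := floor_eq_and_coord_eq_iff.mp (hblock hc')
    rw [(existsUnique_mem_Ico_castSucc_succ (monotone_secondCuts P z k) ht).unique
      (mem_Ico_blockPoint_iff.mp hc) (mem_Ico_blockPoint_iff.mp hd)]
  case E₃.E₃ => rw [(hblock hc').2.symm.trans (hblock hd').2]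
  case E₁.E₂ => exact absurd (hfloor (hE₁ hc').1 (hblock hd').1) (by norm_num)
  case E₁.E₃ => exact absurd (hfloor (hE₁ hc').1 (hblock hd').1) (by norm_num)
  case E₂.E₁ => exact absurd (hfloor (hblock hc').1 (hE₁ hd').1) (by norm_num)
  case E₃.E₁ => exact absurd (hfloor (hblock hc').1 (hE₁ hd').1) (by norm_num)
  case E₂.E₃ => exact absurd (hfloor (hblock hc').1 (hblock hd').1) (by norm_num)
  case E₃.E₂ => exact absurd (hfloor (hblock hc').1 (hblock hd').1) (by norm_num)
  case D.D => rw [hcd]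
  all_goals rfl

theorem exists_part_eq_and_mem_Ico (hz : P.Feasible z) (X : Part) (hx : x ∈ Ico 0 1) :
    ∃ c : Cell, c.part = X ∧ x ∈ Ico (c.left P z) (c.right P z) := by
  obtain ⟨j, hj⟩ := exists_floor_three_mul_eq hx
  rcases X with (_ | _ | _ | m | _ | _) | _ | _
  case core.A => exact ⟨.A, rfl, hx⟩
  case core.B => exact ⟨.B, rfl, hx⟩
  case core.C => exact ⟨.C (coord (3 * x)) j, rfl, mem_Ico_blockStart_iff.mpr ⟨hj, rfl⟩⟩
  case core.D => exact ⟨.D m, rfl, hx⟩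
  case core.F => exact ⟨.F, rfl, hx⟩
  case Q => exact ⟨.Q, rfl, hx⟩
  case R => exact ⟨.R, rfl, hx⟩
  case core.E =>
    set k := coord (3 * x) with hk
    have ht : relPos k j x ∈ Ico 0 1 := floor_eq_and_coord_eq_iff.mp ⟨hj, hk.symm⟩
    fin_cases j
    · obtain ⟨i, hi, -⟩ := existsUnique_mem_Ico_castSucc_succ (monotone_firstCuts hz k) ht
      exact ⟨.E₁ k i, rfl, mem_Ico_blockPoint_iff.mpr hi⟩
    · obtain ⟨i, hi, -⟩ := existsUnique_mem_Ico_castSucc_succ (monotone_secondCuts P z k) ht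
      exact ⟨.E₂ k i, rfl, mem_Ico_blockPoint_iff.mpr hi⟩
    · exact ⟨.E₃ k, rfl, mem_Ico_blockStart_iff.mpr ⟨hj, hk.symm⟩⟩

/-- The piece as a subset of `[0,1)`. -/
def carrier (P : BoundingSequence) (z : Cube) (c : Cell) : Set ℝ :=
  Ico (c.part.embed (c.left P z)) (c.part.embed (c.right P z))

theorem mem_carrier_iff {s : ℝ} :
    s ∈ c.carrier P z ↔ c.part.unembed s ∈ Ico (c.left P z) (c.right P z) := by
  have hpos := c.part.size_pos
  rw [carrier, Part.embed, Part.embed, Part.unembed, mem_Ico, mem_Ico, le_div_iff₀ hpos,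
    div_lt_iff₀ hpos, le_sub_iff_add_le', sub_lt_iff_lt_add', mul_comm, mul_comm (c.right P z)]

theorem disjoint_carrier (hz : P.Feasible z) (hcd : c ≠ d) :
    Disjoint (c.carrier P z) (d.carrier P z) := by
  rw [Set.disjoint_left]
  intro s hc hd
  rw [mem_carrier_iff] at hc hd
  have hpart : c.part = d.part := by
    rw [← partOf_embed c.part (mem_unit_of_mem_Ico hz hc), Part.embed_unembed,
      ← partOf_embed d.part (mem_unit_of_mem_Ico hz hd), Part.embed_unembed]
  exact hcd (eq_of_mem_Ico_of_part_eq hz hpart hc (hpart ▸ hd))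

theorem iUnion_carrier (hz : P.Feasible z) : ⋃ c : Cell, c.carrier P z = Ico 0 1 := by
  ext s
  rw [mem_iUnion]
  constructor
  · rintro ⟨c, hc⟩
    rw [← Part.embed_unembed c.part s]
    exact c.part.embed_mem (mem_unit_of_mem_Ico hz (mem_carrier_iff.mp hc))
  · intro hs
    obtain ⟨c, hpart, hc⟩ := exists_part_eq_and_mem_Ico hz (partOf s) (unembed_partOf_mem hs)
    exact ⟨c, mem_carrier_iff.mpr (hpart ▸ hc)⟩

end Cell

/-! ### The values of `W_P(z)` on products of pieces -/

theorem affine_mem_Ico {a b t : ℝ} (hab : a < b) (ht : t ∈ Ico (0 : ℝ) 1) :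
    a + (b - a) * t ∈ Ico a b := by
  have hpos : 0 < b - a := sub_pos.mpr hab
  exact ⟨le_add_of_nonneg_right (mul_nonneg hpos.le ht.1),
    by nlinarith [mul_pos hpos (sub_pos.mpr ht.2)]⟩

theorem affine_injective {a b : ℝ} (hab : a < b) :
    Function.Injective fun t : ℝ => a + (b - a) * t :=
  fun _ _ h => mul_left_cancel₀ (sub_pos.mpr hab).ne' (add_left_cancel h)

namespace Cell

variable {P : BoundingSequence} {W₀ : ℝ → ℝ → ℝ} {z : Cube} {c d : Cell} {k : ℕ+} {x y s t : ℝ}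

theorem outer_of_not_inCE (hc : ¬ c.InCE) : c.part.Outer := by
  cases c <;> first | exact absurd trivial hc | exact ⟨nofun, nofun⟩

theorem part_of_inCE (hc : c.InCE) : c.part = .core .C ∨ c.part = .core .E := by
  cases c <;> first | exact Or.inl rfl | exact Or.inr rfl | exact hc.elim

theorem left_eq_lo (hc : c.part ≠ .core .E) : c.left P z = c.lo P := by
  cases c <;> first | rfl | exact absurd rfl hc

theorem right_eq_hi (hc : c.part ≠ .core .E) : c.right P z = c.hi P := by
  cases c <;> first | rfl | exact absurd rfl hc

theorem lo_lt_hi (hz : P.Feasible z) (hc : c.left P z < c.right P z) : c.lo P < c.hi P :=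
  have hleft := Ico_left_right_subset_Ico_lo_hi hz c (left_mem_Ico.mpr hc)
  hleft.1.trans_lt hleft.2

/-- The coordinate, in its part, of the point at relative position `t` of the piece itself. -/
def coordAt (P : BoundingSequence) (z : Cube) (c : Cell) (t : ℝ) : ℝ :=
  c.left P z + (c.right P z - c.left P z) * t

/-- The coordinate, in its part, of the point at relative position `t` of the `z`-independent
interval containing the piece; `Cell.point` is the corresponding point of `[0,1)`. -/
def hullCoordAt (P : BoundingSequence) (c : Cell) (t : ℝ) : ℝ :=
  c.lo P + (c.hi P - c.lo P) * t

theorem coordAt_eq_hullCoordAt (z : Cube) (hc : c.part ≠ .core .E) (t : ℝ) :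
    c.coordAt P z t = c.hullCoordAt P t := by
  rw [coordAt, hullCoordAt, left_eq_lo hc, right_eq_hi hc]

theorem hullCoordAt_mem (c : Cell) (ht : t ∈ Ico 0 1) : c.hullCoordAt P t ∈ Ico 0 1 := by
  have hlo := c.lo_mem (P := P)
  have hhi := c.hi_mem (P := P)
  unfold hullCoordAt
  have hs := sub_pos.mpr ht.2
  constructor
  · nlinarith [mul_nonneg hhi.1 ht.1, mul_nonneg hlo.1 hs.le]
  · nlinarith [mul_nonneg (sub_nonneg.mpr hhi.2) ht.1, mul_pos (sub_pos.mpr hlo.2) hs]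

theorem point_mem (c : Cell) (ht : t ∈ Ico 0 1) : c.point P t ∈ Ico 0 1 :=
  c.part.embed_mem (c.hullCoordAt_mem ht)

theorem relPos_lt_l_iff {i : Fin 4} (hx : x ∈ Ico ((E₁ k i).lo P) ((E₁ k i).hi P)) :
    relPos k 0 x < P.l k ↔ i = 0 := by
  obtain ⟨hle, hlt⟩ : relPos k 0 x ∈ Ico (![0, P.l k, P.l k, P.u k] i) (![P.l k, P.u k, P.u k, 1] i)
    := mem_Ico_blockPoint_iff.mp hx
  fin_cases i
  exacts [iff_of_true hlt rfl, iff_of_false (not_lt.mpr hle) nofun,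
    iff_of_false (not_lt.mpr hle) nofun,
    iff_of_false (not_lt.mpr ((P.l_le_u k).trans hle)) nofun]

theorem relPos_lt_u_iff {i : Fin 4} (hx : x ∈ Ico ((E₁ k i).lo P) ((E₁ k i).hi P)) :
    relPos k 0 x < P.u k ↔ i ≠ 3 := by
  obtain ⟨hle, hlt⟩ : relPos k 0 x ∈ Ico (![0, P.l k, P.l k, P.u k] i) (![P.l k, P.u k, P.u k, 1] i)
    := mem_Ico_blockPoint_iff.mp hx
  fin_cases i
  exacts [iff_of_true (hlt.trans_le (P.l_le_u k)) nofun, iff_of_true hlt nofun,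
    iff_of_true hlt nofun, iff_of_false (not_lt.mpr hle) (not_not.mpr rfl)]

theorem sameZone (hc : c.part = .core .E) (hx : x ∈ Ico (c.lo P) (c.hi P))
    (hy : y ∈ Ico (c.lo P) (c.hi P)) : SameZone P x y := by
  have hblock : ∀ {k j}, j ≠ 0 →
      x ∈ Ico (blockStart k j) (blockStart k j + (1 / 2) ^ (k : ℕ) / 3) →
      y ∈ Ico (blockStart k j) (blockStart k j + (1 / 2) ^ (k : ℕ) / 3) → SameZone P x y := by
    intro k j hj hx hy
    obtain ⟨hfx, hkx⟩ := mem_Ico_blockStart_iff.mp hx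
    obtain ⟨hfy, hky⟩ := mem_Ico_blockStart_iff.mp hy
    have hne : ⌊3 * x⌋ ≠ 0 := hfx ▸ Nat.cast_ne_zero.mpr hj
    exact ⟨hfx.trans hfy.symm, hkx.trans hky.symm, fun h => absurd h hne, fun h => absurd h hne⟩
  cases c with
  | E₁ k i =>
    obtain ⟨hfx, rfl⟩ := floor_coord_of_mem_E₁ hx
    obtain ⟨hfy, hky⟩ := floor_coord_of_mem_E₁ hy
    exact ⟨hfx.trans hfy.symm, hky.symm,
      fun _ => (relPos_lt_l_iff hx).trans (relPos_lt_l_iff hy).symm,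
      fun _ => (relPos_lt_u_iff hx).trans (relPos_lt_u_iff hy).symm⟩
  | E₂ k i => exact hblock one_ne_zero hx hy
  | E₃ k => exact hblock two_ne_zero hx hy
  | _ => exact absurd hc nofun

/-- At relative position `t`, both the piece and the `z`-independent interval containing it avoid
the jumps of the tiles. This holds for all but countably many `t`. -/
def Regular (P : BoundingSequence) (z : Cube) (c : Cell) (t : ℝ) : Prop :=
  c.coordAt P z t ∉ jumpSet P z ∧ c.hullCoordAt P t ∉ jumpSet P fun _ => 0

theorem countable_setOf_not_regular (hz : P.Feasible z) (hc : c.left P z < c.right P z) :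
    {t | ¬ c.Regular P z t}.Countable := by
  refine (((countable_jumpSet P z).preimage (affine_injective hc)).union
    ((countable_jumpSet P fun _ => 0).preimage (affine_injective (lo_lt_hi hz hc)))).mono ?_
  intro t ht
  exact (not_and_or.mp ht).imp not_not.mp not_not.mp

theorem tile_coordAt_eq (hz : P.Feasible z) (hc : c.left P z < c.right P z) {Y : Part}
    (hY : Y.Outer) (ht : t ∈ Ico 0 1) (hreg : c.Regular P z t) (s : ℝ) :
    tile P W₀ z c.part Y (c.coordAt P z t) s =
      tile P W₀ (fun _ => 0) c.part Y (c.hullCoordAt P t) s := by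
  have hx := affine_mem_Ico hc ht
  have hy := affine_mem_Ico (lo_lt_hi hz hc) ht
  have hx₀ : 0 ≤ c.coordAt P z t := (mem_unit_of_mem_Ico hz hx).1
  by_cases hE : c.part = .core .E
  · have hzone := sameZone hE (Ico_left_right_subset_Ico_lo_hi hz c hx) hy
    rw [hE]
    exact hzone.tile_eq W₀ hx₀ (c.hullCoordAt_mem ht).1 hreg.1 hreg.2 hY s
  · rw [← coordAt_eq_hullCoordAt z hE]
    by_cases hC : c.part = .core .C
    · rw [hC]
      exact tile_C_eq_of_outer W₀ hY z _ hx₀ s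
    · exact tile_eq_of_outer W₀ ⟨hC, hE⟩ hY z _ _ s

theorem WP_embed_coordAt_of_not_inCE (hW₀ : IsGraphon W₀) (hz : P.Feasible z)
    (hcd : ¬ (c.InCE ∧ d.InCE)) (hc : c.left P z < c.right P z) (hd : d.left P z < d.right P z)
    (ht : t ∈ Ico 0 1) (hs : s ∈ Ico 0 1) (htr : c.Regular P z t) (hsr : d.Regular P z s) :
    WP P W₀ z (c.part.embed (c.coordAt P z t)) (d.part.embed (d.coordAt P z s)) =
      WP P W₀ (fun _ => 0) (c.point P t) (d.point P s) := by
  have hx : c.coordAt P z t ∈ Ico 0 1 := mem_unit_of_mem_Ico hz (affine_mem_Ico hc ht)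
  have hy : d.coordAt P z s ∈ Ico 0 1 := mem_unit_of_mem_Ico hz (affine_mem_Ico hd hs)
  have hx' := c.hullCoordAt_mem (P := P) ht
  have hy' := d.hullCoordAt_mem (P := P) hs
  refine (WP_embed P W₀ z _ _ hx hy).trans (Eq.trans ?_ (WP_embed P W₀ _ _ _ hx' hy').symm)
  by_cases h : d.InCE
  · have hco := outer_of_not_inCE fun h' => hcd ⟨h', h⟩
    rw [tile_comm hW₀ z _ _ hx hy, tile_comm hW₀ _ _ _ hx' hy', ← coordAt_eq_hullCoordAt z hco.2]
    exact tile_coordAt_eq hz hd hco hs hsr _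
  · have hdo := outer_of_not_inCE h
    rw [← coordAt_eq_hullCoordAt z hdo.2]
    exact tile_coordAt_eq hz hc hdo ht htr _

end Cell

section Edges

variable {P : BoundingSequence} {W₀ : ℝ → ℝ → ℝ} {z : Cube} {c d : Cell} {x y : ℝ}

theorem eval_ite_one_zero {σ R : Type*} [CommSemiring R] (f : σ → R) (p : Prop) [Decidable p] :
    MvPolynomial.eval f (if p then 1 else 0) = if p then 1 else 0 := by
  split_ifs
  · exact map_one _
  · exact map_zero _

theorem edgePoly_comm_of_part_eq (hc : c.part = .core .E) (hd : d.part = .core .C) :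
    edgePoly c d = edgePoly d c := by
  cases c <;> cases hc <;> cases d <;> cases hd <;> rfl

theorem edgePoly_eq_zero_of_part_eq (hc : c.part = .core .E) (hd : d.part = .core .E) :
    edgePoly c d = 0 := by
  cases c <;> cases hc <;> cases d <;> cases hd <;> rfl

theorem lt_two_thirds_iff_ne {j : Fin 3} (hx : 0 ≤ x) (hj : ⌊3 * x⌋ = (j : ℕ)) :
    x < 2 / 3 ↔ j ≠ 2 := by
  rw [lt_two_thirds_iff hx, hj]
  fin_cases j <;> decide

theorem tileCC_eq_eval_edgePoly {j j' : Fin 3} (hx : 0 ≤ x) (hy : 0 ≤ y)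
    (hj : ⌊3 * x⌋ = (j : ℕ)) (hj' : ⌊3 * y⌋ = (j' : ℕ)) :
    tileCC z x y =
      MvPolynomial.eval z.val (edgePoly (.C (coord (3 * x)) j) (.C (coord (3 * y)) j')) := by
  have hfloor : ⌊3 * x⌋ = ⌊3 * y⌋ ↔ j = j' := by rw [hj, hj', Nat.cast_inj, Fin.ext_iff]
  have hmonomial : ∀ A, MvPolynomial.eval z.val (MvPolynomial.monomial A 1) = monomialValue A z :=
    fun A => MvPolynomial.eval_monomial.trans (one_mul _)
  simp only [tileCC, edgePoly, lt_two_thirds_iff_ne hx hj, lt_two_thirds_iff_ne hy hj', hfloor,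
    ← and_assoc, and_comm (b := coord (3 * x) = coord (3 * y)), apply_ite (MvPolynomial.eval z.val),
    map_sub, map_one, map_zero, hmonomial]

theorem mem_sides_iff_of_mem_E₁ {k : ℕ+} {i : Fin 4} (hz : P.Feasible z)
    (hy : y ∈ Ico ((Cell.E₁ k i).left P z) ((Cell.E₁ k i).right P z)) (k' : ℕ+) :
    (y ∈ firstSide P z k' ↔ k' = k ∧ i < 2) ∧ (y ∈ secondSide P z k' ↔ k' = k ∧ 2 ≤ i) := by
  obtain ⟨hle, hlt⟩ : relPos k 0 y ∈ Ico (firstCuts P z k i.castSucc) (firstCuts P z k i.succ) :=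
    mem_Ico_blockPoint_iff.mp hy
  have hmono := monotone_firstCuts hz k
  rcases lt_or_ge i 2 with hi | hi
  · have hmid : firstCuts P z k i.succ ≤ P.pval k z := hmono (b := 2) (Fin.le_def.mpr hi)
    have hside : y ∈ firstSide P z k :=
      Or.inl ⟨(hmono (Fin.zero_le _)).trans hle, hlt.trans_le hmid⟩
    simp only [mem_firstSide_iff_of_mem hside, notMem_secondSide hside, hi, hi.not_ge, and_true,
      and_false]
  · have hmid : P.pval k z ≤ firstCuts P z k i.castSucc := hmono (a := 2) (Fin.le_def.mpr hi)
    have hside : y ∈ secondSide P z k :=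
      Or.inl ⟨hmid.trans hle, hlt.trans_le (hmono (Fin.le_last _))⟩
    simp only [mem_secondSide_iff_of_mem hside, notMem_firstSide hside, hi, hi.not_gt, and_true,
      and_false]

theorem mem_sides_iff_of_mem_E₂ {k : ℕ+} {i : Fin 2}
    (hy : y ∈ Ico ((Cell.E₂ k i).left P z) ((Cell.E₂ k i).right P z)) (k' : ℕ+) :
    (y ∈ firstSide P z k' ↔ k' = k ∧ i = 0) ∧ (y ∈ secondSide P z k' ↔ k' = k ∧ i = 1) := by
  have ht := mem_Ico_blockPoint_iff.mp hy
  fin_cases i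
  · have hside : y ∈ firstSide P z k := Or.inr ht
    simp [mem_firstSide_iff_of_mem hside, notMem_secondSide hside]
  · have hside : y ∈ secondSide P z k := Or.inr ht
    simp [mem_secondSide_iff_of_mem hside, notMem_firstSide hside]

theorem tileCE_eq_eval_edgePoly {j : Fin 3} (hz : P.Feasible z) (hx : 0 ≤ x)
    (hj : ⌊3 * x⌋ = (j : ℕ)) (hd : d.part = .core .E) (hy : y ∈ Ico (d.left P z) (d.right P z))
    (hyz : y ∉ jumpSet P z) :
    tileCE P z x y = MvPolynomial.eval z.val (edgePoly (.C (coord (3 * x)) j) d) := by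
  classical
  have hj₀ : ⌊3 * x⌋ = 0 ↔ j = 0 := by rw [hj]; fin_cases j <;> decide
  have hj₁ : ⌊3 * x⌋ = 1 ↔ j = 1 := by rw [hj]; fin_cases j <;> decide
  rw [tileCE_eq_of_notMem_jumpSet hx hyz]
  cases d with
  | E₁ k i =>
    obtain ⟨h₁, h₂⟩ := mem_sides_iff_of_mem_E₁ hz hy (coord (3 * x))
    rw [edgePoly, eval_ite_one_zero]
    refine if_congr ?_ rfl rfl
    rw [h₁, h₂, hj₀, hj₁]
    tauto
  | E₂ k i =>
    obtain ⟨h₁, h₂⟩ := mem_sides_iff_of_mem_E₂ hy (coord (3 * x))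
    rw [edgePoly, eval_ite_one_zero]
    refine if_congr ?_ rfl rfl
    rw [h₁, h₂, hj₀, hj₁]
    tauto
  | E₃ k =>
    have hfloor : ⌊3 * y⌋ = 2 := (mem_Ico_blockStart_iff.mp hy).1
    have hsides := notMem_sides (P := P) (z := z) (y := y) (by rw [hfloor]; decide)
      (coord (3 * x))
    simp only [hsides.1, hsides.2, and_false, or_false, if_false]
    exact (map_zero _).symm
  | _ => exact absurd hd nofun

theorem tile_C_E_eq_eval_edgePoly (hz : P.Feasible z) (hc : c.part = .core .C)
    (hd : d.part = .core .E) (hx : x ∈ Ico (c.left P z) (c.right P z))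
    (hy : y ∈ Ico (d.left P z) (d.right P z)) (hyz : y ∉ jumpSet P z) :
    tile P W₀ z (.core .C) (.core .E) x y = MvPolynomial.eval z.val (edgePoly c d) := by
  have hx₀ := (Cell.mem_unit_of_mem_Ico hz hx).1
  cases c with
  | C k j =>
    obtain ⟨hj, rfl⟩ := mem_Ico_blockStart_iff.mp hx
    exact tileCE_eq_eval_edgePoly hz hx₀ hj hd hy hyz
  | _ => exact absurd hc nofun

theorem tile_C_C_eq_eval_edgePoly (hz : P.Feasible z) (hc : c.part = .core .C)
    (hd : d.part = .core .C) (hx : x ∈ Ico (c.left P z) (c.right P z))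
    (hy : y ∈ Ico (d.left P z) (d.right P z)) :
    tile P W₀ z (.core .C) (.core .C) x y = MvPolynomial.eval z.val (edgePoly c d) := by
  have hx₀ := (Cell.mem_unit_of_mem_Ico hz hx).1
  have hy₀ := (Cell.mem_unit_of_mem_Ico hz hy).1
  cases c <;> cases hc
  cases d <;> cases hd
  obtain ⟨hj, rfl⟩ := mem_Ico_blockStart_iff.mp hx
  obtain ⟨hj', rfl⟩ := mem_Ico_blockStart_iff.mp hy
  exact tileCC_eq_eval_edgePoly hx₀ hy₀ hj hj'

theorem WP_embed_eq_eval_edgePoly (hW₀ : IsGraphon W₀) (hz : P.Feasible z) (hc : c.InCE)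
    (hd : d.InCE) (hx : x ∈ Ico (c.left P z) (c.right P z))
    (hy : y ∈ Ico (d.left P z) (d.right P z)) (hxz : x ∉ jumpSet P z) (hyz : y ∉ jumpSet P z) :
    WP P W₀ z (c.part.embed x) (d.part.embed y) = MvPolynomial.eval z.val (edgePoly c d) := by
  have hxu := Cell.mem_unit_of_mem_Ico hz hx
  have hyu := Cell.mem_unit_of_mem_Ico hz hy
  rw [WP_embed _ _ _ _ _ hxu hyu]
  rcases Cell.part_of_inCE hc with hc' | hc' <;> rcases Cell.part_of_inCE hd with hd' | hd' <;>
    rw [hc', hd']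
  · exact tile_C_C_eq_eval_edgePoly hz hc' hd' hx hy
  · exact tile_C_E_eq_eval_edgePoly hz hc' hd' hx hy hyz
  · rw [tile_comm hW₀ z _ _ hxu hyu, edgePoly_comm_of_part_eq hc' hd']
    exact tile_C_E_eq_eval_edgePoly hz hd' hc' hy hx hxz
  · rw [edgePoly_eq_zero_of_part_eq hc' hd', map_zero]
    rfl

end Edges

/-! ### Labeled densities -/

section Agreement

variable {V α : Type*} {W : α → α → ℝ}

open Classical in
/-- The conditional probability that the `W`-random graph on the points `x` agrees with `H` on the
pairs of vertices in `S`. Its integral is the labeled density if `S` lists all pairs. -/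
def agreementProb (H : SimpleGraph V) (S : Finset (V × V)) (W : α → α → ℝ) (x : V → α) : ℝ :=
  ∏ q ∈ S, if H.Adj q.1 q.2 then W (x q.1) (x q.2) else 1 - W (x q.1) (x q.2)

theorem agreementProb_mem (H : SimpleGraph V) (S : Finset (V × V)) {x : V → α}
    (h : ∀ v w, W (x v) (x w) ∈ Icc 0 1) : agreementProb H S W x ∈ Icc 0 1 := by
  classical
  have hfactor : ∀ q ∈ S,
      (if H.Adj q.1 q.2 then W (x q.1) (x q.2) else 1 - W (x q.1) (x q.2)) ∈ Icc 0 1 := by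
    intro q _
    split_ifs
    exacts [h _ _, one_sub_mem_Icc (h _ _)]
  exact ⟨Finset.prod_nonneg fun q hq => (hfactor q hq).1,
    Finset.prod_le_one (fun q hq => (hfactor q hq).1) fun q hq => (hfactor q hq).2⟩

theorem agreementProb_congr (H : SimpleGraph V) (S : Finset (V × V)) {W' : α → α → ℝ} {x : V → α}
    (h : ∀ v w, W (x v) (x w) = W' (x v) (x w)) :
    agreementProb H S W x = agreementProb H S W' x := by
  simp only [agreementProb, h]

theorem measurable_agreementProb [MeasurableSpace α] (H : SimpleGraph V) (S : Finset (V × V))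
    (hW : Measurable fun q : α × α => W q.1 q.2) : Measurable (agreementProb H S W) := by
  refine Finset.measurable_fun_prod _ fun q _ => ?_
  have hpair : Measurable fun x : V → α => W (x q.1) (x q.2) :=
    hW.comp (f := fun x : V → α => (x q.1, x q.2))
      ((measurable_pi_apply q.1).prodMk (measurable_pi_apply q.2))
  split_ifs
  · exact hpair
  · exact measurable_const.sub hpair

end Agreement

section Labeling

variable {P : BoundingSequence} {W₀ : ℝ → ℝ → ℝ} {z : Cube} {n : ℕ} (H : SimpleGraph (Fin n))

theorem measurableSet_unitBox (n : ℕ) : MeasurableSet (unitBox n) :=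
  MeasurableSet.univ_pi fun _ => measurableSet_Ico

theorem volume_unitBox (n : ℕ) : volume (unitBox n) = 1 := by
  simp [unitBox, volume_pi_pi]

theorem integrableOn_agreementProb {W : ℝ → ℝ → ℝ} (hW : IsGraphon W)
    (S : Finset (Fin n × Fin n)) : IntegrableOn (agreementProb H S W) (unitBox n) := by
  obtain ⟨W₁, hW₁, heq⟩ := hW.exists_measurable
  have hcongr : EqOn (agreementProb H S W₁) (agreementProb H S W) (unitBox n) := fun x hx =>
    agreementProb_congr H S fun v w => (heq _ (hx v trivial) _ (hx w trivial)).symm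
  refine IntegrableOn.congr_fun ?_ hcongr (measurableSet_unitBox n)
  refine Measure.integrableOn_of_bounded (M := 1) (by simp [volume_unitBox])
    (measurable_agreementProb H S hW₁).aestronglyMeasurable ?_
  refine (ae_restrict_iff' (measurableSet_unitBox n)).mpr (Filter.Eventually.of_forall ?_)
  intro x hx
  have hmem := agreementProb_mem H S fun v w => hW.mem _ (hx v trivial) _ (hx w trivial)
  rw [hcongr hx, Real.norm_of_nonneg hmem.1]
  exact hmem.2

theorem abs_outerProb_le_one (hW₀ : IsGraphon W₀) (L : Fin n → Cell) :
    |outerProb P W₀ H L| ≤ 1 := by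
  have hmem : outerProb P W₀ H L ∈ Icc 0 1 :=
    setIntegral_mem_Icc (measurableSet_unitBox n) (volume_unitBox n).le fun x hx =>
      agreementProb_mem H _ (x := fun v => (L v).point P (x v)) fun v w =>
        (isGraphon_WP hW₀ P _).mem _ ((L v).point_mem (hx v trivial)) _
          ((L w).point_mem (hx w trivial))
  exact abs_le.mpr ⟨neg_one_lt_zero.le.trans hmem.1, hmem.2⟩

theorem setIntegral_pi_carrier (hz : P.Feasible z) (L : Fin n → Cell) (F : (Fin n → ℝ) → ℝ) :
    ∫ x in univ.pi fun v => (L v).carrier P z, F x =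
      MvPolynomial.eval z.val (∏ v, (L v).measurePoly P) *
        ∫ t in unitBox n, F fun v => (L v).part.embed ((L v).coordAt P z (t v)) := by
  have hle : ∀ v, (L v).part.embed ((L v).left P z) ≤ (L v).part.embed ((L v).right P z) :=
    fun v => add_le_add_right
      (mul_le_mul_of_nonneg_left ((L v).left_le_right hz) (L v).part.size_pos.le) _
  have hlength : ∀ v, (L v).part.embed ((L v).right P z) - (L v).part.embed ((L v).left P z) =
      MvPolynomial.eval z.val ((L v).measurePoly P) := fun v => by
    rw [← Cell.size_mul_right_sub_left, Part.embed, Part.embed]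
    ring
  have hpoint : ∀ v (s : ℝ), (L v).part.embed ((L v).left P z) +
      MvPolynomial.eval z.val ((L v).measurePoly P) * s =
        (L v).part.embed ((L v).coordAt P z s) := fun v s => by
    rw [← Cell.size_mul_right_sub_left, Part.embed, Part.embed, Cell.coordAt]
    ring
  unfold Cell.carrier
  rw [integral_pi_Ico hle, map_prod]
  simp only [hlength, hpoint]
  rfl

theorem ae_regular (hz : P.Feasible z) {L : Fin n → Cell}
    (hL : ∀ v, (L v).left P z < (L v).right P z) :
    ∀ᵐ t : Fin n → ℝ, ∀ v, (L v).Regular P z (t v) := by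
  refine ae_all_iff.mpr fun v => ?_
  have hcoord : ∀ᵐ s, (L v).Regular P z s :=
    (Cell.countable_setOf_not_regular hz (hL v)).measure_zero volume
  exact (Measure.quasiMeasurePreserving_eval (fun _ => volume) v).ae hcoord

open Classical in
theorem agreementProb_embed_coordAt (hW₀ : IsGraphon W₀) (hz : P.Feasible z) {L : Fin n → Cell}
    (hL : ∀ v, (L v).left P z < (L v).right P z) {t : Fin n → ℝ} (ht : t ∈ unitBox n)
    (hreg : ∀ v, (L v).Regular P z (t v)) (S : Finset (Fin n × Fin n)) :
    agreementProb H S (WP P W₀ z) (fun v => (L v).part.embed ((L v).coordAt P z (t v))) =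
      MvPolynomial.eval z.val (∏ q ∈ S.filter fun q => (L q.1).InCE ∧ (L q.2).InCE,
        if H.Adj q.1 q.2 then edgePoly (L q.1) (L q.2) else 1 - edgePoly (L q.1) (L q.2)) *
      agreementProb H (S.filter fun q => ¬ ((L q.1).InCE ∧ (L q.2).InCE))
        (WP P W₀ fun _ => 0) fun v => (L v).point P (t v) := by
  have hunit : ∀ v, t v ∈ Ico 0 1 := fun v => ht v trivial
  have hmem : ∀ v, (L v).coordAt P z (t v) ∈ Ico ((L v).left P z) ((L v).right P z) := fun v =>
    affine_mem_Ico (hL v) (hunit v)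
  rw [agreementProb, ← Finset.prod_filter_mul_prod_filter_not S
    fun q => (L q.1).InCE ∧ (L q.2).InCE, map_prod]
  congr 1 <;> refine Finset.prod_congr rfl fun q hq => ?_
  · obtain ⟨-, h₁, h₂⟩ := Finset.mem_filter.mp hq
    rw [WP_embed_eq_eval_edgePoly hW₀ hz h₁ h₂ (hmem q.1) (hmem q.2) (hreg q.1).1 (hreg q.2).1,
      apply_ite (MvPolynomial.eval z.val), map_sub, map_one]
  · rw [Cell.WP_embed_coordAt_of_not_inCE hW₀ hz (Finset.mem_filter.mp hq).2 (hL q.1) (hL q.2)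
      (hunit q.1) (hunit q.2) (hreg q.1) (hreg q.2)]

theorem setIntegral_agreementProb_pi_carrier (hW₀ : IsGraphon W₀) (hz : P.Feasible z)
    (L : Fin n → Cell) :
    ∫ x in univ.pi fun v => (L v).carrier P z, agreementProb H (vertexPairs n) (WP P W₀ z) x =
      MvPolynomial.eval z.val (labeledPoly P W₀ H L) := by
  rw [setIntegral_pi_carrier hz, labeledPoly, map_mul, map_mul, MvPolynomial.eval_C]
  by_cases hL : ∀ v, (L v).left P z < (L v).right P z
  · have hcongr := setIntegral_congr_ae (measurableSet_unitBox n) <|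
      (ae_regular hz hL).mono fun t hreg ht =>
        agreementProb_embed_coordAt H hW₀ hz hL ht hreg (vertexPairs n)
    rw [hcongr, integral_const_mul, outerProb]
    simp only [agreementProb]
    ring
  · obtain ⟨v, hv⟩ := not_forall.mp hL
    have hnull : MvPolynomial.eval z.val (∏ v, (L v).measurePoly P) = 0 := by
      rw [map_prod]
      refine Finset.prod_eq_zero (Finset.mem_univ v) ?_
      rw [← Cell.size_mul_right_sub_left, ((L v).left_le_right hz).antisymm (not_lt.mp hv),
        sub_self, mul_zero]
    rw [hnull, zero_mul, mul_zero, zero_mul]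

theorem hasSum_labeledDensity (hW₀ : IsGraphon W₀) (hz : P.Feasible z) :
    HasSum (fun L : Fin n → Cell => MvPolynomial.eval z.val (labeledPoly P W₀ H L))
      (labeledDensity H (WP P W₀ z)) := by
  have hbox : unitBox n = ⋃ L : Fin n → Cell, univ.pi fun v => (L v).carrier P z := by
    ext x
    simp only [unitBox, ← Cell.iUnion_carrier hz, mem_iUnion, mem_univ_pi]
    exact Classical.skolem
  have hmeas : ∀ L : Fin n → Cell, MeasurableSet (univ.pi fun v => (L v).carrier P z) := fun _ =>
    MeasurableSet.univ_pi fun _ => measurableSet_Ico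
  have hdisj : Pairwise (Function.onFun Disjoint fun L : Fin n → Cell =>
      univ.pi fun v => (L v).carrier P z) := fun L L' hne =>
    have ⟨v, hv⟩ := Function.ne_iff.mp hne
    disjoint_univ_pi.mpr ⟨v, Cell.disjoint_carrier hz hv⟩
  have hint := integrableOn_agreementProb H (isGraphon_WP hW₀ P z) (vertexPairs n)
  have hsum := hasSum_integral_iUnion hmeas hdisj (hbox ▸ hint)
  simp only [← hbox, setIntegral_agreementProb_pi_carrier H hW₀ hz] at hsum
  exact hsum

end Labeling

/-! ### The functions `t_{P,H}` -/

section Series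

variable {P : BoundingSequence} {W₀ : ℝ → ℝ → ℝ} {n : ℕ} {H : SimpleGraph (Fin n)}

theorem tFun_eq_seriesSum (z : Cube) : tFun P W₀ H z =
    seriesSum (fun A => ∑' L : Fin n → Cell, (labeledPoly P W₀ H L).coeff A) z.val :=
  multisetEquiv.tsum_eq fun A =>
    (∑' L : Fin n → Cell, (labeledPoly P W₀ H L).coeff A) * monomialValue A z

theorem summable_alpha (h : OverConvergent fun A =>
    ∑' L : Fin n → Cell, (labeledPoly P W₀ H L).coeff A) (z : Cube) :
    Summable fun i : ℕ+ => alpha P W₀ H i * monomialValue (multiset i) z :=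
  (multisetEquiv.summable_iff (f := fun A =>
    (∑' L : Fin n → Cell, (labeledPoly P W₀ H L).coeff A) * monomialValue A z)).mpr
      (h.summable_mul_evalMonomial z.abs_val_le_one)

end Series

end

end GraphonFamily

theorem mainTheorem4_general {n : ℕ} (H : SimpleGraph (Fin n)) (P : BoundingSequence)
    {W₀ : ℝ → ℝ → ℝ} (hW₀ : IsGraphon W₀) :
    (∀ i : ℕ+, Summable fun L : Fin n → Cell =>
      (labeledPoly P W₀ H L).coeff (multiset i)) ∧
    (∀ z : Cube, Summable fun i : ℕ+ => alpha P W₀ H i * monomialValue (multiset i) z) ∧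
    TotallyAnalytic (tFun P W₀ H) ∧
    (∀ z : Cube, IsGraphon (WP P W₀ z)) ∧
    ∀ z : Cube, P.Feasible z → tFun P W₀ H z = labeledDensity H (WP P W₀ z) := by
  obtain ⟨r, hr, hsum⟩ := exists_summable_polydiscNorm_labeledPoly P W₀ H
    (abs_outerProb_le_one H hW₀)
  have hradius : ∀ k, 1 < geometricRadius r k := one_lt_geometricRadius hr
  have hconv := overConvergent_tsum_coeff hradius hsum
  refine ⟨fun i => ?_, summable_alpha hconv, ?_, isGraphon_WP hW₀ P, fun z hz => ?_⟩
  · exact summable_coeff_of_summable_polydiscNorm (fun k => (hradius k).le) hsum _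
  · exact funext (tFun_eq_seriesSum (H := H)) ▸ hconv.totallyAnalytic
  · have hz_le : ∀ k, |z.val k| ≤ geometricRadius r k := fun k =>
      (z.abs_val_le_one k).trans (hradius k).le
    rw [tFun_eq_seriesSum, seriesSum_tsum_coeff hz_le hsum]
    exact (hasSum_labeledDensity H hW₀ hz).tsum_eq

theorem mainTheorem4 (n : ℕ) (H : SimpleGraph (Fin n)) (P : BoundingSequence)
    (W₀ : ℝ → ℝ → ℝ) (hW₀ : IsGraphon W₀)
    (hG : ∀ x ∈ Ico (0 : ℝ) 1, ∀ y ∈ Ico (0 : ℝ) 1,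
      W₀ (hostEmbed 6 x) (hostEmbed 6 y) = WF P x y) :
    (∀ i : ℕ+, Summable fun L : Fin n → Cell =>
      (labeledPoly P W₀ H L).coeff (multiset i)) ∧
    (∀ z : Cube, Summable fun i : ℕ+ => alpha P W₀ H i * monomialValue (multiset i) z) ∧
    TotallyAnalytic (tFun P W₀ H) ∧
    (∀ z : Cube, IsGraphon (WP P W₀ z)) ∧
    ∀ z : Cube, P.Feasible z → tFun P W₀ H z = labeledDensity H (WP P W₀ z) :=
  mainTheorem4_general H P hW₀
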